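/- Let $H(5,4)$ be the Hamming graph whose vertices are the words in $\mathbb{F}_4^5$, two words being adjacent if and only if they differ in exactly one position. Let $C\subset\mathbb{F}_4^5$ be the Hamming $[5,3,3]_4$ code, that is, a $3$-dimensional linear subspace of $\mathbb{F}_4^5$ with minimum Hamming distance $3$ (such a code is unique up to equivalence; the statement holds for every one of them). Consider the partitions of the complement $\mathbb{F}_4^5\setminus C$ into $4$-cliques of $H(5,4)$. Call two such partitions equivalent if some automorphism of the graph $H(5,4)$ maps one onto the other, and let the automorphism group of a partition be the group of all automorphisms of $H(5,4)$ that map the partition onto itself. Then there are exactly $168960$ such partitions. They form exactly $11$ equivalence classes, and these can be numbered so that the automorphism groups of the partitions in the classes have orders $1,1,1,1,1,1,2,3,6,6,6$, respectively. -/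

import Mathlib

/-- The Hamming graph on the words `ι → α`: two words are adjacent when they differ in exactly
one position (the Cartesian product of `ι`-many copies of the complete graph on `α`). -/
def hammingGraph (ι α : Type*) [Fintype ι] [DecidableEq α] : SimpleGraph (ι → α) where
  Adj x y := hammingDist x y = 1
  symm := ⟨fun x y h => by rw [hammingDist_comm]; exact h⟩
  loopless := ⟨fun x h => by simp [hammingDist_self] at h⟩

/-- `C` is an `[n, k, d]_q` code, where `n = |ι|` and `q = |F|`: a `k`-dimensional subspace of
`F ^ n` in which the minimum Hamming distance between two different words is `d`. -/
def IsLinearCode {ι F : Type*} [Fintype ι] [Field F] [DecidableEq F]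
    (k d : ℕ) (C : Submodule F (ι → F)) : Prop :=
  Module.finrank F C = k ∧
    IsLeast {m : ℕ | ∃ x ∈ C, ∃ y ∈ C, x ≠ y ∧ hammingDist x y = m} d

namespace SimpleGraph

variable {V : Type*}

/-- `P` is a partition of the vertex set `S` into `k`-cliques of `G`. -/
structure IsCliquePartition (G : SimpleGraph V) (k : ℕ) (S : Set V)
    (P : Set (Finset V)) : Prop where
  isNClique : ∀ A ∈ P, G.IsNClique k A
  subset : ∀ A ∈ P, (A : Set V) ⊆ S
  existsUnique_mem : ∀ x ∈ S, ∃! A, A ∈ P ∧ x ∈ A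

/-- The type of all partitions of the vertex set `S` into `k`-cliques of `G`. -/
def CliquePartition (G : SimpleGraph V) (k : ℕ) (S : Set V) : Type _ :=
  {P : Set (Finset V) // G.IsCliquePartition k S P}

/-- The image of a family of vertex sets under an automorphism of the graph. -/
def mapFamily {G : SimpleGraph V} (φ : G ≃g G) (P : Set (Finset V)) : Set (Finset V) :=
  (fun A : Finset V => A.map φ.toEquiv.toEmbedding) '' P

theorem mapFamily_one {G : SimpleGraph V} (P : Set (Finset V)) :
    mapFamily (1 : G ≃g G) P = P := by
  have h : (fun A : Finset V => A.map (1 : G ≃g G).toEquiv.toEmbedding) = id := by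
    funext A
    ext x
    simp only [Finset.mem_map_equiv]
    exact Iff.rfl
  rw [mapFamily, h, Set.image_id]

theorem mapFamily_mul {G : SimpleGraph V} (φ ψ : G ≃g G) (P : Set (Finset V)) :
    mapFamily (φ * ψ) P = mapFamily φ (mapFamily ψ P) := by
  rw [mapFamily, mapFamily, mapFamily, Set.image_image]
  congr 1
  funext A
  ext x
  simp only [Finset.mem_map_equiv]
  exact Iff.rfl

/-- The automorphism group of a family of vertex sets: all automorphisms of the graph that map
the family onto itself. -/
def familyAut (G : SimpleGraph V) (P : Set (Finset V)) : Subgroup (G ≃g G) where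
  carrier := {φ | mapFamily φ P = P}
  one_mem' := mapFamily_one P
  mul_mem' := by
    intro φ ψ hφ hψ
    change mapFamily (φ * ψ) P = P
    rw [mapFamily_mul, hψ, hφ]
  inv_mem' := by
    intro φ hφ
    change mapFamily φ⁻¹ P = P
    have h : mapFamily φ P = P := hφ
    conv_lhs => rw [← h]
    rw [← mapFamily_mul, inv_mul_cancel, mapFamily_one]

/-- Two clique partitions of `S` are equivalent when some automorphism of the graph maps one onto
the other (such an automorphism necessarily maps `S` onto itself when the cliques are
nonempty). -/
def cliquePartitionSetoid (G : SimpleGraph V) (k : ℕ) (S : Set V) :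
    Setoid (G.CliquePartition k S) where
  r P Q := ∃ φ : G ≃g G, mapFamily φ P.1 = Q.1
  iseqv :=
    { refl := fun P => ⟨1, mapFamily_one P.1⟩
      symm := by
        rintro P Q ⟨φ, h⟩
        exact ⟨φ⁻¹, by rw [← h, ← mapFamily_mul, inv_mul_cancel, mapFamily_one]⟩
      trans := by
        rintro P Q R ⟨φ, h⟩ ⟨ψ, h'⟩
        exact ⟨ψ * φ, by rw [mapFamily_mul, h, h']⟩ }

end SimpleGraph

/-! A 4-clique of H(5,4) is a line, the set of words obtained by varying one position
(`eq_hammingLine_of_isNClique`). A partition of the complement of C into 4-cliques is therefore the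
same as a direction function: every word outside C chooses a position such that the line in this
direction avoids C and all its words make the same choice (`IsDirection`). The automorphisms of the
graph are the position permutations combined with letter permutations in each position
(`exists_eq_isotopy`). One that carries a partition of the complement to another must preserve C, so
the equivalence classes are the orbits of the stabilizer of C.

No nonzero codeword has weight below 3. Hence, after rescaling the letters in each position, every
[5,3,3] code over the field with four elements becomes one model code
(`IsLinearCode.exists_isotopy`). The result for the model is carried back along this isomorphism of
graphs.

The stabilizer of the model consists of 64 translations by codewords times 360 symmetries fixing the
zero word. Here 360 = 120 · 3: every permutation of the positions occurs, the image of the letter 1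
in position 0 can be any nonzero letter (`exists_symmetry`), and these data determine the symmetry
(`letters_eq_self`). The order is 23040.

The classification is a finite search with certificates. After the directions of a few words are
prescribed, constraints propagate: a word with one remaining candidate fixes a line, and every other
line meeting it is discarded. Each branch ends in a contradiction or enforces a symmetric image of
an earlier list of prescriptions. In this way the empty list reduces to eleven lists
(`search_sound`, `direction_induction`), each of which determines an explicit partition by
propagation alone (`eq_rep_of_satisfies`). This gives at most eleven classes.

Since a partition is determined by its list, an automorphism maps one of the eleven partitions to
another as soon as it does so on the list (`moves_iff`). Testing all 23040 automorphisms shows that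
the eleven are inequivalent and yields their automorphism groups (`mem_stabilizer_of_moves`). The
orbit-stabilizer theorem then gives 6 · 23040 + 11520 + 7680 + 3 · 3840 = 168960 partitions. -/

open Function

/-! ### Lines, cliques and isotopies of Hamming graphs -/

section Hamming

variable {ι α β : Type*} [Fintype ι] [DecidableEq ι] [DecidableEq α] [DecidableEq β]

theorem hammingGraph_adj_iff {x y : ι → α} :
    (hammingGraph ι α).Adj x y ↔ ∃ i, x i ≠ y i ∧ ∀ j, j ≠ i → x j = y j := by
  change hammingDist x y = 1 ↔ _
  rw [hammingDist, Finset.card_eq_one]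
  constructor
  · rintro ⟨i, hi⟩
    refine ⟨i, ?_, fun j hj => ?_⟩
    · have : i ∈ ({i} : Finset ι) := Finset.mem_singleton_self i
      rw [← hi] at this
      simpa using this
    · by_contra h
      have : j ∈ Finset.univ.filter fun i => x i ≠ y i := by simpa using h
      rw [hi, Finset.mem_singleton] at this
      exact hj this
  · rintro ⟨i, hi, h⟩
    refine ⟨i, ?_⟩
    ext j
    simp only [Finset.mem_filter, Finset.mem_univ, true_and, Finset.mem_singleton]
    constructor
    · intro hj
      by_contra hne
      exact hj (h j hne)
    · rintro rfl
      exact hi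

/-- The line through the word `x` in direction `i`. -/
def hammingLine [Fintype α] (x : ι → α) (i : ι) : Finset (ι → α) :=
  Finset.univ.image (update x i)

theorem mem_hammingLine [Fintype α] {x y : ι → α} {i : ι} :
    y ∈ hammingLine x i ↔ ∃ v, update x i v = y := by
  simp [hammingLine]

theorem self_mem_hammingLine [Fintype α] (x : ι → α) (i : ι) : x ∈ hammingLine x i :=
  mem_hammingLine.2 ⟨x i, update_eq_self i x⟩

theorem hammingLine_update [Fintype α] (x : ι → α) (i : ι) (v : α) :
    hammingLine (update x i v) i = hammingLine x i := by
  ext y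
  simp [mem_hammingLine]

theorem card_hammingLine [Fintype α] (x : ι → α) (i : ι) :
    (hammingLine x i).card = Fintype.card α := by
  rw [hammingLine, Finset.card_image_of_injective _ (update_injective x i), Finset.card_univ]

theorem hammingLine_direction_inj [Fintype α] [Nontrivial α] {x : ι → α} {i j : ι}
    (h : hammingLine x i = hammingLine x j) : i = j := by
  by_contra hne
  obtain ⟨v, hv⟩ := exists_ne (x i)
  have hm : update x i v ∈ hammingLine x j := h ▸ mem_hammingLine.2 ⟨v, rfl⟩
  obtain ⟨w, hw⟩ := mem_hammingLine.1 hm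
  have := congrFun hw i
  rw [update_self, update_of_ne hne] at this
  exact hv this.symm

theorem isNClique_hammingLine [Fintype α] (x : ι → α) (i : ι) :
    (hammingGraph ι α).IsNClique (Fintype.card α) (hammingLine x i) := by
  refine ⟨?_, card_hammingLine x i⟩
  intro y hy z hz hyz
  obtain ⟨v, rfl⟩ := mem_hammingLine.1 (Finset.mem_coe.1 hy)
  obtain ⟨w, rfl⟩ := mem_hammingLine.1 (Finset.mem_coe.1 hz)
  refine hammingGraph_adj_iff.2 ⟨i, ?_, fun j hj => by simp [hj]⟩
  intro h
  apply hyz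
  rw [update_self, update_self] at h
  rw [h]

/-- In a Hamming graph every clique with as many vertices as letters is a line. -/
theorem eq_hammingLine_of_isNClique [Fintype α] [Nontrivial α] {A : Finset (ι → α)}
    (hA : (hammingGraph ι α).IsNClique (Fintype.card α) A) {x : ι → α} (hx : x ∈ A) :
    ∃ i, A = hammingLine x i := by
  have h1 : 1 < A.card := by rw [hA.card_eq]; exact Fintype.one_lt_card
  obtain ⟨y, hy, hyx⟩ := Finset.exists_mem_ne h1 x
  obtain ⟨i, hi, hxy⟩ := hammingGraph_adj_iff.1 (hA.isClique hx hy hyx.symm)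
  refine ⟨i, Finset.eq_of_subset_of_card_le ?_ ?_⟩
  · intro z hz
    refine mem_hammingLine.2 ⟨z i, ?_⟩
    by_cases hzx : z = x
    · rw [hzx, update_eq_self]
    by_cases hzy : z = y
    · subst hzy
      ext j
      by_cases hj : j = i
      · subst hj; simp
      · simp [hj, hxy j hj]
    obtain ⟨j, hj, hxz⟩ := hammingGraph_adj_iff.1 (hA.isClique hx hz (Ne.symm hzx))
    obtain ⟨k, hk, hyz⟩ := hammingGraph_adj_iff.1 (hA.isClique hy hz (Ne.symm hzy))
    -- If `j ≠ i`, then `y` and `z` differ both in position `i` (where `z` agrees with `x`) and in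
    -- position `j` (where `y` agrees with `x`), so they are not adjacent.
    have hji : j = i := by
      by_contra hne
      have e1 : x i = z i := hxz i (Ne.symm hne)
      have e2 : x j = y j := hxy j hne
      have k1 : i = k := by
        by_contra hik
        exact hi (e1.trans (hyz i hik).symm)
      have k2 : j = k := by
        by_contra hjk
        exact hj (e2.trans (hyz j hjk))
      exact hne (k2.trans k1.symm)
    subst hji
    ext l
    by_cases hl : l = j
    · subst hl; simp
    · simp [hl, hxz l hl]
  · rw [card_hammingLine, hA.card_eq]

/-- The isomorphism of Hamming graphs that applies the bijection `f i` to the letter in position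
`i` and moves it to position `p i`. -/
def isotopy (p : Equiv.Perm ι) (f : ι → α ≃ β) : hammingGraph ι α ≃g hammingGraph ι β where
  toFun x j := f (p.symm j) (x (p.symm j))
  invFun y i := (f i).symm (y (p i))
  left_inv x := by ext i; simp
  right_inv y := by ext j; simp
  map_rel_iff' := by
    intro x y
    simp only [hammingGraph_adj_iff, Equiv.coe_fn_mk]
    constructor
    · rintro ⟨j, hj, h⟩
      refine ⟨p.symm j, fun e => hj (by rw [e]), fun i hi => ?_⟩
      have := h (p i) (by rintro rfl; simp at hi)
      simpa using this
    · rintro ⟨i, hi, h⟩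
      refine ⟨p i, by simpa using hi, fun j hj => ?_⟩
      rw [h (p.symm j) (by rintro rfl; simp at hj)]

theorem isotopy_apply (p : Equiv.Perm ι) (f : ι → α ≃ β) (x : ι → α) (j : ι) :
    isotopy p f x j = f (p.symm j) (x (p.symm j)) := rfl

theorem isotopy_apply_perm (p : Equiv.Perm ι) (f : ι → α ≃ β) (x : ι → α) (i : ι) :
    isotopy p f x (p i) = f i (x i) := by
  simp [isotopy_apply]

theorem isotopy_symm_apply (p : Equiv.Perm ι) (f : ι → α ≃ β) (y : ι → β) (i : ι) :
    (isotopy p f).symm y i = (f i).symm (y (p i)) := rfl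

theorem isotopy_update (p : Equiv.Perm ι) (f : ι → α ≃ β) (x : ι → α) (i : ι) (v : α) :
    isotopy p f (update x i v) = update (isotopy p f x) (p i) (f i v) := by
  ext j
  obtain ⟨k, rfl⟩ := p.surjective j
  rw [isotopy_apply_perm]
  by_cases hk : k = i
  · subst hk; simp
  · rw [update_of_ne hk, update_of_ne (p.injective.ne hk), isotopy_apply_perm]

theorem map_hammingLine [Fintype α] [Fintype β] (p : Equiv.Perm ι) (f : ι → α ≃ β) (x : ι → α)
    (i : ι) : (hammingLine x i).map (isotopy p f).toEquiv.toEmbedding =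
      hammingLine (isotopy p f x) (p i) := by
  ext y
  simp only [Finset.mem_map, mem_hammingLine]
  constructor
  · rintro ⟨_, ⟨v, rfl⟩, rfl⟩
    exact ⟨f i v, (isotopy_update p f x i v).symm⟩
  · rintro ⟨w, rfl⟩
    refine ⟨_, ⟨(f i).symm w, rfl⟩, ?_⟩
    have := isotopy_update p f x i ((f i).symm w)
    rw [Equiv.apply_symm_apply] at this
    exact this

/-- An automorphism of a Hamming graph that fixes a word and all its neighbours is trivial. -/
theorem hammingGraph_iso_eq_of_fix (θ : hammingGraph ι α ≃g hammingGraph ι α) (o : ι → α)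
    (h : ∀ i v, θ (update o i v) = update o i v) (x : ι → α) : θ x = x := by
  induction hn : hammingDist o x using Nat.strong_induction_on generalizing x with
  | _ n ih =>
    -- Induction on the distance from `o`. Distances 0 and 1 are the hypothesis; otherwise `x`
    -- differs from `o` in two positions `i`, `j`, and resetting either or both of them gives words
    -- that are already known to be fixed.
    have fix_of_closer : ∀ i, o i ≠ x i → θ (update x i (o i)) = update x i (o i) := by
      intro i hi
      refine ih _ ?_ _ rfl
      rw [← hn]
      refine Finset.card_lt_card (Finset.ssubset_iff.2 ⟨i, ?_, ?_⟩)
      · simp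
      · intro j hj
        rcases Finset.mem_insert.1 hj with rfl | hj
        · simpa using hi
        · have hji : j ≠ i := by rintro rfl; simp at hj
          simpa [hji] using hj
    by_cases h0 : ∃ i, o i ≠ x i
    swap
    · push Not at h0
      have hox : o = x := funext h0
      subst hox
      rcases isEmpty_or_nonempty ι with hι | ⟨⟨i⟩⟩
      · exact Subsingleton.elim _ _
      · simpa using h i (o i)
    obtain ⟨i, hi⟩ := h0
    by_cases h1 : ∃ j, j ≠ i ∧ o j ≠ x j
    swap
    · push Not at h1
      have : x = update o i (x i) := by
        ext j
        by_cases hj : j = i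
        · subst hj; simp
        · simp [hj, h1 j hj]
      rw [this]
      exact h i _
    obtain ⟨j, hji, hj⟩ := h1
    have hy := fix_of_closer i hi
    have hz := fix_of_closer j hj
    have adj_y : (hammingGraph ι α).Adj x (update x i (o i)) :=
      hammingGraph_adj_iff.2 ⟨i, by simpa using hi.symm, fun k hk => by simp [hk]⟩
    have adj_z : (hammingGraph ι α).Adj x (update x j (o j)) :=
      hammingGraph_adj_iff.2 ⟨j, by simpa using hj.symm, fun k hk => by simp [hk]⟩
    have hw : θ (update (update x i (o i)) j (o j)) = update (update x i (o i)) j (o j) := by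
      refine ih _ ?_ _ rfl
      rw [← hn]
      refine Finset.card_lt_card (Finset.ssubset_iff.2 ⟨i, ?_, ?_⟩)
      · simp [hji.symm]
      · intro k hk
        rcases Finset.mem_insert.1 hk with rfl | hk
        · simpa using hi
        · have hkj : k ≠ j := by rintro rfl; simp at hk
          have hki : k ≠ i := by rintro rfl; simp [hkj] at hk
          simpa [hkj, hki] using hk
    have ay := θ.map_adj_iff.2 adj_y
    have az := θ.map_adj_iff.2 adj_z
    rw [hy] at ay
    rw [hz] at az
    -- The two words obtained by one reset have exactly two common neighbours: `x` and the word with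
    -- both resets. The image `θ x` is a common neighbour, and it is not the second one, which is
    -- itself fixed.
    have nw : θ x ≠ update (update x i (o i)) j (o j) := by
      intro e
      have := θ.injective (e.trans hw.symm)
      have := congrFun this j
      rw [update_self] at this
      exact hj this.symm
    obtain ⟨a, ha, hya⟩ := hammingGraph_adj_iff.1 ay
    obtain ⟨b, hb, hzb⟩ := hammingGraph_adj_iff.1 az
    have off : ∀ k, k ≠ i → k ≠ j → θ x k = x k := by
      intro k hki hkj
      by_cases hka : k = a
      · subst hka
        by_cases hkb : k = b
        · subst hkb
          exfalso
          have e1 := hya i hki.symm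
          have e2 := hzb i hki.symm
          rw [update_self] at e1
          rw [update_of_ne hji.symm] at e2
          exact hi (e1.symm.trans e2)
        · simpa [hkj] using hzb k hkb
      · simpa [hki] using hya k hka
    have hi' : θ x i = x i ∨ θ x i = o i := by
      by_cases hia : i = a
      · subst hia
        by_cases hib : i = b
        · subst hib
          exfalso
          have e1 := hya j hji
          have e2 := hzb j hji
          rw [update_of_ne hji] at e1
          rw [update_self] at e2
          exact hj (e2.symm.trans e1)
        · left; simpa [hji.symm] using hzb i hib
      · right; simpa using hya i hia
    have hj' : θ x j = x j ∨ θ x j = o j := by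
      by_cases hjb : j = b
      · subst hjb
        by_cases hja : j = a
        · subst hja
          exfalso
          have e1 := hya i hji.symm
          have e2 := hzb i hji.symm
          rw [update_self] at e1
          rw [update_of_ne hji.symm] at e2
          exact hi (e1.symm.trans e2)
        · left; simpa [hji] using hya j hja
      · right; simpa using hzb j hjb
    have key : θ x i = x i ∧ θ x j = x j := by
      rcases hi' with e1 | e1 <;> rcases hj' with e2 | e2
      · exact ⟨e1, e2⟩
      · exfalso
        have : i = a := by
          by_contra hne
          have := hya i hne
          rw [e1, update_self] at this
          exact hi this.symm
        subst this
        have := hya j hji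
        rw [e2, update_of_ne hji] at this
        exact hj this
      · exfalso
        have : j = b := by
          by_contra hne
          have := hzb j hne
          rw [e2, update_self] at this
          exact hj this.symm
        subst this
        have := hzb i hji.symm
        rw [e1, update_of_ne hji.symm] at this
        exact hi this
      · exfalso
        apply nw
        ext k
        by_cases hkj : k = j
        · subst hkj; rw [update_self, e2]
        · rw [update_of_ne hkj]
          by_cases hki : k = i
          · subst hki; rw [update_self, e1]
          · rw [update_of_ne hki, off k hki hkj]
    ext k
    by_cases hki : k = i
    · rw [hki, key.1]
    by_cases hkj : k = j
    · rw [hkj, key.2]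
    exact off k hki hkj

/-- Every automorphism of a Hamming graph permutes the positions and the letters in each
position. -/
theorem exists_eq_isotopy [Fintype α] [Nontrivial α]
    (φ : hammingGraph ι α ≃g hammingGraph ι α) : ∃ p f, φ = isotopy p f := by
  classical
  obtain ⟨a, b, hab⟩ := exists_pair_ne α
  let o : ι → α := fun _ => a
  have adj_o : ∀ i v w, v ≠ w → (hammingGraph ι α).Adj (update o i v) (update o i w) := by
    intro i v w hvw
    exact hammingGraph_adj_iff.2 ⟨i, by simpa using hvw, fun k hk => by simp [hk]⟩
  have upd : ∀ i, update o i a = o := fun i => update_eq_self i o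
  -- The image of a line through `o` is a clique of the same size, hence again a line; `q` is its
  -- direction.
  have dir : ∀ i, ∃ q, ∀ v w, ∀ k, k ≠ q → φ (update o i v) k = φ (update o i w) k := by
    intro i
    have hc' : (hammingGraph ι α).IsNClique (Fintype.card α)
        ((hammingLine o i).map φ.toEquiv.toEmbedding) := by
      refine ⟨?_, by rw [Finset.card_map, card_hammingLine]⟩
      intro y hy z hz hyz
      obtain ⟨y, hy', rfl⟩ := Finset.mem_map.1 (Finset.mem_coe.1 hy)
      obtain ⟨z, hz', rfl⟩ := Finset.mem_map.1 (Finset.mem_coe.1 hz)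
      exact φ.map_adj_iff.2 ((isNClique_hammingLine o i).isClique hy' hz'
        (fun e => hyz (by rw [e])))
    obtain ⟨q, hq⟩ := eq_hammingLine_of_isNClique hc'
      (Finset.mem_map_of_mem _ (self_mem_hammingLine o i))
    refine ⟨q, fun v w k hk => ?_⟩
    have key : ∀ v, φ (update o i v) k = φ o k := by
      intro v
      have hm : φ (update o i v) ∈ (hammingLine o i).map φ.toEquiv.toEmbedding :=
        Finset.mem_map_of_mem φ.toEquiv.toEmbedding (mem_hammingLine.2 ⟨v, rfl⟩)
      rw [hq] at hm
      obtain ⟨u, hu⟩ := mem_hammingLine.1 hm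
      rw [← hu, update_of_ne hk]
      rfl
    rw [key v, key w]
  choose q hq using dir
  -- If the lines through `o` in two directions had images in the same direction, two words at
  -- distance 2 would have adjacent images.
  have q_inj : Injective q := by
    intro i j hij
    by_contra hne
    have hqi : φ (update o i b) (q i) ≠ φ (update o j b) (q i) := by
      intro e
      have : φ (update o i b) = φ (update o j b) := by
        ext k
        by_cases hk : k = q i
        · rw [hk, e]
        · rw [hq i b a k hk, hq j b a k (hij ▸ hk), upd, upd]
      have := congrFun (φ.injective this) i
      rw [update_self, update_of_ne hne] at this
      exact hab this.symm
    have : (hammingGraph ι α).Adj (φ (update o i b)) (φ (update o j b)) := by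
      refine hammingGraph_adj_iff.2 ⟨q i, hqi, fun k hk => ?_⟩
      rw [hq i b a k hk, hq j b a k (hij ▸ hk), upd, upd]
    obtain ⟨k, hk, hk'⟩ := hammingGraph_adj_iff.1 (φ.map_adj_iff.1 this)
    have e1 : i = k := by
      by_contra h
      have := hk' i h
      rw [update_self, update_of_ne hne] at this
      exact hab this.symm
    have e2 : j = k := by
      by_contra h
      have := hk' j h
      rw [update_self, update_of_ne (Ne.symm hne)] at this
      exact hab this
    exact hne (e1.trans e2.symm)
  let p : Equiv.Perm ι := Equiv.ofBijective q (Finite.injective_iff_bijective.1 q_inj)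
  have f_inj : ∀ i, Injective fun v => φ (update o i v) (q i) := by
    intro i v w hvw
    have : φ (update o i v) = φ (update o i w) := by
      ext k
      by_cases hk : k = q i
      · rw [hk]; exact hvw
      · exact hq i v w k hk
    simpa using congrFun (φ.injective this) i
  let f : ι → α ≃ α := fun i =>
    Equiv.ofBijective _ (Finite.injective_iff_bijective.1 (f_inj i))
  have agree : ∀ i v, φ (update o i v) = isotopy p f (update o i v) := by
    intro i v
    ext k
    obtain ⟨j, rfl⟩ := p.surjective k
    rw [isotopy_apply_perm]
    by_cases hj : j = i
    · subst hj
      rw [update_self]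
      rfl
    · rw [update_of_ne hj]
      change φ (update o i v) (q j) = φ (update o j a) (q j)
      rw [hq i v a (q j) (q_inj.ne hj), upd, upd]
  refine ⟨p, f, ?_⟩
  ext x : 1
  -- Following `φ` by the inverse isotopy fixes `o` and all its neighbours, hence everything.
  have := hammingGraph_iso_eq_of_fix (φ.trans (isotopy p f).symm) o
    (fun i v => by rw [RelIso.trans_apply, agree, RelIso.symm_apply_apply]) x
  rw [RelIso.trans_apply] at this
  rw [← RelIso.apply_symm_apply (isotopy p f) (φ x), this]

end Hamming

/-! ### Partitions into lines as direction functions -/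

section Directions

variable {ι α : Type*} [Fintype ι] [DecidableEq ι] [DecidableEq α]

/-- `d` chooses for every word outside `C` the direction of a line that avoids `C`, in such a way
that all words of this line choose the same direction. -/
structure IsDirection (C : Set (ι → α)) (d : (ι → α) → ι) : Prop where
  update_notMem : ∀ x ∉ C, ∀ v, update x (d x) v ∉ C
  update_eq : ∀ x ∉ C, ∀ v, d (update x (d x) v) = d x

/-- This is the direction function of the preimage of the partition under the isotopy; positions are
moved back by `p.symm`. -/
theorem IsDirection.pullback {C : Set (ι → α)} {d : (ι → α) → ι} (hd : IsDirection C d)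
    (p : Equiv.Perm ι) (f : ι → α ≃ α) (hC : ∀ x, isotopy p f x ∈ C ↔ x ∈ C) :
    IsDirection C fun x => p.symm (d (isotopy p f x)) where
  update_notMem x hx v := by
    rw [← hC, isotopy_update, Equiv.apply_symm_apply]
    exact hd.update_notMem _ ((hC x).not.2 hx) _
  update_eq x hx v := by
    rw [isotopy_update, Equiv.apply_symm_apply, hd.update_eq _ ((hC x).not.2 hx)]

variable [Fintype α]

/-- The lines chosen by a direction function. -/
def lineFamily (C : Set (ι → α)) (d : (ι → α) → ι) : Set (Finset (ι → α)) :=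
  {A | ∃ x ∉ C, A = hammingLine x (d x)}

/-- The values of a direction function on `C` carry no information. -/
theorem lineFamily_congr {C : Set (ι → α)} {d d' : (ι → α) → ι} (h : ∀ x ∉ C, d x = d' x) :
    lineFamily C d = lineFamily C d' := by
  ext A
  constructor <;> rintro ⟨x, hx, rfl⟩
  · exact ⟨x, hx, by rw [h x hx]⟩
  · exact ⟨x, hx, by rw [h x hx]⟩

/-- Any word of a chosen line recovers the line, because the direction is constant on it. This makes
distinct chosen lines disjoint. -/
theorem IsDirection.eq_line_of_mem {C : Set (ι → α)} {d : (ι → α) → ι} (hd : IsDirection C d)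
    {A : Finset (ι → α)} (hA : A ∈ lineFamily C d) {x : ι → α} (hx : x ∈ A) :
    x ∉ C ∧ A = hammingLine x (d x) := by
  obtain ⟨y, hy, rfl⟩ := hA
  obtain ⟨v, rfl⟩ := mem_hammingLine.1 hx
  refine ⟨hd.update_notMem y hy v, ?_⟩
  rw [hd.update_eq y hy, hammingLine_update]

theorem IsDirection.isCliquePartition {C : Set (ι → α)} {d : (ι → α) → ι}
    (hd : IsDirection C d) :
    (hammingGraph ι α).IsCliquePartition (Fintype.card α) Cᶜ (lineFamily C d) where
  isNClique := by
    rintro A ⟨x, -, rfl⟩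
    exact isNClique_hammingLine x (d x)
  subset A hA x hx := (hd.eq_line_of_mem hA hx).1
  existsUnique_mem x hx :=
    ⟨hammingLine x (d x), ⟨⟨x, hx, rfl⟩, self_mem_hammingLine _ _⟩,
      fun _ hB => (hd.eq_line_of_mem hB.1 hB.2).2⟩

theorem IsDirection.eq_of_lineFamily_eq [Nontrivial α] {C : Set (ι → α)} {d d' : (ι → α) → ι}
    (hd' : IsDirection C d') (h : lineFamily C d = lineFamily C d') {x : ι → α} (hx : x ∉ C) :
    d x = d' x := by
  have hm : hammingLine x (d x) ∈ lineFamily C d' := h ▸ ⟨x, hx, rfl⟩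
  exact hammingLine_direction_inj (hd'.eq_line_of_mem hm (self_mem_hammingLine _ _)).2

/-- The block through a word is a line, and its direction is the value of `d`; uniqueness of the
block makes `d` constant along it. On `C` the value is arbitrary. -/
theorem SimpleGraph.IsCliquePartition.exists_direction [Nonempty ι] [Nontrivial α]
    {C : Set (ι → α)} {P : Set (Finset (ι → α))}
    (hP : (hammingGraph ι α).IsCliquePartition (Fintype.card α) Cᶜ P) :
    ∃ d, IsDirection C d ∧ P = lineFamily C d := by
  have ex : ∀ x, ∃ i, x ∉ C → hammingLine x i ∈ P := by
    intro x
    by_cases hx : x ∈ C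
    · exact ⟨Classical.arbitrary ι, fun h => absurd hx h⟩
    obtain ⟨A, ⟨hA, hxA⟩, -⟩ := hP.existsUnique_mem x hx
    obtain ⟨i, rfl⟩ := eq_hammingLine_of_isNClique (hP.isNClique A hA) hxA
    exact ⟨i, fun _ => hA⟩
  choose d hd using ex
  have hC : ∀ x ∉ C, ∀ v, update x (d x) v ∉ C := fun x hx v =>
    hP.subset _ (hd x hx) (Finset.mem_coe.2 (mem_hammingLine.2 ⟨v, rfl⟩))
  refine ⟨d, ⟨hC, fun x hx v => ?_⟩, ?_⟩
  · have e := (hP.existsUnique_mem _ (hC x hx v)).unique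
      ⟨hd _ (hC x hx v), self_mem_hammingLine _ _⟩
      ⟨hd x hx, mem_hammingLine.2 ⟨v, rfl⟩⟩
    rw [← hammingLine_update x (d x) v] at e
    exact hammingLine_direction_inj e
  · ext A
    constructor
    · intro hA
      have hpos : 0 < A.card := by rw [(hP.isNClique A hA).card_eq]; exact Fintype.card_pos
      obtain ⟨x, hxA⟩ := Finset.card_pos.1 hpos
      have hx : x ∉ C := hP.subset A hA hxA
      exact ⟨x, hx, (hP.existsUnique_mem x hx).unique ⟨hA, hxA⟩
        ⟨hd x hx, self_mem_hammingLine _ _⟩⟩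
    · rintro ⟨x, hx, rfl⟩
      exact hd x hx

theorem mapFamily_lineFamily {C : Set (ι → α)} {d d' : (ι → α) → ι}
    (p : Equiv.Perm ι) (f : ι → α ≃ α) (hC : ∀ x, isotopy p f x ∈ C ↔ x ∈ C)
    (h : ∀ x ∉ C, d' (isotopy p f x) = p (d x)) :
    SimpleGraph.mapFamily (isotopy p f) (lineFamily C d) = lineFamily C d' := by
  ext A
  constructor
  · rintro ⟨_, ⟨x, hx, rfl⟩, rfl⟩
    refine ⟨isotopy p f x, (hC x).not.2 hx, ?_⟩
    dsimp only
    rw [map_hammingLine, h x hx]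
  · rintro ⟨y, hy, rfl⟩
    obtain ⟨x, rfl⟩ := (isotopy p f).surjective y
    have hx := (hC x).not.1 hy
    refine ⟨hammingLine x (d x), ⟨x, hx, rfl⟩, ?_⟩
    dsimp only
    rw [map_hammingLine, h x hx]

end Directions

/-- An automorphism between clique partitions of two vertex sets maps one set onto the other. -/
theorem SimpleGraph.IsCliquePartition.apply_mem_iff {V : Type*} {G : SimpleGraph V} {k : ℕ}
    {S : Set V} {P Q : Set (Finset V)} (hP : G.IsCliquePartition k S P)
    (hQ : G.IsCliquePartition k S Q) {φ : G ≃g G} (h : SimpleGraph.mapFamily φ P = Q) (x : V) :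
    φ x ∈ S ↔ x ∈ S := by
  constructor
  · intro hx
    obtain ⟨B, ⟨hB, hxB⟩, -⟩ := hQ.existsUnique_mem _ hx
    rw [← h] at hB
    obtain ⟨A, hA, rfl⟩ := hB
    obtain ⟨y, hy, e⟩ := Finset.mem_map.1 hxB
    have : y = x := φ.injective e
    exact hP.subset A hA (this ▸ hy)
  · intro hx
    obtain ⟨A, ⟨hA, hxA⟩, -⟩ := hP.existsUnique_mem x hx
    have hB : A.map φ.toEquiv.toEmbedding ∈ Q := h ▸ ⟨A, hA, rfl⟩
    exact hQ.subset _ hB (Finset.mem_coe.2 (Finset.mem_map_of_mem _ hxA))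

/-! ### The model of the Hamming code over the field with four elements

The letters `0, 1, 2, 3` stand for the elements `0, 1, w, w + 1` of the field, so that addition
is the bitwise exclusive or. -/

/-- Multiplication by `w`. -/
def mulTwo : Fin 4 → Fin 4 := ![0, 2, 3, 1]

/-- Multiplication by `w + 1`. -/
def mulThree : Fin 4 → Fin 4 := ![0, 3, 1, 2]

/-- The words `x` with `x₀ = x₂ + x₃ + x₄` and `x₁ = x₂ + w x₃ + (w + 1) x₄`. -/
def modelCode : Set (Fin 5 → Fin 4) :=
  {x | x 0 = x 2 ^^^ x 3 ^^^ x 4 ∧ x 1 = x 2 ^^^ mulTwo (x 3) ^^^ mulThree (x 4)}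

instance : DecidablePred (· ∈ modelCode) := fun x =>
  inferInstanceAs (Decidable (x 0 = x 2 ^^^ x 3 ^^^ x 4 ∧
    x 1 = x 2 ^^^ mulTwo (x 3) ^^^ mulThree (x 4)))

/-! ### The field with four elements and the normal form of a [5, 3, 3] code -/

section FieldFour

variable {F : Type*} [Field F]

theorem two_eq_zero_of_card_four (hF : Nat.card F = 4) : (2 : F) = 0 := by
  have : Finite F := Nat.finite_of_card_ne_zero (by omega)
  have := Fintype.ofFinite F
  have h := Nat.cast_card_eq_zero F
  rw [← Nat.card_eq_fintype_card, hF] at h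
  have h' : (2 : F) * 2 = 0 := by push_cast at h; rw [← h]; norm_num
  exact mul_self_eq_zero.1 h'

/-- Since `w ^ 3 = 1` and `w ≠ 1`, the factor `w - 1` of `w ^ 3 - 1` can be cancelled; signs do not
matter in characteristic 2. -/
theorem sq_eq_of_card_four (hF : Nat.card F = 4) {w : F} (h0 : w ≠ 0) (h1 : w ≠ 1) :
    w * w = w + 1 := by
  have : Finite F := Nat.finite_of_card_ne_zero (by omega)
  have := Fintype.ofFinite F
  have h2 := two_eq_zero_of_card_four hF
  have h := FiniteField.pow_card_sub_one_eq_one w h0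
  rw [← Nat.card_eq_fintype_card, hF] at h
  have h3 : (w - 1) * (w * w + w + 1) = 0 := by linear_combination h
  rcases mul_eq_zero.1 h3 with h4 | h4
  · exact absurd (sub_eq_zero.1 h4) h1
  · linear_combination h4 - (w + 1) * h2

/-- The letters as elements of the field. -/
def letter (w : F) : Fin 4 → F := ![0, 1, w, w + 1]

theorem letter_bijective (hF : Nat.card F = 4) {w : F} (h0 : w ≠ 0) (h1 : w ≠ 1) :
    Bijective (letter w) := by
  have : Finite F := Nat.finite_of_card_ne_zero (by omega)
  have := Fintype.ofFinite F
  have h2 := two_eq_zero_of_card_four hF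
  have hw : w + 1 ≠ 0 := fun h => h1 (by linear_combination h - h2)
  refine (Fintype.bijective_iff_injective_and_card _).2 ⟨?_, ?_⟩
  · have hw' : (w + 1 : F) ≠ w := by simp
    have hw'' : (w + 1 : F) ≠ 1 := by simpa using h0
    have h10 : (1 : F) ≠ 0 := one_ne_zero
    intro a b hab
    fin_cases a <;> fin_cases b <;>
      simp_all [letter, eq_comm]
  · rw [← Nat.card_eq_fintype_card (α := F), hF, Fintype.card_fin]

theorem letter_xor (hF : Nat.card F = 4) (w : F) (a b : Fin 4) :
    letter w (a ^^^ b) = letter w a + letter w b := by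
  have h2 := two_eq_zero_of_card_four hF
  fin_cases a <;> fin_cases b <;> simp [letter] <;>
    first
      | ring1
      | linear_combination -h2
      | linear_combination -w * h2
      | linear_combination -(w + 1) * h2

theorem letter_mulTwo (hF : Nat.card F = 4) {w : F} (h0 : w ≠ 0) (h1 : w ≠ 1) (a : Fin 4) :
    letter w (mulTwo a) = w * letter w a := by
  have h2 := two_eq_zero_of_card_four hF
  have hw := sq_eq_of_card_four hF h0 h1
  fin_cases a <;> simp [letter, mulTwo]
  · exact hw.symm
  · linear_combination -hw - w * h2

theorem letter_mulThree (hF : Nat.card F = 4) {w : F} (h0 : w ≠ 0) (h1 : w ≠ 1) (a : Fin 4) :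
    letter w (mulThree a) = (w + 1) * letter w a := by
  have h2 := two_eq_zero_of_card_four hF
  have hw := sq_eq_of_card_four hF h0 h1
  fin_cases a <;> simp [letter, mulThree]
  · linear_combination -hw - w * h2
  · linear_combination -hw - (w + 1) * h2

variable [DecidableEq F]

/-- A word supported on two positions has weight at most 2. All nondegeneracy of the check equations
below comes from this. -/
theorem IsLinearCode.eq_zero_of_support {C : Submodule F (Fin 5 → F)} (hC : IsLinearCode 3 3 C)
    {z : Fin 5 → F} (hz : z ∈ C) (i j : Fin 5) (h : ∀ k, k ≠ i → k ≠ j → z k = 0) : z = 0 := by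
  by_contra hne
  have hle : 3 ≤ hammingDist z 0 := hC.2.2 ⟨z, hz, 0, C.zero_mem, hne, rfl⟩
  have hsub : (Finset.univ.filter fun k => z k ≠ (0 : Fin 5 → F) k) ⊆ {i, j} := by
    intro k hk
    by_contra hk'
    simp only [Finset.mem_insert, Finset.mem_singleton, not_or] at hk'
    exact (Finset.mem_filter.1 hk).2 (h k hk'.1 hk'.2)
  have := (Finset.card_le_card hsub).trans Finset.card_le_two
  rw [hammingDist] at hle
  omega

/-- A code with parameters `[5, 3, 3]` is systematic in the last three positions. -/
theorem IsLinearCode.exists_check {C : Submodule F (Fin 5 → F)} (hC : IsLinearCode 3 3 C) :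
    ∃ l m : Fin 3 → F, ∀ x, x ∈ C ↔
      x 0 = l 0 * x 2 + l 1 * x 3 + l 2 * x 4 ∧ x 1 = m 0 * x 2 + m 1 * x 3 + m 2 * x 4 := by
  let π : C →ₗ[F] (Fin 3 → F) :=
    { toFun := fun x => ![x.1 2, x.1 3, x.1 4]
      map_add' := fun x y => by ext k; fin_cases k <;> rfl
      map_smul' := fun a x => by ext k; fin_cases k <;> rfl }
  have hinj : Injective π := by
    rw [injective_iff_map_eq_zero]
    intro x hx
    have h2 : x.1 2 = 0 := congrFun hx 0
    have h3 : x.1 3 = 0 := congrFun hx 1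
    have h4 : x.1 4 = 0 := congrFun hx 2
    refine Subtype.ext (hC.eq_zero_of_support x.2 0 1 fun k hk0 hk1 => ?_)
    fin_cases k <;> simp_all
  -- A codeword vanishing in the last three positions is zero, so `π` is injective between spaces of
  -- dimension 3.
  have hsurj : Surjective π := by
    refine (LinearMap.injective_iff_surjective_of_finrank_eq_finrank ?_).1 hinj
    rw [hC.1, Module.finrank_fin_fun]
  obtain ⟨b, hb⟩ := hsurj ![1, 0, 0]
  obtain ⟨c, hc⟩ := hsurj ![0, 1, 0]
  obtain ⟨d, hd⟩ := hsurj ![0, 0, 1]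
  have hb2 : b.1 2 = 1 := congrFun hb 0
  have hb3 : b.1 3 = 0 := congrFun hb 1
  have hb4 : b.1 4 = 0 := congrFun hb 2
  have hc2 : c.1 2 = 0 := congrFun hc 0
  have hc3 : c.1 3 = 1 := congrFun hc 1
  have hc4 : c.1 4 = 0 := congrFun hc 2
  have hd2 : d.1 2 = 0 := congrFun hd 0
  have hd3 : d.1 3 = 0 := congrFun hd 1
  have hd4 : d.1 4 = 1 := congrFun hd 2
  refine ⟨![b.1 0, c.1 0, d.1 0], ![b.1 1, c.1 1, d.1 1], fun x => ?_⟩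
  have hmem : x 2 • b.1 + x 3 • c.1 + x 4 • d.1 ∈ C :=
    C.add_mem (C.add_mem (C.smul_mem _ b.2) (C.smul_mem _ c.2)) (C.smul_mem _ d.2)
  constructor
  · intro hx
    -- The difference between `x` and the combination of the three basis words with the same last
    -- letters is supported on positions 0 and 1.
    have h0 := hC.eq_zero_of_support (C.sub_mem hx hmem) 0 1 (by
      intro k hk0 hk1
      fin_cases k <;> simp_all)
    have e0 := congrFun h0 0
    have e1 := congrFun h0 1
    simp only [Pi.sub_apply, Pi.add_apply, Pi.smul_apply, smul_eq_mul, Pi.zero_apply] at e0 e1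
    refine ⟨?_, ?_⟩
    · simp only [Matrix.cons_val]
      linear_combination e0
    · simp only [Matrix.cons_val]
      linear_combination e1
  · rintro ⟨e0, e1⟩
    convert hmem using 1
    simp only [Matrix.cons_val] at e0 e1
    ext k
    fin_cases k
    · simp only [Pi.add_apply, Pi.smul_apply, smul_eq_mul]
      simp only [Fin.zero_eta]
      linear_combination e0
    · simp only [Pi.add_apply, Pi.smul_apply, smul_eq_mul]
      simp only [Fin.mk_one]
      linear_combination e1
    all_goals simp_all

/-- Every `[5, 3, 3]` code over the field with four elements is mapped onto the model by bijections
between the letters. -/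
theorem IsLinearCode.exists_isotopy (hF : Nat.card F = 4) {C : Submodule F (Fin 5 → F)}
    (hC : IsLinearCode 3 3 C) :
    ∃ f : Fin 5 → F ≃ Fin 4, ∀ x, isotopy 1 f x ∈ modelCode ↔ x ∈ C := by
  obtain ⟨l, m, hlm⟩ := hC.exists_check
  have word : ∀ a b c : F, ![l 0 * a + l 1 * b + l 2 * c, m 0 * a + m 1 * b + m 2 * c, a, b, c] ∈ C :=
    fun a b c => (hlm _).2 ⟨by simp, by simp⟩
  -- A vanishing coefficient would leave a basis codeword of weight at most 2.
  have hl : ∀ k, l k ≠ 0 := by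
    intro k hk
    fin_cases k
    · have := hC.eq_zero_of_support (word 1 0 0) 1 2 (by
        intro k h1 h2; fin_cases k <;> simp_all)
      simpa using congrFun this 2
    · have := hC.eq_zero_of_support (word 0 1 0) 1 3 (by
        intro k h1 h2; fin_cases k <;> simp_all)
      simpa using congrFun this 3
    · have := hC.eq_zero_of_support (word 0 0 1) 1 4 (by
        intro k h1 h2; fin_cases k <;> simp_all)
      simpa using congrFun this 4
  have hm : ∀ k, m k ≠ 0 := by
    intro k hk
    fin_cases k
    · have := hC.eq_zero_of_support (word 1 0 0) 0 2 (by
        intro k h1 h2; fin_cases k <;> simp_all)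
      simpa using congrFun this 2
    · have := hC.eq_zero_of_support (word 0 1 0) 0 3 (by
        intro k h1 h2; fin_cases k <;> simp_all)
      simpa using congrFun this 3
    · have := hC.eq_zero_of_support (word 0 0 1) 0 4 (by
        intro k h1 h2; fin_cases k <;> simp_all)
      simpa using congrFun this 4
  -- The letters `l 1`, `-l 0` in positions 2, 3 cancel the letter in position 0 and put this minor
  -- in position 1; if it vanished, the codeword would have weight 2.
  have h01 : m 0 * l 1 - m 1 * l 0 ≠ 0 := by
    intro h
    have := hC.eq_zero_of_support (word (l 1) (-l 0) 0) 2 3 (by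
      intro k h1 h2
      fin_cases k <;> simp_all
      · ring
      · linear_combination h)
    exact hl 1 (by simpa using congrFun this 2)
  have h02 : m 0 * l 2 - m 2 * l 0 ≠ 0 := by
    intro h
    have := hC.eq_zero_of_support (word (l 2) 0 (-l 0)) 2 4 (by
      intro k h1 h2
      fin_cases k <;> simp_all
      · ring
      · linear_combination h)
    exact hl 2 (by simpa using congrFun this 2)
  have h12 : m 1 * l 2 - m 2 * l 1 ≠ 0 := by
    intro h
    have := hC.eq_zero_of_support (word 0 (l 2) (-l 1)) 3 4 (by
      intro k h1 h2
      fin_cases k <;> simp_all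
      · ring
      · linear_combination h)
    exact hl 2 (by simpa using congrFun this 3)
  have l0 := hl 0
  have l1 := hl 1
  have l2 := hl 2
  have m0 := hm 0
  have m1 := hm 1
  have m2 := hm 2
  -- The ratios `m k / l k`, normalized by the one for `k = 0`, are 1, `w` and a third value. They
  -- are nonzero and pairwise distinct, so they exhaust the nonzero elements of the field.
  set w : F := m 1 * l 0 / (l 1 * m 0) with hw
  have hw0 : w ≠ 0 := by positivity
  have hw1 : w ≠ 1 := by
    intro h
    rw [hw, div_eq_one_iff_eq (mul_ne_zero l1 m0)] at h
    exact h01 (by linear_combination -h)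
  have hbij := letter_bijective hF hw0 hw1
  -- The third ratio is nonzero, differs from 1 by `h02` and from `w` by `h12`.
  have hw' : m 2 * l 0 / (l 2 * m 0) = w + 1 := by
    obtain ⟨a, ha⟩ := hbij.2 (m 2 * l 0 / (l 2 * m 0))
    rw [eq_div_iff (mul_ne_zero l2 m0)] at ha
    rw [div_eq_iff (mul_ne_zero l2 m0)]
    fin_cases a
    · exfalso
      simp [letter, l0, m2] at ha
    · exfalso
      simp [letter] at ha
      exact h02 (by linear_combination ha)
    · exfalso
      simp [letter, hw] at ha
      field_simp at ha
      exact h12 (by linear_combination ha)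
    · exact ha.symm
  let σ : Fin 4 ≃ F := Equiv.ofBijective _ hbij
  -- Scaling positions 2, 3, 4 by `l` turns the first check equation into a plain sum; the factor `l
  -- 0 / m 0` in position 1 then turns the coefficients of the second one into the normalized ratios
  -- 1, `w`, `w + 1`.
  let a : Fin 5 → F := ![1, l 0 / m 0, l 0, l 1, l 2]
  have ha : ∀ k, a k ≠ 0 := by
    intro k
    fin_cases k
    · exact one_ne_zero
    · exact div_ne_zero l0 m0
    · exact l0
    · exact l1
    · exact l2
  refine ⟨fun k => (Equiv.mulLeft₀ (a k) (ha k)).trans σ.symm, fun x => ?_⟩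
  set y := isotopy (1 : Equiv.Perm (Fin 5)) (fun k => (Equiv.mulLeft₀ (a k) (ha k)).trans σ.symm) x
  have hy : ∀ k, letter w (y k) = a k * x k := fun k => σ.apply_symm_apply _
  change (y 0 = _ ∧ y 1 = _) ↔ _
  rw [hlm, ← hbij.1.eq_iff, ← hbij.1.eq_iff (a := y 1)]
  simp only [letter_xor hF, letter_mulTwo hF hw0 hw1, letter_mulThree hF hw0 hw1, hy]
  have a0 : a 0 = 1 := rfl
  have a1 : a 1 = l 0 / m 0 := rfl
  have a2 : a 2 = l 0 := rfl
  have a3 : a 3 = l 1 := rfl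
  have a4 : a 4 = l 2 := rfl
  rw [a0, a1, a2, a3, a4, one_mul, ← hw', hw]
  refine and_congr Iff.rfl ?_
  constructor
  · intro h
    field_simp at h
    linear_combination h
  · intro h
    rw [h]
    field_simp

end FieldFour

/-! ### A propagation procedure for direction functions

A set of words is stored as a natural number, whose bit `idx x` tells whether the word `x` belongs
to the set. The arithmetic is written with the functions `Nat.land`, `Nat.lor`, … themselves because
the procedure is evaluated by the kernel. -/

/-- The number of a word. -/
def idx (x : Fin 5 → Fin 4) : ℕ := x 0 + 4 * x 1 + 16 * x 2 + 64 * x 3 + 256 * x 4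

theorem idx_lt (x : Fin 5 → Fin 4) : idx x < 1024 := by
  have h0 := (x 0).2
  have h1 := (x 1).2
  have h2 := (x 2).2
  have h3 := (x 3).2
  have h4 := (x 4).2
  rw [idx]
  omega

theorem idx_injective : Injective idx := by
  intro x y h
  rw [idx, idx] at h
  have h0 := (x 0).2
  have h1 := (x 1).2
  have h2 := (x 2).2
  have h3 := (x 3).2
  have h4 := (x 4).2
  have k0 := (y 0).2
  have k1 := (y 1).2
  have k2 := (y 2).2
  have k3 := (y 3).2
  have k4 := (y 4).2
  ext j
  fin_cases j <;> simp only [Fin.mk_one, Fin.zero_eta, Fin.reduceFinMk] <;> omega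

theorem exists_idx_eq {n : ℕ} (hn : n < 1024) : ∃ x, idx x = n := by
  refine ⟨![⟨n % 4, Nat.mod_lt _ (by norm_num)⟩, ⟨n / 4 % 4, Nat.mod_lt _ (by norm_num)⟩,
    ⟨n / 16 % 4, Nat.mod_lt _ (by norm_num)⟩, ⟨n / 64 % 4, Nat.mod_lt _ (by norm_num)⟩,
    ⟨n / 256 % 4, Nat.mod_lt _ (by norm_num)⟩], ?_⟩
  simp only [idx, Matrix.cons_val]
  omega

/-- The numbers of the words outside the code. -/
def nonCode : ℕ := 0xfff7ffbffdffeffffbff7ffffffeffdfdffffeffff7ffffbffeffffdbffff7ffbffff7ffffeffffdff7ffffbdffffefffffeffdffbff7ffffdffeffffff7ffbfffdffffe7ffffbffeffffdffffbffff7f7ffbffffffdffeffffbff7ffeffdffffeffdffffffbff7ffffdffeff7ffbfffffbffff7effffdff7ffffbffffdffffe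

theorem testBit_nonCode (x : Fin 5 → Fin 4) :
    nonCode.testBit (idx x) = true ↔ x ∉ modelCode := by
  have h : ∀ a b c d e : Fin 4, nonCode.testBit (a + 4 * b + 16 * c + 64 * d + 256 * e) =
      !(decide (a = c ^^^ d ^^^ e ∧ b = c ^^^ mulTwo d ^^^ mulThree e)) := by
    decide +kernel
  rw [idx, h, Bool.not_eq_true', decide_eq_false_iff_not]
  rfl

set_option exponentiation.threshold 1024 in
theorem lt_of_testBit_nonCode {n : ℕ} (h : nonCode.testBit n = true) : n < 1024 := by
  by_contra hn
  have hlt : nonCode < 2 ^ n :=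
    lt_of_lt_of_le (show nonCode < 2 ^ 1024 by decide +kernel)
      (Nat.pow_le_pow_right (by norm_num) (not_lt.1 hn))
  rw [Nat.testBit_lt_two_pow hlt] at h
  exact Bool.false_ne_true h

/-- The candidates for the words of the directions `0, …, 4`. -/
structure Masks where
  a : ℕ
  b : ℕ
  c : ℕ
  d : ℕ
  e : ℕ

namespace Masks

def get (m : Masks) : ℕ → ℕ
  | 0 => m.a
  | 1 => m.b
  | 2 => m.c
  | 3 => m.d
  | _ => m.e

/-- The words with at least one candidate direction. -/
def union (m : Masks) : ℕ := Nat.lor m.a (Nat.lor m.b (Nat.lor m.c (Nat.lor m.d m.e)))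

/-- `o` accumulates the words with at least one candidate and `t` those with at least two. The
second set lies in the first, so the exclusive or is their difference. -/
def uniqueAux (o t c d e : ℕ) : ℕ :=
  let t₃ := Nat.lor t (Nat.land o c)
  let o₃ := Nat.lor o c
  let t₄ := Nat.lor t₃ (Nat.land o₃ d)
  let o₄ := Nat.lor o₃ d
  Nat.land nonCode (Nat.xor (Nat.lor o₄ e) (Nat.lor t₄ (Nat.land o₄ e)))

/-- The words outside the code with exactly one candidate direction. -/
def unique (m : Masks) : ℕ := uniqueAux (Nat.lor m.a m.b) (Nat.land m.a m.b) m.c m.d m.e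

/-- Every word outside the code has a candidate direction. -/
def full (m : Masks) : Bool := Nat.beq (Nat.land m.union nonCode) nonCode

end Masks

/-- Applied with `s` and then `2 * s`, `double` copies a bit to the offsets `0, s, 2s, 3s` above it;
`halve` collects bits from these offsets in the same way. -/
def double (s b : ℕ) : ℕ := Nat.lor b (Nat.shiftLeft b s)

def halve (s b : ℕ) : ℕ := Nat.lor b (Nat.shiftRight b s)

/-- The union of all lines that meet the set `r`, in the direction with place value `s`; the set `z`
holds the words with a zero in this position, and `t = 2 * s`. -/
def spread (s t z r : ℕ) : ℕ := double t (double s (Nat.land (halve t (halve s r)) z))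

/-- Remove from `d` all lines that meet `r`. -/
def prune (s t z d r : ℕ) : ℕ := Nat.xor d (Nat.land d (spread s t z r))

/-- This mask and the next four mark words with letter 0 in the respective position. Soundness uses
only that a marked word has this letter. -/
def zeroAt0 : ℕ := 0x1111111111111111111111111111111111111111111111111111111111111111111111111111111111111111111111111111111111111111111111111111111111111111111111111111111111111111111111111111111111111111111111111111111111111111111111111111111111111111111111111111111111111111

def zeroAt1 : ℕ := 0xf000f000f000f000f000f000f000f000f000f000f000f000f000f000f000f000f000f000f000f000f000f000f000f000f000f000f000f000f000f000f000f000f000f000f000f000f000f000f000f000f000f000f000f000f000f000f000f000f000f000f000f000f000f000f000f000f000f000f000f000f000f000f000f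

def zeroAt2 : ℕ := 0xffff000000000000ffff000000000000ffff000000000000ffff000000000000ffff000000000000ffff000000000000ffff000000000000ffff000000000000ffff000000000000ffff000000000000ffff000000000000ffff000000000000ffff000000000000ffff000000000000ffff000000000000ffff

def zeroAt3 : ℕ := 0xffffffffffffffff000000000000000000000000000000000000000000000000ffffffffffffffff000000000000000000000000000000000000000000000000ffffffffffffffff000000000000000000000000000000000000000000000000ffffffffffffffff

def zeroAt4 : ℕ := 0xffffffffffffffffffffffffffffffffffffffffffffffffffffffffffffffff

/-- The sets `fa, …, fe` are the words on lines already forced in the five directions. A line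
survives as a candidate only if it meets no forced line of another direction. -/
def refineAux (a b c d e fa fb fc fd fe : ℕ) : Masks :=
  ⟨prune 1 2 zeroAt0 a (Nat.lor (Nat.lor fb fc) (Nat.lor fd fe)),
    prune 4 8 zeroAt1 b (Nat.lor (Nat.lor fa fc) (Nat.lor fd fe)),
    prune 16 32 zeroAt2 c (Nat.lor (Nat.lor fa fb) (Nat.lor fd fe)),
    prune 64 128 zeroAt3 d (Nat.lor (Nat.lor fa fb) (Nat.lor fc fe)),
    prune 256 512 zeroAt4 e (Nat.lor (Nat.lor fa fb) (Nat.lor fc fd))⟩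

/-- One round of propagation: the words `u` have a single candidate direction, which fixes the
direction of all words on the corresponding lines. -/
def Masks.refine (m : Masks) (u : ℕ) : Masks :=
  refineAux m.a m.b m.c m.d m.e
    (spread 1 2 zeroAt0 (Nat.land m.a u)) (spread 4 8 zeroAt1 (Nat.land m.b u))
    (spread 16 32 zeroAt2 (Nat.land m.c u)) (spread 64 128 zeroAt3 (Nat.land m.d u))
    (spread 256 512 zeroAt4 (Nat.land m.e u))

/-- Propagation until nothing changes or a word has no candidate direction left. -/
def propagate : ℕ → ℕ → Masks → Masks
  | 0, _, m => m
  | n + 1, v, m =>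
    bif m.full then
      -- `v` is the set of forced words of the previous round; without a new forced word there is
      -- nothing to propagate. Stopping at any time is sound, since it only keeps more candidates.
      bif Nat.beq m.unique v then m else propagate n m.unique (m.refine m.unique)
    else m

def clear (x d : ℕ) : ℕ := Nat.xor d (Nat.land d (Nat.shiftLeft 1 x))

/-- Fix the direction of the word with number `x`. -/
def restrict (x : ℕ) : ℕ → Masks → Masks
  | 0, m => ⟨m.a, clear x m.b, clear x m.c, clear x m.d, clear x m.e⟩
  | 1, m => ⟨clear x m.a, m.b, clear x m.c, clear x m.d, clear x m.e⟩
  | 2, m => ⟨clear x m.a, clear x m.b, m.c, clear x m.d, clear x m.e⟩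
  | 3, m => ⟨clear x m.a, clear x m.b, clear x m.c, m.d, clear x m.e⟩
  | _, m => ⟨clear x m.a, clear x m.b, clear x m.c, clear x m.d, m.e⟩

/-! ### Correctness of the propagation -/

theorem testBit_lor (a b n : ℕ) : (Nat.lor a b).testBit n = (a.testBit n || b.testBit n) :=
  Nat.testBit_or a b n

theorem testBit_land (a b n : ℕ) : (Nat.land a b).testBit n = (a.testBit n && b.testBit n) :=
  Nat.testBit_and a b n

theorem testBit_xor (a b n : ℕ) : (Nat.xor a b).testBit n = (a.testBit n ^^ b.testBit n) :=
  Nat.testBit_xor a b n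

theorem testBit_double (s b n : ℕ) :
    (double s b).testBit n = true ↔ b.testBit n = true ∨ s ≤ n ∧ b.testBit (n - s) = true := by
  have h : (Nat.shiftLeft b s).testBit n = (decide (n ≥ s) && b.testBit (n - s)) :=
    Nat.testBit_shiftLeft b
  rw [double, testBit_lor, h]
  simp

theorem testBit_halve (s b n : ℕ) :
    (halve s b).testBit n = true ↔ b.testBit n = true ∨ b.testBit (s + n) = true := by
  have h : (Nat.shiftRight b s).testBit n = b.testBit (s + n) := Nat.testBit_shiftRight b
  rw [halve, testBit_lor, h]
  simp

/-- Here `m` is the word with letter 0 on the line, and `k`, `l` are the letters of the word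
reported and of a word in `r`. Only this inclusion is needed: a superfluous bit could discard a
valid candidate, a missing one merely weakens the pruning. -/
theorem testBit_spread {s z r n : ℕ} (h : (spread s (2 * s) z r).testBit n = true) :
    ∃ k < 4, ∃ l < 4, ∃ m, n = m + k * s ∧ z.testBit m = true ∧ r.testBit (m + l * s) = true := by
  have core : ∀ m, (Nat.land (halve (2 * s) (halve s r)) z).testBit m = true →
      z.testBit m = true ∧ ∃ l < 4, r.testBit (m + l * s) = true := by
    intro m hm
    rw [testBit_land, Bool.and_eq_true, testBit_halve, testBit_halve, testBit_halve] at hm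
    refine ⟨hm.2, ?_⟩
    rcases hm.1 with (h | h) | (h | h)
    · exact ⟨0, by norm_num, by simpa using h⟩
    · exact ⟨1, by norm_num, by rw [← h]; congr 1; ring⟩
    · exact ⟨2, by norm_num, by rw [← h]; congr 1; ring⟩
    · exact ⟨3, by norm_num, by rw [← h]; congr 1; ring⟩
  rw [spread, testBit_double, testBit_double, testBit_double] at h
  rcases h with (h | ⟨hs, h⟩) | ⟨hs, h | ⟨ht, h⟩⟩ <;> obtain ⟨hz, l, hl, hr⟩ := core _ h
  · exact ⟨0, by norm_num, l, hl, _, by simp, hz, hr⟩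
  · exact ⟨1, by norm_num, l, hl, _, by omega, hz, hr⟩
  · exact ⟨2, by norm_num, l, hl, _, by omega, hz, hr⟩
  · exact ⟨3, by norm_num, l, hl, _, by omega, hz, hr⟩

theorem digit_of_testBit_zeroAt : ∀ n < 1024,
    (zeroAt0.testBit n = true → n % 4 = 0) ∧ (zeroAt1.testBit n = true → n / 4 % 4 = 0) ∧
    (zeroAt2.testBit n = true → n / 16 % 4 = 0) ∧ (zeroAt3.testBit n = true → n / 64 % 4 = 0) ∧
    (zeroAt4.testBit n = true → n / 256 % 4 = 0) := by
  decide +kernel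

def zeroAt : Fin 5 → ℕ := ![zeroAt0, zeroAt1, zeroAt2, zeroAt3, zeroAt4]

/-- Digit `j` of the base word is 0, so adding `k` or `l` times `4 ^ j` causes no carry and changes
that letter alone. -/
theorem exists_update_of_testBit_spread {j : Fin 5} {r : ℕ} {x : Fin 5 → Fin 4}
    (h : (spread (4 ^ (j : ℕ)) (2 * 4 ^ (j : ℕ)) (zeroAt j) r).testBit (idx x) = true) :
    ∃ v, r.testBit (idx (update x j v)) = true := by
  obtain ⟨k, hk, l, hl, m, hm, hz, hr⟩ := testBit_spread h
  refine ⟨⟨l, hl⟩, ?_⟩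
  rw [← hr]
  congr 1
  have hx := idx_lt x
  obtain ⟨d0, d1, d2, d3, d4⟩ := digit_of_testBit_zeroAt m (by omega)
  have h0 := (x 0).2
  have h1 := (x 1).2
  have h2 := (x 2).2
  have h3 := (x 3).2
  have h4 := (x 4).2
  rw [idx] at hm
  fin_cases j <;> simp only [idx, Fin.zero_eta, Fin.mk_one, Fin.reduceFinMk, Fin.isValue, pow_zero,
    pow_one, zeroAt, Matrix.cons_val, Nat.reducePow, update_self, ne_eq, Fin.reduceEq, not_false_eq_true, update_of_ne] at hm hz ⊢
  · have := d0 hz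
    omega
  · have := d1 hz
    omega
  · have := d2 hz
    omega
  · have := d3 hz
    omega
  · have := d4 hz
    omega

/-- The direction function `d` chooses among the candidates `m`. -/
def Compatible (m : Masks) (d : (Fin 5 → Fin 4) → Fin 5) : Prop :=
  ∀ x ∉ modelCode, (m.get (d x)).testBit (idx x) = true

theorem testBit_union (m : Masks) (i : Fin 5) (n : ℕ) (h : (m.get i).testBit n = true) :
    m.union.testBit n = true := by
  simp only [Masks.union, testBit_lor]
  fin_cases i <;> simp only [Masks.get] at h <;> simp [h]

theorem eq_of_testBit_unique {m : Masks} {i j : Fin 5} {n : ℕ} (h : m.unique.testBit n = true)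
    (hi : (m.get i).testBit n = true) (hj : (m.get j).testBit n = true) : i = j := by
  simp only [Masks.unique, Masks.uniqueAux, testBit_lor, testBit_land, testBit_xor,
    Bool.and_eq_true] at h
  replace h := h.2
  revert h hi hj
  -- At a single word the claim is a statement about five truth values.
  have key : ∀ a b c d e : Bool, ∀ i j : Fin 5,
      ![a, b, c, d, e] i = true → ![a, b, c, d, e] j = true →
      (((((a || b) || c) || d) || e) ^^
        ((((a && b) || ((a || b) && c)) || (((a || b) || c) && d)) ||
          ((((a || b) || c) || d) && e))) = true → i = j := by
    decide
  have get_eq : ∀ i : Fin 5, (m.get i).testBit n =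
      ![m.a.testBit n, m.b.testBit n, m.c.testBit n, m.d.testBit n, m.e.testBit n] i := by
    intro i
    fin_cases i <;> rfl
  rw [get_eq, get_eq]
  exact key _ _ _ _ _ i j

theorem notMem_of_testBit_unique {m : Masks} {x : Fin 5 → Fin 4}
    (h : m.unique.testBit (idx x) = true) : x ∉ modelCode := by
  rw [Masks.unique, Masks.uniqueAux, testBit_land, Bool.and_eq_true] at h
  exact (testBit_nonCode x).1 h.1

/-- Used in the contrapositive: masks that leave some word outside the code without a candidate
refute the branch. -/
theorem Compatible.full {m : Masks} {d : (Fin 5 → Fin 4) → Fin 5} (h : Compatible m d) :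
    m.full = true := by
  have : Nat.land m.union nonCode = nonCode := by
    refine Nat.eq_of_testBit_eq fun n => ?_
    rw [testBit_land, Bool.and_eq_right_iff_imp]
    intro hn
    obtain ⟨x, rfl⟩ := exists_idx_eq (lt_of_testBit_nonCode hn)
    exact testBit_union m (d x) _ (h x ((testBit_nonCode x).1 hn))
  rw [Masks.full, this]
  exact Nat.beq_refl nonCode

/-- A description of the five components of a refinement that is uniform in `j`: `r` is the union of
the forced lines in the other directions. -/
theorem Masks.get_refine (m : Masks) (u : ℕ) (j : Fin 5) : ∃ r,
    (m.refine u).get j = prune (4 ^ (j : ℕ)) (2 * 4 ^ (j : ℕ)) (zeroAt j) (m.get j) r ∧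
    ∀ n, r.testBit n = true → ∃ i ≠ j,
      (spread (4 ^ (i : ℕ)) (2 * 4 ^ (i : ℕ)) (zeroAt i) (Nat.land (m.get i) u)).testBit n =
        true := by
  have split : ∀ a b c d n : ℕ, (Nat.lor (Nat.lor a b) (Nat.lor c d)).testBit n = true →
      (a.testBit n = true ∨ b.testBit n = true) ∨ c.testBit n = true ∨ d.testBit n = true := by
    intro a b c d n h
    simpa only [testBit_lor, Bool.or_eq_true] using h
  fin_cases j
  · refine ⟨_, rfl, fun n hn => ?_⟩
    rcases split _ _ _ _ n hn with (h | h) | h | h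
    exacts [⟨1, by decide, h⟩, ⟨2, by decide, h⟩, ⟨3, by decide, h⟩, ⟨4, by decide, h⟩]
  · refine ⟨_, rfl, fun n hn => ?_⟩
    rcases split _ _ _ _ n hn with (h | h) | h | h
    exacts [⟨0, by decide, h⟩, ⟨2, by decide, h⟩, ⟨3, by decide, h⟩, ⟨4, by decide, h⟩]
  · refine ⟨_, rfl, fun n hn => ?_⟩
    rcases split _ _ _ _ n hn with (h | h) | h | h
    exacts [⟨0, by decide, h⟩, ⟨1, by decide, h⟩, ⟨3, by decide, h⟩, ⟨4, by decide, h⟩]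
  · refine ⟨_, rfl, fun n hn => ?_⟩
    rcases split _ _ _ _ n hn with (h | h) | h | h
    exacts [⟨0, by decide, h⟩, ⟨1, by decide, h⟩, ⟨2, by decide, h⟩, ⟨4, by decide, h⟩]
  · refine ⟨_, rfl, fun n hn => ?_⟩
    rcases split _ _ _ _ n hn with (h | h) | h | h
    exacts [⟨0, by decide, h⟩, ⟨1, by decide, h⟩, ⟨2, by decide, h⟩, ⟨3, by decide, h⟩]

theorem IsDirection.eq_of_update_eq {d : (Fin 5 → Fin 4) → Fin 5} (hd : IsDirection modelCode d)
    {x : Fin 5 → Fin 4} {i : Fin 5} {v : Fin 4} (hC : update x i v ∉ modelCode)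
    (h : d (update x i v) = i) : d x = i := by
  have := hd.update_eq _ hC (x i)
  rw [h] at this
  simpa using this

/-- Suppose the chosen direction of `x` were discarded. Then the chosen line of `x` contains a word
that also lies on a line forced in a direction `i ≠ d x`. This word has direction `i` by the forced
line and direction `d x` by the line of `x`, a contradiction. -/
theorem Compatible.refine {m : Masks} {d : (Fin 5 → Fin 4) → Fin 5} (h : Compatible m d)
    (hd : IsDirection modelCode d) : Compatible (m.refine m.unique) d := by
  intro x hx
  obtain ⟨r, hr, hr'⟩ := m.get_refine m.unique (d x)
  rw [hr, prune, testBit_xor, testBit_land, h x hx]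
  by_contra hs
  simp only [Bool.true_and, Bool.not_eq_true, Bool.true_xor, Bool.not_eq_false'] at hs
  obtain ⟨v, hv⟩ := exists_update_of_testBit_spread hs
  obtain ⟨i, hi, hi'⟩ := hr' _ hv
  obtain ⟨w, hw⟩ := exists_update_of_testBit_spread hi'
  rw [testBit_land, Bool.and_eq_true] at hw
  have hC := notMem_of_testBit_unique hw.2
  have e := hd.eq_of_update_eq hC (eq_of_testBit_unique hw.2 (h _ hC) hw.1)
  rw [hd.update_eq x hx] at e
  exact hi e.symm

theorem Compatible.propagate {d : (Fin 5 → Fin 4) → Fin 5} (hd : IsDirection modelCode d) :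
    ∀ (n v : ℕ) {m : Masks}, Compatible m d → Compatible (propagate n v m) d
  | 0, _, _, h => h
  | n + 1, v, m, h => by
    rw [_root_.propagate]
    cases m.full with
    | false => exact h
    | true =>
      cases Nat.beq m.unique v with
      | true => exact h
      | false => exact Compatible.propagate hd n _ (h.refine hd)

theorem testBit_clear {x d n : ℕ} (hn : n ≠ x) (h : d.testBit n = true) :
    (clear x d).testBit n = true := by
  have e : (Nat.shiftLeft 1 x).testBit n = false := by
    have : Nat.shiftLeft 1 x = 2 ^ x := Nat.one_shiftLeft x
    rw [this, Nat.testBit_two_pow_of_ne (Ne.symm hn)]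
  rw [clear, testBit_xor, testBit_land, h, e]
  rfl

theorem Compatible.restrict {m : Masks} {d : (Fin 5 → Fin 4) → Fin 5} (h : Compatible m d)
    {n i : ℕ} (hi : ∀ x ∉ modelCode, idx x = n → (d x : ℕ) = i) :
    Compatible (restrict n i m) d := by
  intro x hx
  by_cases hn : idx x = n
  · rw [← hi x hx hn]
    have := h x hx
    generalize d x = j at this ⊢
    fin_cases j <;> exact this
  · have := h x hx
    generalize d x = j at this ⊢
    have hc : ∀ a : ℕ, a.testBit (idx x) = true → (clear n a).testBit (idx x) = true :=
      fun a => testBit_clear hn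
    match i with
    | 0 | 1 | 2 | 3 | _ + 4 =>
      fin_cases j <;> first | exact this | exact hc _ this

/-! ### Symmetries of the model code

A symmetry that fixes the zero word is stored as a number `g`: the letter `v` in position `i` becomes
the letter `letterOf g i v` in position `dirOf g i`. -/

/-- The low 40 bits of `g` hold the images of the letters, two bits each and eight bits per
position. The top 15 bits hold the images of the positions, three bits each, with position 0
highest. -/
def letterOf (g i v : ℕ) : ℕ :=
  Nat.land (Nat.shiftRight g (Nat.add (Nat.mul 8 i) (Nat.mul 2 v))) 3

def dirOf (g i : ℕ) : ℕ := Nat.land (Nat.shiftRight g (Nat.sub 52 (Nat.mul 3 i))) 7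

def digit (y i : ℕ) : ℕ := Nat.land (Nat.shiftRight y (Nat.mul 2 i)) 3

def actPart (g y i : ℕ) : ℕ :=
  Nat.shiftLeft (letterOf g i (digit y i)) (Nat.mul 2 (dirOf g i))

/-- The image of the word with number `y` under the symmetry `g` followed by the addition of the
word with number `c`. -/
def act (g c y : ℕ) : ℕ :=
  Nat.xor c (Nat.add (Nat.add (Nat.add (Nat.add (actPart g y 0) (actPart g y 1)) (actPart g y 2))
    (actPart g y 3)) (actPart g y 4))

/-- The symmetries of the model code that fix the zero word, 55 bits each, in increasing order. -/
def symmetryTable : ℕ := 0x8d11c8f139c8f11a227391e273923443c4e723c4e4681d8b46cb4d88d0368d9b0d9691a05b362d361b23286c5a3636364650b46cd8d8d88ca0d9b1696969190b91e27272723214e723c3c3c4642789ce4e4e48c23c8f138f1c918467391e39272308bc4e724e3c460ad8b46cd8b48c1568d9b168d91829b362d1b3622646c6c366c5a44c8b4b4d8b46c8990d8d968d9b113079391e39272260ce4e724e3c44c178789c78e488b1c8f1c939391162739271e1e222c3c4e3c72724443d8b4b46c6c888768d8d9b1b1110db36362d2d220cec366c365a4419b4d8b4d86c8832d968d969b1102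f92727391e2205ce3c3c4e72440b78e4e4789c85a1c9c9c9c9c90b4272727272721683c3c3c3c3c42c2d8d8d8d8d8858569696969690b09b1b1b1b1b214c6c6c6c366c4298b4b4b4d8b48530d8d8d968d90a0f939391e392141ce4e4e724e42837878789c788435c9c9c939c9086a727271e27210d3c3c3c723c4213d8d8d8b4d88427696968d969084db1b1b361b2068ec6c5a6c3640d1b4b46cb4d881a2d8d9b0d969032b93927391e20654e4e3c4e7240ca7878e4789c8133c939c938f1026671e271e39204cbc723c724e408bd86c6cd8b4811769b1b168d9022db2d2d1b36202d6c5a6c3636405ab46cb4d8d880b4d9b0d96969014f91e1e27272029ce72723c3c4053789c9ce4e47111b168d9b168e222d1b362d1b1c44366c5a366c3881e4789c78e4710339c8f1c938e205e2739271e1c28723c4e4e4e38509ce478787870a0f139c9c9c8e10b62d1b1b1b1c215a366c6c6c38426cd8b4b4b47023b168d969b0e046d1b361b2d1c08b66c5a6c36380ae4789ce478701539c8f139c8e029e27391e271a8472724e723c35089c9c789ce46a10f0f1c8f138d4076362d361b1a80da5a365a6c35016c6cd86cb468c1b169b0d8d8d182d1b2d36361a30366c365a5a3444e478789c9c688939c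9c8f0f0d111e272739391a10f24e724e3c34219c789c78e46842f1c8f1c938d03361b1b362d1a065a6c6c5a36340c6cb4b46cd86621b1b1b1b1b0cc42d2d2d2d2d198836363636363302e4e4e4e4e466053939393938cc09e1e1e1e1e19507272724e7232a09c9c9c789c6540f0f0f1c8f0ca13636362d3619425a5a5a365a32846c6c6cd86c6445b1b1b0d9b0c88ad2d2d362d19113636365a363214e4e4e478e46429393939c938c851e1e1e271e1888f2723c724e31119c9ce49c786222f0f138f1c8c42b6361b362d18855a5a6c5a36310a6c6cb46cd86143b0d9b0d968c286d362d361b1850b65a365a6c308ce49c9ce478611938f0f139c8c231e39391e271831723c724e4e30629ce49c787860c4f138f1c9c8c15362d2d1b1b182a5a36366c6c30546cd8d8b4b45191c93939c8f0a32271e1e273914643c72723c4e28c1d86cd86cb4518369b169b0d8a305b2d1b2d36142c6c5a5a36362858b46c6cd8d850b0d9b1b16968a10f91e3927271421ce724e3c3c2843789c78e4e45033c9c8f1c938a06672739271e140cbc3c4e3c72280bd8d86cd8b450176969b168d8a02db1b2d1b3613846c36366c5a2708b4d8d8b46c4e10d96968d9b09c0792739271e1380ce3c4e3c72270178e478e4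9c4cc1c8f0f139389982739391e1e13303c4e4e72722644d8b4d86c6c4c8968d969b1b09911b361b2d2d1310ec6c5a6c362621b4b46cb4d84c42d8d9b0d968983393927391e13064e4e3c4e72260c7878e4789c4631c9c9c8f1c88c62727273927118c3c3c3c4e3c2303d8d8d86cd84607696969b1688c0db1b1b2d1b11706c6c6c5a6c22e0b4b4b46cb445c0d8d8d9b0d88b1393939273911624e4e4e3c4e22c4787878e4784447c9c9c9c9c8888e7272727271111bc3c3c3c3c221cd8d8d8d8d8443969696969688871b1b1b1b1b108cec5a365a6c2119b46cd86cb44232d9b169b0d8842f91e27391e1085ce723c4e72210b789ce4789c41c3c8f138f1c883867391e39271070bc4e724e3c20ccd8b46cd8b4419968d9b168d88331b362d1b361031ec5a3636362063b46cd8d8d840c6d9b1696968817391e272727102e4e723c3c3c205c789ce4e4e431a1b0d96969686342d361b1b1b0c68365a6c6c6c18c2e49c787878318538f1c9c9c86309e392727270c4c724e3c3c4e18989c78e4e4783130f1c93939c8620f61b2d2d360c41da6c36365a18836cb4d8d86c3035b0d96968d8606ad361b1b360c0d365a6c6c5a1813e49c7878e4302738f1c9c938604de3927271e0b88724e3c3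c3c17109c78e4e4e42e20f1c93939385c0b61b2d2d2d0b815a6c36363617026cb4d8d8d82d41b0d96968d85a82d361b1b360b50365a6c6c5a1684e49c7878e42d0938f1c9c9385a11e3927271e0b11724e3c3c4e16229c78e4e4782c44f1c93939c8585361b2d2d360b0a5a6c36365a16146cb4d8d86c2a31b0d96969b05462d361b1b2d0a8c365a6c6c361503e49c78789c2a0738f1c9c8f0540de392727390a70724e3c3c7214e09c78e4e49c29c0f1c93938f0531361b2d2d1b0a625a6c36366c14c46cb4d8d8b42847b0d9696968508ed361b1b1b0a11b65a6c6c6c141ce49c787878283938f1c9c9c85071e39272727088d724e3c3c72111a9c78e4e49c2234f1c93938f0444f61b2d2d1b0889da6c36366c11136cb4d8d8b421c5b0d96969b0438ad361b1b2d0871365a6c6c3610d4e49c78789c21a938f1c9c8f04351e392727390851f24e3c3c3c10a39c78e4e4e42146f1c9393938427361b2d2d2d084e5a6c363636109c6cb4d8d8d811a3c939c938f0234671e271e390468bc723c724e08cad86c6cd8b4119569b1b168d82329b2d2d1b36044cec6c5a6c360899b4b46cb4d81132d8d9b0d968222f93927391e0445ce4e3c4e72088b7878e4789c10b5c8f0f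13938216a739391e1e042d3c4e4e72720853d8b4d86c6c10a768d969b1b0214db361b2d2d0388ec366c365a0711b4d8b4d86c0e22d968d969b01c2b92727391e03854e3c3c4e72070a78e4e4789c0d43c9c8f1c9381a8672739271e0350bc3c4e3c72068cd8d86cd8b40d196969b168d81a31b1b2d1b3603316c5a5a36360662b46c6cd8d80cc4d9b1b16968195391e392727032a4e724e3c3c0654789c78e4e40a33c8f138f1c814667391e3927028cbc4e724e3c050bd8b46cd8b40a1768d9b168d8142db362d1b360270ec5a365a6c04e1b46cd86cb409c2d9b169b0d8133391e27391e02664e723c4e7204cc789ce4789c08c7c8f1393938118e7391e1e1e0231bc4e727272045cd8b46c6c6c08b968d9b1b1b01171b362d2d2d018d6c6c6c5a6c031ab4b4b46cb40634d8d8d9b0d80c4f9393927390189ce4e4e3c4e0313787878e47805c5c9c9c8f1c80b8a72727392701713c3c3c4e3c02d4d8d8d86cd805a9696969b1680b51b1b1b2d1b0151ec6c6c6c6c02a3b4b4b4b4b40546d8d8d8d8d80a73939393939014e4e4e4e4e4e029c7878787878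

def symmetry (k : ℕ) : ℕ := Nat.land (Nat.shiftRight symmetryTable (Nat.mul 55 k)) 0x7fffffffffffff

/-- The numbers of the words of the model code. -/
def codewords : List ℕ := [
  0, 21, 42, 63, 73, 92, 99, 118, 142, 155, 164, 177, 199, 210, 237, 248, 269, 280, 295, 306, 324,
  337, 366, 379, 387, 406, 425, 444, 458, 479, 480, 501, 518, 531, 556, 569, 591, 602, 613, 624,
  648, 669, 674, 695, 705, 724, 747, 766, 779, 798, 801, 820, 834, 855, 872, 893, 901, 912, 943,
  954, 972, 985, 998, 1011]

def bit (m x : ℕ) : Bool := Nat.beq (Nat.land (Nat.shiftRight m x) 1) 1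

theorem bit_eq_testBit (m x : ℕ) : bit m x = m.testBit x := by
  change Nat.beq ((m >>> x) &&& 1) 1 = (1 &&& (m >>> x) != 0)
  rw [Nat.and_comm, Nat.one_and_eq_mod_two]
  rcases Nat.mod_two_eq_zero_or_one (m >>> x) with h | h <;> rw [h] <;> rfl

def codeMask : ℕ := 0x8004002001000040080000001002020000100008000040010000240000800400008000010000200800004200001000001002004008000020010000008004000200001800004001000020000400008080040000002001000040080010020000100200000040080000200100800400000400008100002008000040000200001

theorem bit_codeMask (x : Fin 5 → Fin 4) : bit codeMask (idx x) = true ↔ x ∈ modelCode := by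
  have h : ∀ a b c d e : Fin 4, bit codeMask (a + 4 * b + 16 * c + 64 * d + 256 * e) =
      (decide (a = c ^^^ d ^^^ e ∧ b = c ^^^ mulTwo d ^^^ mulThree e)) := by
    decide +kernel
  rw [idx, h, decide_eq_true_iff]
  rfl

theorem bit_codeMask_of_mem {c : ℕ} (hc : c ∈ codewords) : c < 1024 ∧ bit codeMask c = true := by
  have h : (codewords.all fun n => Nat.blt n 1024 && bit codeMask n) = true := by decide +kernel
  have := List.all_eq_true.1 h c hc
  rw [Bool.and_eq_true] at this
  exact ⟨Nat.le_of_ble_eq_true this.1, this.2⟩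

theorem idx_mem_codewords (x : Fin 5 → Fin 4) : idx x ∈ codewords ↔ x ∈ modelCode := by
  constructor
  · intro h
    exact (bit_codeMask x).1 (bit_codeMask_of_mem h).2
  · have h : ∀ c d e : Fin 4, ((c ^^^ d ^^^ e : Fin 4) + 4 * (c ^^^ mulTwo d ^^^ mulThree e : Fin 4) +
        16 * c + 64 * d + 256 * e : ℕ) ∈ codewords := by
      decide +kernel
    rintro ⟨h0, h1⟩
    rw [idx, h0, h1]
    exact h _ _ _

theorem xor_mem_codewords {b c : ℕ} (hb : b ∈ codewords) (hc : c ∈ codewords) :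
    Nat.xor b c ∈ codewords := by
  have h : (codewords.all fun b => codewords.all fun c =>
      Nat.blt (Nat.xor b c) 1024 && bit codeMask (Nat.xor b c)) = true := by
    decide +kernel
  have := List.all_eq_true.1 (List.all_eq_true.1 h b hb) c hc
  rw [Bool.and_eq_true] at this
  obtain ⟨x, hx⟩ := exists_idx_eq (Nat.le_of_ble_eq_true this.1)
  rw [← hx] at this ⊢
  exact (idx_mem_codewords x).2 ((bit_codeMask x).1 this.2)

/-- Each letter occupies its own pair of bits, so bitwise addition of numbers is letterwise addition
of words. The Horner form lets the pairs be split off one at a time. -/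
theorem idx_xor (x y : Fin 5 → Fin 4) : idx (fun j => x j ^^^ y j) = Nat.xor (idx x) (idx y) := by
  have four : ∀ a b c d : ℕ, b < 4 → d < 4 →
      (b + 4 * a) ^^^ (d + 4 * c) = (b ^^^ d) + 4 * (a ^^^ c) := by
    intro a b c d hb hd
    have h1 : ((b + 4 * a) ^^^ (d + 4 * c)) / 2 ^ 2 = a ^^^ c := by
      rw [Nat.xor_div_two_pow]
      congr 1 <;> omega
    have h2 : ((b + 4 * a) ^^^ (d + 4 * c)) % 2 ^ 2 = b ^^^ d := by
      rw [Nat.xor_mod_two_pow]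
      congr 1 <;> omega
    omega
  have val : ∀ a b : Fin 4, ((a ^^^ b : Fin 4) : ℕ) = (a : ℕ) ^^^ (b : ℕ) := by decide
  have horner : ∀ z : Fin 5 → Fin 4,
      idx z = z 0 + 4 * (z 1 + 4 * (z 2 + 4 * (z 3 + 4 * (z 4 : ℕ)))) := by
    intro z
    rw [idx]
    ring
  change _ = idx x ^^^ idx y
  rw [horner, horner, horner, four _ _ _ _ (x 0).2 (y 0).2, four _ _ _ _ (x 1).2 (y 1).2,
    four _ _ _ _ (x 2).2 (y 2).2, four _ _ _ _ (x 3).2 (y 3).2]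
  simp only [val]

theorem digit_idx (x : Fin 5 → Fin 4) (i : Fin 5) : digit (idx x) i = x i := by
  have e : digit (idx x) i = idx x / 4 ^ (i : ℕ) % 4 := by
    have h3 : ∀ n : ℕ, Nat.land n 3 = n % 4 := fun n => Nat.and_two_pow_sub_one_eq_mod n 2
    have hs : ∀ n k : ℕ, Nat.shiftRight n k = n / 2 ^ k := fun n k => Nat.shiftRight_eq_div_pow n k
    rw [digit, h3, hs]
    change idx x / 2 ^ (2 * (i : ℕ)) % 4 = _
    rw [pow_mul, show 2 ^ 2 = 4 from rfl]
  have h0 := (x 0).2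
  have h1 := (x 1).2
  have h2 := (x 2).2
  have h3 := (x 3).2
  have h4 := (x 4).2
  rw [e, idx]
  fin_cases i <;> simp only [Fin.zero_eta, Fin.mk_one, Fin.reduceFinMk, Fin.isValue, pow_zero,
    pow_one, Nat.reducePow] <;> omega

/-- Replace the letter in position `i` by `v`. -/
def setDigit (y i v : ℕ) : ℕ :=
  Nat.add (Nat.sub y (Nat.shiftLeft (digit y i) (Nat.mul 2 i))) (Nat.shiftLeft v (Nat.mul 2 i))

theorem idx_update (x : Fin 5 → Fin 4) (i : Fin 5) (v : Fin 4) :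
    idx (update x i v) = setDigit (idx x) i v := by
  have hs : ∀ n : ℕ, Nat.shiftLeft n (Nat.mul 2 i) = n * 4 ^ (i : ℕ) := by
    intro n
    change n <<< (2 * (i : ℕ)) = _
    rw [Nat.shiftLeft_eq, pow_mul, show 2 ^ 2 = 4 from rfl]
  rw [setDigit, digit_idx, hs, hs]
  change _ = idx x - x i * 4 ^ (i : ℕ) + v * 4 ^ (i : ℕ)
  fin_cases i <;> simp only [idx, Fin.zero_eta, Fin.mk_one, Fin.reduceFinMk, Fin.isValue, pow_zero,
    pow_one, Nat.reducePow, update_self, ne_eq, Fin.reduceEq, not_false_eq_true, update_of_ne] <;>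
    omega

theorem letterOf_lt (g i v : ℕ) : letterOf g i v < 4 :=
  lt_of_le_of_lt Nat.and_le_right (by norm_num)

theorem idx_eq_sum (x : Fin 5 → Fin 4) : idx x = ∑ j : Fin 5, (x j : ℕ) * 4 ^ (j : ℕ) := by
  rw [Fin.sum_univ_five, idx]
  simp only [Fin.isValue, Fin.coe_ofNat_eq_mod, Nat.zero_mod, pow_zero, mul_one, Nat.reduceMod,
    pow_one, Nat.reducePow]
  ring

/-- The arithmetic action adds up the contributions of the source positions, the isotopy is
described by target positions; reindexing the sum along `p` identifies them. -/
theorem act_idx (g : ℕ) (p : Equiv.Perm (Fin 5)) (f : Fin 5 → Fin 4 ≃ Fin 4) (c x : Fin 5 → Fin 4)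
    (hp : ∀ i, (p i : ℕ) = dirOf g i)
    (hf : ∀ i v, f i v = c (p i) ^^^ ⟨letterOf g i v, letterOf_lt _ _ _⟩) :
    idx (isotopy p f x) = act g (idx c) (idx x) := by
  have e : isotopy p f x = fun j => c j ^^^
      ⟨letterOf g (p.symm j) (x (p.symm j)), letterOf_lt _ _ _⟩ := by
    ext j
    rw [isotopy_apply, hf, Equiv.apply_symm_apply]
  rw [e, idx_xor, act]
  congr 1
  rw [idx_eq_sum, ← Equiv.sum_comp p]
  simp only [Equiv.symm_apply_apply]
  rw [Fin.sum_univ_five]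
  have part : ∀ i : Fin 5, letterOf g i (x i) * 4 ^ (p i : ℕ) = actPart g (idx x) i := by
    intro i
    rw [actPart, digit_idx, ← hp]
    change _ = letterOf g i (x i) <<< (2 * (p i : ℕ))
    rw [Nat.shiftLeft_eq, pow_mul, show 2 ^ 2 = 4 from rfl]
  rw [part, part, part, part, part]
  rfl

/-- The number `g` describes a symmetry of the code that fixes the zero word. -/
def isSymmetry (g : ℕ) : Bool :=
  ((List.range 5).all fun i =>
    Nat.blt (dirOf g i) 5 && Nat.beq (letterOf g i 0) 0 &&
    ((List.range 5).all fun j => Nat.beq i j || !Nat.beq (dirOf g i) (dirOf g j)) &&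
    ((List.range 4).all fun v => (List.range 4).all fun w =>
      Nat.beq v w || !Nat.beq (letterOf g i v) (letterOf g i w))) &&
  codewords.all fun y => bit codeMask (act g 0 y)

theorem isSymmetry_symmetry : ∀ k < 360, isSymmetry (symmetry k) = true := by
  decide +kernel

/-- `k` and `c` describe the automorphism `isotopy p f` of the graph and the code. -/
structure IsRealization (k : ℕ) (c : Fin 5 → Fin 4) (p : Equiv.Perm (Fin 5))
    (f : Fin 5 → Fin 4 ≃ Fin 4) : Prop where
  dirOf_eq : ∀ i : Fin 5, dirOf (symmetry k) i = p i
  idx_eq : ∀ x, idx (isotopy p f x) = act (symmetry k) (idx c) (idx x)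
  mem_iff : ∀ x, isotopy p f x ∈ modelCode ↔ x ∈ modelCode
  apply_eq : ∀ i v, f i v = c (p i) ^^^ ⟨letterOf (symmetry k) i v, letterOf_lt _ _ _⟩
  letterOf_zero : ∀ i : Fin 5, letterOf (symmetry k) i 0 = 0

set_option exponentiation.threshold 1024 in
theorem exists_isRealization {k : ℕ} (hk : k < 360) {c : Fin 5 → Fin 4} (hc : c ∈ modelCode) :
    ∃ p f, IsRealization k c p f := by
  have h := isSymmetry_symmetry k hk
  generalize hg : symmetry k = g at h
  simp only [isSymmetry, Bool.and_eq_true, List.all_eq_true, List.mem_range, Bool.or_eq_true,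
    Bool.not_eq_true'] at h
  obtain ⟨h, hcode⟩ := h
  have hlt : ∀ i : Fin 5, dirOf g i < 5 := fun i =>
    Nat.le_of_ble_eq_true (h i i.2).1.1.1
  have hinj : Injective fun i : Fin 5 => (⟨dirOf g i, hlt i⟩ : Fin 5) := by
    intro i j hij
    rcases (h i i.2).1.2 j j.2 with e | e
    · exact Fin.ext (Nat.eq_of_beq_eq_true e)
    · rw [Fin.mk.injEq] at hij
      rw [hij, Nat.beq_refl] at e
      exact absurd e (by simp)
  let p : Equiv.Perm (Fin 5) := Equiv.ofBijective _ (Finite.injective_iff_bijective.1 hinj)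
  have hxor : ∀ a b b' : Fin 4, a ^^^ b = a ^^^ b' → b = b' := by decide
  have finj : ∀ i : Fin 5, Injective fun v : Fin 4 =>
      c (p i) ^^^ (⟨letterOf g i v, letterOf_lt _ _ _⟩ : Fin 4) := by
    intro i v w hvw
    have hvw := hxor _ _ _ hvw
    rcases (h i i.2).2 v v.2 w w.2 with e | e
    · exact Fin.ext (Nat.eq_of_beq_eq_true e)
    · rw [Fin.mk.injEq] at hvw
      rw [hvw, Nat.beq_refl] at e
      exact absurd e (by simp)
  let f : Fin 5 → Fin 4 ≃ Fin 4 := fun i =>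
    Equiv.ofBijective _ (Finite.injective_iff_bijective.1 (finj i))
  have hidx : ∀ x, idx (isotopy p f x) = act g (idx c) (idx x) := fun x =>
    act_idx g p f c x (fun _ => rfl) (fun _ _ => rfl)
  -- The symmetry fixing the zero word maps the code into itself by the table check, and the
  -- translation by `c` stays inside because the code is closed under addition.
  have hmem : ∀ x ∈ modelCode, isotopy p f x ∈ modelCode := by
    intro x hx
    have hx' := hcode _ ((idx_mem_codewords x).2 hx)
    -- `codeMask` has no set bit from 1024 on.
    have hb : act g 0 (idx x) < 1024 := by
      by_contra hge
      have hlt : codeMask < 2 ^ act g 0 (idx x) :=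
        lt_of_lt_of_le (show codeMask < 2 ^ 1024 by decide +kernel)
          (Nat.pow_le_pow_right (by norm_num) (not_lt.1 hge))
      rw [bit_eq_testBit, Nat.testBit_lt_two_pow hlt] at hx'
      exact Bool.false_ne_true hx'
    obtain ⟨y, hy⟩ := exists_idx_eq hb
    rw [← hy, bit_codeMask, ← idx_mem_codewords] at hx'
    rw [← idx_mem_codewords, hidx]
    have e : act g (idx c) (idx x) = Nat.xor (idx c) (idx y) := by
      rw [hy]
      change idx c ^^^ _ = idx c ^^^ (0 ^^^ _)
      rw [Nat.zero_xor]
    rw [e]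
    exact xor_mem_codewords ((idx_mem_codewords c).2 hc) hx'
  refine ⟨p, f, fun i => by rw [hg]; rfl, fun x => by rw [hg]; exact hidx x,
    fun x => ⟨fun hx => ?_, hmem x⟩,
    fun i v => by subst hg; rfl, fun i => by rw [hg]; exact Nat.eq_of_beq_eq_true (h i i.2).1.1.2⟩
  -- An injective map of the finite code into itself is onto, which gives the converse implication.
  let r : modelCode → modelCode := fun y => ⟨isotopy p f y.1, hmem y.1 y.2⟩
  have hr : Injective r := fun y z hyz =>
    Subtype.ext ((isotopy p f).injective (congrArg Subtype.val hyz))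
  obtain ⟨y, hy⟩ := (Finite.injective_iff_surjective.1 hr) ⟨_, hx⟩
  have : y.1 = x := (isotopy p f).injective (congrArg Subtype.val hy)
  exact this ▸ y.2

/-! ### The search -/

/-- The list `l` of prescribed directions is respected by `d`. -/
def Satisfies (l : List (ℕ × ℕ)) (d : (Fin 5 → Fin 4) → Fin 5) : Prop :=
  ∀ q ∈ l, ∀ x ∉ modelCode, idx x = q.1 → (d x : ℕ) = q.2

/-- The prescriptions that occur in the search. The first eleven determine a direction function. -/
def patterns : List (List (ℕ × ℕ)) := [
  [(1, 1), (2, 2), (3, 3), (266, 2), (201, 4), (738, 1)],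
  [(1, 1), (2, 2), (3, 3), (450, 2), (201, 4), (64, 1)],
  [(1, 1), (2, 2), (3, 3), (513, 2), (530, 3), (392, 0), (4, 4)],
  [(1, 1), (2, 2), (3, 3), (273, 1), (338, 1), (114, 4), (196, 2)],
  [(1, 1), (2, 2), (3, 3), (263, 3), (321, 1), (266, 2), (528, 1)],
  [(1, 1), (2, 2), (3, 3), (291, 3), (450, 2), (321, 1), (776, 2)],
  [(1, 1), (2, 2), (3, 3), (136, 0), (256, 2), (51, 4)],
  [(1, 1), (2, 2), (3, 3), (44, 0), (98, 4), (72, 4), (4, 2)],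
  [(1, 1), (2, 2), (3, 3), (44, 0), (98, 4), (72, 4), (52, 3)],
  [(1, 1), (2, 2), (3, 3), (52, 0), (197, 4), (528, 3)],
  [(1, 1), (2, 2), (3, 3), (264, 0), (544, 0), (115, 4), (120, 4), (20, 4)],
  -- The numbers 1, 2, 3 are the neighbours of the zero codeword in position 0. Their directions are
  -- pairwise different (this pattern and the next), all equal, or split 1 + 2. When they are all
  -- equal, the neighbours 4, 8, 12 in position 1 and then 16, 32, 48 in position 2 are
  -- distinguished further.
  [(1, 1), (2, 2), (3, 3)],
  [(1, 1), (2, 3), (3, 2)],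
  [(1, 1), (2, 1), (3, 1), (4, 2), (8, 2), (12, 2), (16, 0), (32, 0), (48, 0)],
  [(1, 1), (2, 1), (3, 1), (4, 2), (8, 2), (12, 2), (16, 3), (32, 3), (48, 3)],
  [(1, 1), (2, 1), (3, 1), (4, 2), (8, 2), (12, 2), (16, 0), (32, 0), (48, 3)],
  [(1, 1), (2, 1), (3, 1), (4, 2), (8, 2), (12, 2), (16, 0), (32, 3), (48, 3)],
  [(1, 1), (2, 1), (3, 1), (4, 2), (8, 2), (12, 2), (16, 3), (32, 3), (48, 4)],
  [(1, 1), (2, 1), (3, 1), (4, 2), (8, 2), (12, 2)],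
  [(1, 1), (2, 1), (3, 1), (4, 2), (8, 3), (12, 3)],
  [(1, 1), (2, 1), (3, 1)],
  [(1, 1), (2, 2), (3, 2)],
  []]

def pattern (r : ℕ) : List (ℕ × ℕ) := patterns.getD r []

theorem pattern_snd_lt (r : ℕ) : ∀ q ∈ pattern r, q.2 < 5 := by
  have h : ∀ l ∈ patterns, ∀ q ∈ l, q.2 < 5 := by decide
  intro q hq
  rw [pattern, List.getD_eq_getElem?_getD] at hq
  by_cases hr : r < patterns.length
  · rw [List.getElem?_eq_getElem hr] at hq
    exact h _ (List.getElem_mem hr) q hq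
  · rw [List.getElem?_eq_none (not_lt.1 hr)] at hq
    simp at hq

/-- The word with number `x` has the single candidate direction `i`. -/
def forced (m : Masks) (x i : ℕ) : Bool := bit m.unique x && bit (m.get i) x

/-- The images of the prescriptions `l` are enforced by `m`. -/
def matchPattern (m : Masks) (g c : ℕ) : List (ℕ × ℕ) → Bool
  | [] => true
  | q :: l => bif forced m (act g c q.1) (dirOf g q.2) then matchPattern m g c l else false

/-- The number `v` encodes a symmetry, a codeword and a pattern before the `r`-th one such that the
image of this pattern is enforced by `m`. -/
def closeLeaf (m : Masks) (r v : ℕ) : Bool :=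
  -- The encoding is `v = 1024 * (360 * t + k) + c`, with pattern `t`, symmetry `k` and codeword
  -- `c`.
  let c := Nat.land v 1023
  let k := Nat.shiftRight v 10
  let t := Nat.div k 360
  Nat.blt t r && bit codeMask c && matchPattern m (symmetry (Nat.mod k 360)) c (pattern t)

/-- Depth first search, guided by a list of numbers: a number below `1024` is a word whose direction is
guessed, the other ones refer to an earlier pattern. The result is the rest of the list. -/
def search (r : ℕ) : ℕ → Masks → List ℕ → Option (List ℕ)
  | 0, _, _ => none
  | n + 1, m₀, s =>
    let m := propagate 100 0 m₀
    bif m.full then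
      match s with
      | [] => none
      | v :: s =>
        bif Nat.ble 1024 v then bif closeLeaf m r (Nat.sub v 1024) then some s else none
        else
          match search r n (restrict v 0 m) s with
          | none => none
          | some s =>
            match search r n (restrict v 1 m) s with
            | none => none
            | some s =>
              match search r n (restrict v 2 m) s with
              | none => none
              | some s =>
                match search r n (restrict v 3 m) s with
                | none => none
                | some s => search r n (restrict v 4 m) s
    -- A refuted branch consumes no entry of the certificate.
    else some s

/-- The lines that avoid the code. -/
def initial : Masks :=
  ⟨0xfff0ff0ff0ff0ffff0ff0ffffff0ff0f0ffff0ffff0ffff0ff0ffff00ffff0ff0ffff0ffff0ffff0ff0ffff00ffff0fffff0ff0ff0ff0ffff0ff0ffffff0ff0fff0ffff00ffff0ff0ffff0ffff0ffff0f0ff0ffffff0ff0ffff0ff0ff0ff0ffff0ff0ffffff0ff0ffff0ff0ff0ff0fffff0ffff00ffff0ff0ffff0ffff0ffff0,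
    0x7777bbbbddddeeeebbbb7777eeeeddddddddeeee7777bbbbeeeeddddbbbb7777bbbb7777eeeedddd7777bbbbddddeeeeeeeeddddbbbb7777ddddeeee7777bbbbddddeeee7777bbbbeeeeddddbbbb77777777bbbbddddeeeebbbb7777eeeeddddeeeeddddbbbb7777ddddeeee7777bbbbbbbb7777eeeedddd7777bbbbddddeeee,
    0xedb7edb7edb7edb77bde7bde7bde7bdede7bde7bde7bde7bb7edb7edb7edb7edb7edb7edb7edb7edde7bde7bde7bde7b7bde7bde7bde7bdeedb7edb7edb7edb77bde7bde7bde7bdeedb7edb7edb7edb7b7edb7edb7edb7edde7bde7bde7bde7bde7bde7bde7bde7bb7edb7edb7edb7ededb7edb7edb7edb77bde7bde7bde7bde,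
    0xdbe77ebdbd7ee7dbdbe77ebdbd7ee7dbdbe77ebdbd7ee7dbdbe77ebdbd7ee7dbbd7ee7dbdbe77ebdbd7ee7dbdbe77ebdbd7ee7dbdbe77ebdbd7ee7dbdbe77ebde7dbbd7e7ebddbe7e7dbbd7e7ebddbe7e7dbbd7e7ebddbe7e7dbbd7e7ebddbe77ebddbe7e7dbbd7e7ebddbe7e7dbbd7e7ebddbe7e7dbbd7e7ebddbe7e7dbbd7e,
    0xbed7d7be7debeb7deb7d7debd7bebed7d7bebed7eb7d7deb7debeb7dbed7d7bebed7d7be7debeb7deb7d7debd7bebed7d7bebed7eb7d7deb7debeb7dbed7d7bebed7d7be7debeb7deb7d7debd7bebed7d7bebed7eb7d7deb7debeb7dbed7d7bebed7d7be7debeb7deb7d7debd7bebed7d7bebed7eb7d7deb7debeb7dbed7d7be⟩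

def start : List (ℕ × ℕ) → Masks
  | [] => initial
  | q :: l => restrict q.1 q.2 (start l)

def checkSearch (r : ℕ) (s : List ℕ) : Bool := (search r 50 (start (pattern r)) s).isSome

/-- A candidate absent from `initial` belongs to a word and a direction whose line meets the code;
this is checked for all words and directions. -/
theorem compatible_initial {d : (Fin 5 → Fin 4) → Fin 5} (hd : IsDirection modelCode d) :
    Compatible initial d := by
  have h : ((List.range 5).all fun i => (List.range 1024).all fun n =>
      bit (initial.get i) n || (List.range 4).any fun v => bit codeMask (setDigit n i v)) = true := by
    decide +kernel
  intro x hx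
  have := List.all_eq_true.1 (List.all_eq_true.1 h (d x) (List.mem_range.2 (d x).2)) (idx x)
    (List.mem_range.2 (idx_lt x))
  rcases Bool.or_eq_true_iff.1 this with h | h
  · rwa [bit_eq_testBit] at h
  · obtain ⟨v, hv, hv'⟩ := List.any_eq_true.1 h
    have e := idx_update x (d x) ⟨v, List.mem_range.1 hv⟩
    dsimp only at e
    rw [← e, bit_codeMask] at hv'
    exact absurd hv' (hd.update_notMem x hx _)

theorem compatible_start {d : (Fin 5 → Fin 4) → Fin 5} (hd : IsDirection modelCode d) :
    ∀ {l : List (ℕ × ℕ)}, Satisfies l d → Compatible (start l) d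
  | [], _ => compatible_initial hd
  | q :: _, h =>
    (compatible_start hd fun q' hq' => h q' (List.mem_cons_of_mem _ hq')).restrict
      (h q List.mem_cons_self)

theorem forced_of_matchPattern {m : Masks} {g c : ℕ} :
    ∀ {l : List (ℕ × ℕ)}, matchPattern m g c l = true →
      ∀ q ∈ l, forced m (act g c q.1) (dirOf g q.2) = true
  | [], _, q, hq => by simp at hq
  | q' :: l, h, q, hq => by
    have h : (forced m (act g c q'.1) (dirOf g q'.2) && matchPattern m g c l) = true := by
      rw [← h, matchPattern]
      cases forced m (act g c q'.1) (dirOf g q'.2) <;> rfl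
    rw [Bool.and_eq_true] at h
    rcases List.mem_cons.1 hq with rfl | hq
    · exact h.1
    · exact forced_of_matchPattern h.2 q hq

/-- If `m` forces the images of the prescriptions of pattern `t`, then every `d` compatible with `m`
becomes, after pulling back along the symmetry, a direction function satisfying pattern `t` itself.
-/
theorem satisfies_pullback {m : Masks} {d : (Fin 5 → Fin 4) → Fin 5} (hm : Compatible m d)
    {k : ℕ} {c : Fin 5 → Fin 4} {p : Equiv.Perm (Fin 5)} {f : Fin 5 → Fin 4 ≃ Fin 4}
    (hpf : IsRealization k c p f) {t : ℕ}
    (h : matchPattern m (symmetry k) (idx c) (pattern t) = true) :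
    Satisfies (pattern t) fun x => p.symm (d (isotopy p f x)) := by
  intro q hq x hx hxq
  have hlt := pattern_snd_lt t q hq
  have hf := forced_of_matchPattern h q hq
  rw [forced, bit_eq_testBit, bit_eq_testBit, Bool.and_eq_true, ← hxq, ← hpf.idx_eq] at hf
  have hd := hpf.dirOf_eq ⟨q.2, hlt⟩
  dsimp only at hd
  rw [hd] at hf
  have := eq_of_testBit_unique hf.1 (hm _ ((hpf.mem_iff x).not.2 hx)) hf.2
  dsimp only
  rw [this, Equiv.symm_apply_apply]

/-- At a branching word `d` takes one of the five values, and the corresponding subsearch applies.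
At a leaf the pullback of `d` satisfies an earlier pattern, hence has property `Q`, and invariance
returns `Q` to `d`. Refuted branches contain no `d`. -/
theorem search_sound {Q : ((Fin 5 → Fin 4) → Fin 5) → Prop} {r : ℕ}
    (earlier : ∀ t < r, ∀ d, IsDirection modelCode d → Satisfies (pattern t) d → Q d)
    (symm : ∀ d p f, (∀ x, isotopy p f x ∈ modelCode ↔ x ∈ modelCode) → IsDirection modelCode d →
      Q (fun x => p.symm (d (isotopy p f x))) → Q d)
    {d : (Fin 5 → Fin 4) → Fin 5} (hd : IsDirection modelCode d) :
    ∀ (n : ℕ) (m : Masks) (s : List ℕ), (search r n m s).isSome = true → Compatible m d → Q d := by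
  intro n
  induction n with
  | zero => intro m s h; exact absurd h (by simp [search])
  | succ n ih =>
    intro m₀ s h hm₀
    have hm := hm₀.propagate hd 100 0
    rw [search.eq_def] at h
    dsimp only at h
    generalize propagate 100 0 m₀ = m at h hm
    rw [hm.full, cond_true] at h
    match s with
    | [] => simp at h
    | v :: s =>
      dsimp only at h
      cases hv : Nat.ble 1024 v with
      | true =>
        rw [hv, cond_true] at h
        cases hl : closeLeaf m r (Nat.sub v 1024) with
        | false => rw [hl] at h; simp at h
        | true =>
          simp only [closeLeaf, Bool.and_eq_true] at hl
          obtain ⟨⟨ht, hc⟩, hmatch⟩ := hl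
          set c₀ := Nat.land (Nat.sub v 1024) 1023
          have hc₀ : c₀ < 1024 := lt_of_le_of_lt Nat.and_le_right (by norm_num)
          obtain ⟨c, hcc⟩ := exists_idx_eq hc₀
          rw [← hcc] at hc hmatch
          obtain ⟨p, f, hpf⟩ := exists_isRealization
            (Nat.mod_lt (Nat.shiftRight (Nat.sub v 1024) 10) (by norm_num : 0 < 360))
            ((bit_codeMask c).1 hc)
          exact symm d p f hpf.mem_iff hd (earlier _ (Nat.le_of_ble_eq_true ht) _
            (hd.pullback p f hpf.mem_iff) (satisfies_pullback hm hpf hmatch))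
      | false =>
        rw [hv, cond_false] at h
        -- If the guessed number is not that of a word outside the code, the restriction excludes
        -- nothing, and the first subsearch alone suffices.
        by_cases hx : ∃ x, x ∉ modelCode ∧ idx x = v
        · obtain ⟨x, hx, rfl⟩ := hx
          have hres : Compatible (restrict (idx x) (d x) m) d :=
            hm.restrict fun y _ hy => by rw [idx_injective hy]
          generalize d x = j at hres
          revert h
          cases h0 : search r n (restrict (idx x) 0 m) s with
          | none => intro h; simp at h
          | some s0 =>
            dsimp only
            cases h1 : search r n (restrict (idx x) 1 m) s0 with
            | none => intro h; simp at h
            | some s1 =>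
              dsimp only
              cases h2 : search r n (restrict (idx x) 2 m) s1 with
              | none => intro h; simp at h
              | some s2 =>
                dsimp only
                cases h3 : search r n (restrict (idx x) 3 m) s2 with
                | none => intro h; simp at h
                | some s3 =>
                  dsimp only
                  intro h4
                  fin_cases j
                  · exact ih _ s (by rw [h0]; rfl) hres
                  · exact ih _ s0 (by rw [h1]; rfl) hres
                  · exact ih _ s1 (by rw [h2]; rfl) hres
                  · exact ih _ s2 (by rw [h3]; rfl) hres
                  · exact ih _ s3 h4 hres
        · have hres : Compatible (restrict v 0 m) d :=
            hm.restrict fun y hy hyv => absurd ⟨y, hy, hyv⟩ hx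
          cases h0 : search r n (restrict v 0 m) s with
          | none => rw [h0] at h; simp at h
          | some s0 => exact ih _ s (by rw [h0]; rfl) hres

/-! ### Certificates for the search -/

def searchTree11 : List ℕ := [
  39, 357, 742, 284, 16, 15, 278, 375, 4, 16, 10, 334, 51, 10, 202, 81, 282, 223, 223, 68, 537,
  279, 4, 23, 74, 33, 322, 70, 309, 466, 987, 108, 48, 12, 818, 563, 104, 725, 486, 24, 565, 514,
  319, 25, 555, 12, 14, 25, 283, 20, 4, 891, 20, 585, 26, 49, 742, 878, 30, 129, 771, 601130,
  800867, 771, 232490, 1370154, 287, 4, 201, 859915, 371712, 565, 571, 53, 453, 100, 373, 343,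
  873, 24, 27, 14, 4, 361, 795, 361, 217, 90, 225, 193, 279, 788, 225, 491, 394, 14, 601, 622, 36,
  1846272, 1514496, 12, 1891665, 1540433, 192, 669097, 775816, 15, 643, 507, 853, 546, 546, 549,
  547, 768, 76, 1406377, 319913, 76, 850589, 688553, 433, 427, 426, 15, 282, 471, 530, 517, 14,
  14, 902, 4, 49, 4, 245, 15, 8, 19, 405, 426, 53, 350, 136, 463, 895, 514, 517, 514, 517, 514,
  517, 514, 219, 2363134, 53, 56, 422, 19, 272, 935, 19, 853, 112, 742, 59, 359, 44, 275, 27, 393,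
  355, 614, 179, 20, 555, 12, 898, 212, 873, 491, 68, 905, 771, 398, 46, 966, 14, 12, 326, 52, 8,
  69, 662, 72, 789, 71, 129, 1003, 735, 79, 49, 514, 808146, 526535, 514, 1296583, 157895, 334, 8,
  37, 842246, 376832, 513, 902, 25, 216, 297, 409, 346, 725, 68, 8, 70, 14, 469, 87, 225, 33, 582,
  469, 101, 330, 580, 170, 502, 503, 327, 362, 14, 835, 774, 14, 571, 4, 23, 8, 14, 169, 14, 4,
  377, 19, 507, 66, 272, 503, 137, 137, 351, 44, 302, 670, 771, 774, 771, 774, 771, 774, 771, 102,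
  2426458, 132, 762, 575, 112, 27, 1003, 121, 417, 136, 486, 311, 15, 853, 991, 32, 667125,
  757556, 36, 1495040, 1851392, 12, 1547601, 1872209, 14, 818, 422, 601, 963, 969, 963, 807, 512,
  28, 1404405, 315893, 28, 833405, 684533, 433, 225, 473, 713, 144, 48, 70, 330, 16, 534, 579, 12,
  64, 554, 115, 174, 453, 789, 17, 769, 329, 215, 16, 24, 81, 581, 603, 80, 32, 207, 4, 31, 360,
  768, 60, 12, 4, 19, 262, 297, 377, 1020, 400, 646, 4, 15, 22, 23, 183, 688, 4, 193, 1118595,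
  42371, 4, 525, 769, 8, 678689, 745472, 491, 319, 349, 136, 83, 973, 44, 230, 823, 32, 665410,
  757760, 15, 1129741, 15, 4365, 539, 4, 16, 694, 4, 8, 15, 367, 119, 2220032, 159, 19, 2232320,
  2256896, 40, 753, 6, 87, 8, 23, 924, 308, 254, 572, 8, 19, 30002, 1155378, 6, 643, 769, 64,
  675595, 782336, 289, 491, 521, 64, 102, 595, 4, 149, 818, 15, 15, 811, 4, 4, 4, 810, 4, 4, 4,
  25, 87, 214, 432, 58, 121, 15, 15, 15, 15, 68, 76, 56, 209, 601, 8, 214, 870, 8, 31886, 4, 730,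
  206, 4, 385, 1122895, 61007, 385, 1100142, 429647, 484, 970, 12, 307, 442018, 1086889, 307,
  73378, 1159842, 129, 771, 23, 730, 468, 536, 12, 49, 64, 54335, 1179711, 8, 12, 207, 110, 88, 4,
  283, 877, 53, 12, 57, 215, 4, 4, 158, 8, 68, 16, 48, 16, 528, 351, 525, 197, 23, 16, 201,
  1126400, 3072, 510, 55, 49, 121, 358, 746, 4, 170, 576, 151, 439, 817, 283, 187, 8, 116, 369, 4,
  3696060, 3689472, 344, 585, 631, 4, 4, 125, 146, 772, 25, 12, 228, 424, 6, 317, 4, 595, 990039,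
  4, 1114112, 4, 39936, 224, 416, 144, 405, 4, 4, 707, 86, 438, 70, 174, 305, 15, 193, 937, 168,
  468, 414741, 147, 52, 16, 166, 4, 517, 768, 376, 12, 769, 8, 4, 4, 87, 27, 521, 14, 19, 24, 207,
  208, 4, 4, 282, 373, 178, 51, 643, 782, 32, 296770, 1423170, 12, 152, 2452644, 1013, 23, 787,
  56, 560, 192, 334, 198, 1167537, 153, 938, 8, 310049, 1457953, 2397432, 8, 135, 4, 4, 144, 661,
  678, 4, 4, 70, 521, 1169550, 548, 133, 12, 617, 23, 133, 17585, 350, 146, 8, 573, 8, 1018, 525,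
  819, 64, 306955, 1442571, 84, 2305116, 48, 701, 36, 2958780, 2590140, 12, 3319228, 2590420, 4,
  611, 19, 691, 354, 267, 68, 771, 48, 789, 146, 611, 12, 2589396, 2957312, 867, 4, 270, 1061243,
  431673, 270, 1140281, 63033, 116, 49, 4, 217, 31, 718, 4, 4, 979, 16, 15, 4, 87, 768, 464, 412,
  14, 22, 2588672, 1012, 26, 147, 38, 774, 109, 920, 25, 51, 23, 212, 916, 26, 3320832, 14, 12,
  146, 48, 761, 38, 52, 14, 46, 634, 12, 19, 46, 408, 896, 12, 787, 160, 190, 102, 467, 946, 38,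
  627, 12, 930, 12, 53, 104, 585, 378066, 119, 551, 53, 22, 525, 840665, 116, 54, 516, 8, 224, 16,
  576, 771, 19, 12, 364, 12, 770, 4, 4, 192, 361, 741, 55, 627, 4, 282, 520, 390343, 151, 438,
  741, 15, 23, 24, 4, 582, 8, 12, 38, 1150976, 27648, 121, 933862, 289, 225, 463, 277, 4, 781,
  854, 12, 57, 473, 68, 542, 513, 71, 326, 78, 8, 398, 48, 12, 12, 586, 526, 88, 727, 878, 25,
  611, 69, 14, 590, 467, 232, 29, 477, 729, 937, 133, 49, 770, 520265, 798762, 770, 151625,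
  1277001, 719, 390, 4, 83, 1006402, 408576, 486, 875, 70, 8, 68, 15, 838, 363, 85, 101, 27, 19,
  363, 346, 369, 4, 615, 681, 36, 1883136, 1502208, 12, 1866023, 1533223, 16, 681339, 763504, 130,
  562, 319, 350, 999, 521, 715, 521, 522, 768, 160, 1418619, 356731, 160, 998071, 725371, 378,
  377, 421, 112, 86, 2295453, 402, 942, 513, 522, 513, 522, 513, 522, 513, 207, 207, 76, 505, 6,
  260, 377, 15, 310, 470, 517, 522, 19, 8, 1009, 8, 15, 4, 223, 19, 6, 503, 4, 1018, 6, 815, 44,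
  729, 287, 136, 78, 454, 836, 25, 81, 70, 346, 850, 136, 12, 130, 809, 465, 8, 963, 46, 192, 789,
  107, 181, 354, 554, 10, 514, 466, 107, 8, 24, 202, 281, 123, 123, 68, 449, 225, 302, 329, 8,
  603, 12, 133, 525, 357, 24, 814, 769, 26, 319, 26, 12, 791, 12, 283, 31, 4, 783, 84, 874, 735,
  40, 978, 25, 14, 869, 757, 53, 129, 515, 593941, 794823, 515, 225301, 1351701, 315, 4, 82,
  932371, 389120, 514, 799, 354, 46, 228, 365, 491, 726, 27, 4, 14, 20, 539, 470, 89, 470, 217,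
  70, 66, 343, 401, 8, 986, 1013, 36, 1519616, 1863680, 12, 1535434, 1884618, 64, 674198, 782224,
  51, 899, 351, 746, 773, 773, 806, 775, 512, 240, 1411478, 338326, 240, 925626, 706966, 398, 299,
  536, 69, 407, 405, 505, 112, 371, 767, 769, 774, 769, 774, 769, 774, 769, 91, 2507499, 46, 46,
  28, 405, 14, 281, 363, 777, 774, 30, 4, 673, 4, 14, 8, 110, 29, 11, 4, 426, 421, 11, 264, 679,
  11, 654, 136, 869, 31, 334, 44, 738, 465, 4, 24, 43, 15, 267, 27, 402, 455, 791, 997, 79, 15, 4,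
  641, 84, 726, 343, 224, 645, 515, 481, 44, 14, 433, 12, 12, 598, 4, 226, 937, 69, 554, 227, 129,
  673, 88, 26, 278, 407, 599, 891, 115, 14, 769, 811081, 453731, 769, 1222755, 85091, 658, 497,
  12, 38, 916257, 396288, 473, 874, 16, 72, 225, 14, 235, 70, 6, 362, 993, 362, 230, 365, 351,
  193, 264, 367, 461, 469, 6, 707, 517, 6, 799, 6, 25, 6, 12, 150, 6, 478, 8, 11, 367, 146, 146,
  507, 44, 229, 2442935, 309, 953, 515, 517, 515, 517, 515, 517, 515, 160, 861, 831, 136, 27, 599,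
  345, 112, 150, 465, 976, 69, 357, 303, 8, 746, 635, 4, 671086, 738860, 36, 1870848, 1477632, 12,
  1854922, 1543626, 49, 525, 398, 421, 986, 594, 579, 579, 535, 768, 56, 1408366, 334190, 56,
  905982, 702830, 202, 267, 278, 478, 636, 392, 929, 11, 41, 4, 25, 175, 908, 4, 66, 47491,
  1137027, 11, 818, 513, 16, 680454, 764928, 503, 846, 4, 68, 16, 43, 117, 173, 33, 2239488,
  2214912, 2251776, 4, 696, 300, 125, 828, 4, 11, 10509, 1149197, 899, 514, 192, 668179, 777216,
  4, 343, 319, 505, 112, 203, 101, 541, 4, 673473, 740352, 51, 1111346, 51, 24882, 626, 52, 795,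
  4, 8, 941, 4, 4, 51, 467, 262, 24, 514, 561, 32, 115, 978, 12, 2584424, 2952192, 722, 8, 271,
  438149, 1067414, 271, 69509, 1158021, 32, 8, 46, 101, 78, 610, 33, 14, 8, 815, 8, 8, 90, 104,
  632, 46, 3325952, 12, 14, 115, 97, 933, 47, 136, 15, 82, 919, 12, 25, 171, 372, 560, 12, 534,
  240, 191, 51, 354, 634, 691, 25, 12, 755, 12, 137, 512, 352, 380, 15, 26, 2583552, 523, 47, 26,
  628, 30, 30, 680, 33, 114, 114, 152, 212, 789, 370787, 37, 795, 96, 515, 858725, 33, 469, 1001,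
  135, 914, 4, 327, 616, 407594, 104, 443, 1001, 14, 26, 68, 8, 795, 4, 12, 203, 1133568, 45056,
  149, 1008363, 139, 776, 4, 224, 16, 514, 37, 12, 720, 476, 12, 514, 8, 8, 32, 449, 486, 773, 16,
  219, 850, 8, 121, 623, 14, 14, 710, 8, 8, 8, 711, 8, 8, 8, 29, 86, 107, 432, 51, 149, 14, 14,
  14, 14, 33, 24, 28, 97, 853, 4, 107, 731, 4, 50239, 8, 871, 47, 8, 305, 1120030, 59166, 305,
  1080799, 427806, 488, 551, 12, 386, 435187, 1106421, 386, 66547, 1142771, 49, 514, 43, 871, 360,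
  836, 12, 129, 16, 34958, 1173646, 4, 12, 46, 223, 84, 8, 127, 4, 326, 733, 27, 24, 12, 106, 4,
  4, 350, 781, 41, 74, 48, 37, 1145856, 8192, 431, 43, 16, 149, 475, 999, 4, 784, 104, 122, 442,
  641, 326, 166, 4, 152, 401, 4, 3694592, 3688892, 24, 64, 32, 576, 44, 114, 136, 33, 251, 8, 512,
  757, 404, 12, 513, 4, 4, 8, 340, 789, 922, 8, 4, 157, 114, 520, 25, 12, 232, 500, 11, 397, 8,
  850, 915034, 4, 1108992, 8, 20480, 224, 496, 112, 377, 8, 8, 802, 43, 443, 255, 385, 14, 33,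
  757, 244, 360, 395337, 27, 90, 70, 773, 14, 68, 66, 46, 96, 8, 8, 351, 115, 4, 909, 4, 679, 781,
  543, 16, 311814, 1461766, 88, 2323548, 16, 957, 36, 2582972, 2951612, 12, 2583400, 3325372, 4,
  978, 51, 946, 327, 112, 571, 8, 1019, 8, 409, 179, 53, 818, 527, 192, 299539, 1424915, 116,
  2379000, 12, 681, 74, 132, 533, 896, 32, 287, 43, 1163441, 117, 759, 4, 304833, 1439425,
  2471076, 4, 58, 8, 8, 27, 773, 1176639, 857, 53, 12, 981, 57, 15537, 74, 994, 987, 200, 4, 115,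
  4, 59, 468, 512, 60, 22, 48, 11, 262, 70, 371, 298, 562, 8, 745, 14, 30, 346, 224, 825, 770,
  481, 88, 14, 227, 433, 12, 12, 8, 859, 817, 88, 875, 757, 25, 967, 226, 49, 1009, 84, 331, 38,
  375, 858, 662, 146, 14, 513, 804885, 448722, 513, 1203410, 80082, 515, 417, 12, 203, 988865,
  413696, 357, 727, 64, 225, 14, 20, 230, 27, 11, 737, 471, 234, 471, 477, 350, 33, 260, 478, 115,
  422, 136, 233, 2357861, 393, 693, 770, 777, 770, 777, 770, 777, 770, 115, 240, 478, 301, 361,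
  11, 802, 777, 11, 590, 6, 51, 6, 12, 123, 11, 367, 6, 4, 605, 567, 44, 33, 858, 315, 112, 111,
  473, 462, 4, 999, 918, 8, 677343, 745420, 36, 1482752, 1888256, 12, 1537319, 1849639, 129, 781,
  319, 505, 615, 851, 786, 786, 785, 512, 132, 1414623, 353759, 132, 980911, 722399, 353, 608, 25,
  70, 225, 608, 11, 514, 10, 40, 12, 869, 804, 27, 640, 149, 41, 453, 8, 23, 645, 97, 994, 17, 25,
  611, 137, 978, 46, 127, 278, 805, 315, 4, 49, 23, 817, 4, 4, 325, 375, 10, 162, 589, 303, 12,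
  486, 550, 204, 14, 14, 609, 521, 49, 742, 8, 85, 278, 770, 297, 205, 213, 31]

def searchTree12 : List ℕ := [
  30, 79, 606, 895, 11, 373, 8, 4, 221, 348, 80, 4057679, 709, 4, 8, 388, 4, 4361308, 860, 572, 4,
  136, 4, 4057679, 4381506, 206, 112, 16, 6, 214, 10, 7, 243, 4286851, 348, 832, 4379917, 691, 32,
  409, 731, 4056862, 860, 8, 4056862, 8, 4057425, 832, 4, 4379155, 4056401, 81, 54, 144, 4, 44,
  4157595, 22, 4232487, 189, 708, 4307099, 4279473, 143, 192, 4279473, 4307099, 22, 4, 32,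
  4204721, 4232310, 25, 4205610, 215, 432, 4306157, 4278471, 209, 4, 128, 4278471, 4306157, 8, 8,
  4129991, 4158582, 47, 4131882, 86, 8, 4129991, 4158582, 125, 293, 4232310, 4204721, 709, 7, 4,
  148, 8, 256, 870, 53, 298, 6, 4232498, 32, 8, 880, 85, 691, 4, 4, 81, 512, 858, 58, 4208417,
  119, 8, 8, 853, 25, 8, 6, 492, 32, 409, 20, 595, 535, 283, 4, 213, 72, 134, 4, 4352855, 519,
  150, 126, 4352855, 845, 1001, 4, 4, 883, 775, 4139901, 4135691, 297, 96, 138, 862, 277, 6, 10,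
  6, 6, 94, 478, 147, 4280530, 4288760, 134, 4288760, 4280530, 670, 205, 4288654, 4280484, 204,
  4288654, 4280484, 926, 10, 4287967, 322, 23, 7, 254, 817, 775, 4215639, 4135691, 157, 6, 307, 8,
  147, 355, 34, 22, 8, 795, 10, 6, 4208417, 190, 671, 103, 239, 4361289, 90, 147, 586, 6, 4288654,
  4, 4363251, 32, 4288654, 7, 595, 879, 139, 4280530, 4355171, 131, 4280530, 8, 879, 34, 641,
  4065353, 205, 22, 6, 175, 34, 8, 22, 494, 4232498, 350, 895, 10, 260, 981, 4, 129, 861, 58, 10,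
  143, 101, 41, 346, 108, 4379155, 775, 863, 32, 37, 717, 106, 60, 4351681, 37, 81, 350, 853, 631,
  7, 33, 6, 149, 861, 37, 25, 32, 4, 4, 584, 4381506, 4057425, 315, 8, 139, 76, 4355164, 68, 204,
  26, 811, 7, 100, 10, 8, 832, 888, 8, 11, 4, 4379155, 751, 8, 435, 8, 22, 252, 4, 870, 90, 54, 4,
  333, 317, 557, 191, 4, 96, 139, 48, 4351869, 305, 254, 86, 4351869, 861, 256, 300, 8, 4, 24,
  4205610, 37, 10, 224, 4057130, 38, 242, 4, 37, 4, 628, 4084778, 139, 414, 4353693, 290, 4,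
  4354203, 4214066, 310, 810, 277, 68, 50, 4205610, 106, 174, 4067216, 8, 305, 62, 4213537, 543,
  717, 81, 1008, 48, 4, 48, 1023, 720, 4353503, 134, 4066446, 11, 989, 59, 90, 49, 59, 863, 6, 4,
  723, 45, 6, 522, 4158982, 53, 560, 10, 4158982, 26, 17, 80, 26, 4, 150, 902, 26, 45, 4288019,
  638, 4205610, 37, 11, 963, 751, 322, 6, 588, 6, 8, 4066346, 116, 8, 4057130, 4361921, 4,
  4134136, 748, 4208382, 11, 4212799, 790, 4, 572, 4068129, 59, 64, 898, 4278082, 11, 174, 750,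
  54, 125, 4131882, 260, 82, 4131882, 272, 8, 235, 8, 8, 138, 715, 220, 4362477, 4215550, 808,
  263, 4084049, 592, 4084809, 707, 4215550, 973, 36, 4204792, 38, 77, 50, 995, 4, 22, 12, 532, 4,
  24, 40, 81, 850, 795, 79, 456, 192, 192, 29, 350, 32, 33, 474, 37, 4059157, 344, 4361818, 29,
  347, 93, 46, 125, 141, 101, 293, 29, 147, 4141890, 46, 989, 4279473, 147, 842, 138, 817,
  4234017, 28, 137, 960, 49, 4234017, 100, 15, 68, 113, 7, 266, 922, 525, 4355851, 15, 796, 37,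
  4059313, 33, 236, 4, 4058289, 920, 4287449, 12, 32, 4212984, 4281554, 353, 4, 111, 352, 4060547,
  12, 261, 4131085, 50, 864, 10, 8, 144, 149, 921, 225, 223, 4204721, 523, 576, 24, 77, 4204721,
  186, 4, 29, 53, 778, 4281305, 283, 38, 28, 4278520, 31, 15, 826, 88, 4356251, 432, 288, 4067919,
  4281305, 325, 4065343, 394, 97, 11, 8, 850, 330, 103, 4203638, 105, 4206691, 471, 4065560,
  4356698, 31, 778, 159, 123, 4356698, 87, 579, 471, 393, 29, 4306019, 58, 4231210, 4231210, 29,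
  4059460, 171, 850, 847, 466, 4307331, 829, 806, 4234017, 289, 4067492, 69, 231, 138, 62, 966,
  49, 1021, 469, 4132638, 4378930, 627, 4378930, 245, 193, 349, 7, 825, 242, 135, 40, 897, 53, 8,
  54, 310, 38, 157, 879, 55, 640, 4060278, 4, 4060278, 4086771, 4203638, 4213534, 4, 256, 878, 10,
  58, 46, 466, 53, 28, 174, 941, 4, 4281581, 539, 15, 4234071, 4158582, 4160101, 791, 961, 310,
  4206566, 857, 10, 4234017, 10, 77, 4158219, 566, 4353330, 15, 647, 149, 311, 58, 58, 589, 561,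
  4353330, 143, 10, 287, 537, 354, 314, 25, 4084828, 190, 4, 405, 10, 139, 694, 755, 159, 918,
  4158219, 4278082, 743, 511, 60, 49, 4356214, 322, 172, 4067483, 4, 4, 4288575, 459, 817, 4, 4,
  817, 4131085, 546, 172, 738, 15, 288, 4307331, 4354285, 247, 314, 4, 958, 514, 309, 4307099,
  905, 4157595, 698, 597, 68, 71, 369, 4, 4059157, 408, 4, 4060037, 4085194, 4067483, 546,
  4287509, 34, 625, 149, 285, 327, 587, 4, 4, 7, 170, 474, 231, 963, 4351681, 182, 50, 818, 952,
  573, 67, 4135192, 4135192, 839, 4158219, 317, 4, 909, 33, 605, 88, 169, 606, 7, 23, 23, 7,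
  4361237, 87, 293, 67, 4057130, 10, 32, 839, 256, 114, 4206691, 925, 774, 818, 1022, 32, 4214847,
  4206840, 4062096, 106, 4206840, 4214847, 4, 4062096, 4158219, 963, 31, 218, 850, 975, 28, 655,
  4, 12, 917, 37, 263, 4360710, 233, 33, 185, 289, 424, 866, 15, 463, 4307331, 610, 15, 4131085,
  4131085, 330, 606, 24, 182, 39, 605, 29, 33, 37, 7, 4353234, 223, 1010, 4, 15, 7, 4061276, 263,
  34, 346, 262, 4307331, 289, 357, 4086040, 48, 4206691, 4214948, 4086040, 7, 55, 4214948,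
  4206691, 463, 768, 45, 4214847, 149, 275, 221, 778, 441, 4157941, 4306421, 953, 707, 4232213,
  4278082, 4130971, 218, 4206691, 4130971, 37, 785, 4361747, 793, 842, 15, 15, 123, 4231210, 38,
  33, 50, 930, 37, 850, 673, 361, 4, 102, 4, 15, 409, 816, 34, 4061832, 4233426, 4059313, 143,
  4233426, 331, 7, 38, 218, 91, 305, 50, 4277403, 16, 7, 297, 31, 122, 7, 175, 4231345, 34, 7,
  363, 103, 31, 31, 275, 799, 8, 41, 483, 8, 322, 4277727, 46, 433, 7, 20, 768, 256, 79, 846, 813,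
  81, 672, 128, 128, 8, 686, 59, 4061247, 620, 4355438, 6, 606, 8, 11, 621, 90, 25, 87, 134, 123,
  571, 31, 205, 4213570, 927, 4278471, 6, 134, 866, 205, 7, 775, 4158219, 137, 896, 7, 4158219,
  70, 17, 80, 71, 8, 546, 1006, 275, 11, 4362017, 796, 11, 4, 4061383, 152, 4, 4056263, 1004,
  4283311, 6, 8, 4141220, 4287630, 587, 8, 89, 584, 4060865, 16, 563, 4204051, 6, 840, 8, 29, 156,
  255, 1007, 139, 157, 4129991, 264, 83, 4129991, 320, 4, 230, 4, 4, 55, 806, 108, 4360429,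
  4289455, 708, 266, 4084049, 627, 4085781, 802, 4289455, 557, 22, 20, 4279460, 29, 17, 738, 7,
  71, 12, 125, 321, 701, 739, 23, 4307017, 38, 4159530, 4159530, 7, 4061808, 233, 829, 899, 566,
  4132794, 82, 4234017, 879, 33, 17, 4158219, 310, 4353542, 17, 497, 263, 4353542, 175, 29, 255,
  565, 38, 38, 339, 846, 849, 654, 4306625, 325, 4380166, 183, 791, 826, 4158219, 522, 4083960,
  115, 905, 6, 185, 135, 22, 918, 4206366, 703, 4380166, 131, 607, 49, 807, 134, 147, 40, 963, 55,
  6, 53, 566, 22, 223, 857, 4, 53, 448, 4060278, 8, 4086055, 4067565, 4130934, 4141854, 512, 26,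
  858, 34, 38, 654, 53, 217, 28, 987, 4, 4287643, 301, 17, 4158333, 4232310, 4231547, 541, 303,
  586, 550, 47, 4066396, 150, 7, 767, 6, 846, 610, 121, 4130934, 105, 4132937, 4086316, 701,
  4360558, 29, 802, 221, 101, 4360558, 225, 427, 309, 4, 516, 4134444, 4360310, 313, 101, 437,
  889, 17, 10, 4362395, 787, 4, 4, 4061247, 100, 4083949, 1009, 522, 20, 4, 522, 4060547, 263,
  100, 554, 4204051, 4352295, 185, 971, 7, 619, 259, 551, 4306157, 555, 4233453, 491, 414, 144,
  794, 100, 4280341, 1004, 12, 4066978, 4062195, 4083949, 263, 145, 4208782, 7, 282, 255, 543,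
  625, 353, 4, 48, 8, 234, 686, 134, 897, 4352387, 245, 6, 774, 996, 881, 4234017, 279, 65,
  4084049, 4084049, 535, 25, 979, 11, 351, 108, 171, 350, 26, 47, 6, 6, 4355135, 125, 571, 27, 65,
  4057130, 7, 991, 818, 774, 918, 8, 4139029, 4133028, 4060108, 7, 89, 4139029, 4133028, 4060108,
  4234017, 881, 512, 69, 4132937, 897, 7, 174, 846, 913, 465, 6, 28, 4, 1023, 59, 561, 4356402,
  169, 11, 231, 523, 744, 657, 4306625, 842, 17, 330, 17, 4067634, 4067634, 610, 6, 350, 44, 230,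
  351, 31, 22, 6, 4, 4353166, 157, 902, 17, 4, 17, 4059228, 622, 562, 523, 635, 4, 4132937,
  4139256, 4065836, 10, 4065836, 53, 4139256, 4132937, 4306625, 561, 10, 657, 768, 25, 4139029,
  174, 781, 125, 707, 1002, 4306874, 4233146, 618, 305, 4157582, 4204051, 255, 4139029, 4277485,
  43, 526, 4353293, 4277485, 718, 723, 17, 6, 217, 4159687, 6, 10, 11, 543, 294, 151, 10, 982, 11,
  7, 551, 11, 1006, 520, 7, 4065760, 4158527, 4066346, 97, 4158527, 977, 10, 43, 255, 221, 778,
  11, 4, 4203757, 17, 966, 29, 101, 4159530, 7, 7, 219, 6, 981, 25, 43, 4, 525, 797, 26, 7, 649,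
  7, 711, 4, 768, 11, 578, 26, 4277917, 256, 77, 81, 351, 601, 922, 6, 11, 96, 121, 605, 201, 25,
  192, 8, 6, 788, 4379155, 4056401, 390, 4, 54, 28, 4353116, 24, 44, 52, 710, 4, 216, 7, 4, 528,
  660, 4, 6, 7, 4381506, 1006, 4, 434, 4, 16, 172, 4, 663, 215, 26, 128, 605, 256, 460, 4, 4, 22,
  4353166, 201, 7, 224, 4056263, 116, 748, 4085959, 163, 6, 47, 6, 54, 383, 4355965, 451, 4,
  4351094, 4286851, 391, 710, 279, 24, 131, 4278471, 214, 255, 4061808, 4, 385, 143, 4288193, 285,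
  397, 973, 190, 37, 4, 54, 37, 4354717, 385, 175, 91, 4354717, 515, 225, 7, 603, 25, 64, 7, 8,
  671, 218, 11, 8, 31, 137, 10, 267, 80, 4159794, 849, 579, 528, 62, 8, 6, 647, 54, 4, 4279473,
  4060958, 544, 88, 623, 136, 200, 4, 6, 4356575, 55, 4058289, 4, 152, 4065457, 278, 512, 107, 10,
  22, 4139029, 132, 136, 176, 799, 101, 122, 380, 106, 4061550, 1021, 4203757, 4, 579, 16,
  4056862, 4379155, 721, 200, 4065457, 4, 4085708, 627, 265, 46, 515, 87, 28, 4060958, 53, 675, 8,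
  4204051, 8, 4232498, 111, 12, 54, 372, 4203789, 28, 4060958, 4060278, 4140356, 11, 53, 662,
  4362071, 4, 4281668, 566, 256, 6, 915, 4067216, 4354717, 4]

def searchTree13 : List ℕ := [
  87, 549, 675, 176, 4379790, 315, 750, 4135291, 4130971, 26, 125, 4086384, 246, 593, 157, 442,
  668, 25, 225, 352, 4233540, 4380871, 26, 4231816, 653, 168, 55, 168, 4066952, 4207093, 41,
  4065604, 4204662, 65, 4360284, 587, 25, 861, 31, 4361289, 900, 47, 4362382, 93, 41, 26, 649, 29,
  773, 4086672, 4361380, 4160289, 4361380, 833, 580, 608, 107, 55, 4378834, 4378697, 55, 4158064,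
  25, 4351313, 90, 25, 610, 752, 4351313, 4141098, 107, 282, 4084757, 351, 64, 4507747, 107, 64,
  4499287, 85, 331, 46, 4577646, 4356188, 517, 4286744, 4066628, 37, 356, 29, 4139842, 37, 38,
  4355171, 25, 278, 245, 1010, 800, 4061590, 110, 658, 4360391, 4360284, 31, 65, 297, 4084192,
  465, 793, 879, 984, 26, 128, 31, 4234188, 128, 4056182, 4231492, 969, 66, 38, 61, 4354212,
  4354258, 753, 4066252, 4355320, 206, 4286744, 462, 29, 409, 26, 4288781, 281, 31, 58, 900, 41,
  4158563, 973, 25, 133, 4084624, 4129910, 4159665, 4135278, 385, 452, 504, 68, 38, 4305165,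
  4067420, 38, 4158944, 29, 4277585, 172, 25, 250, 499, 736, 4277585, 4139071, 267, 420, 157,
  4282674, 25, 319, 4141443, 245, 281, 4061464, 4434200, 38, 464, 4362488, 489, 4281624, 64,
  4232265, 4212809, 31, 64, 4453397]

def searchTree14 : List ℕ := [
  110, 183, 217, 71, 356, 429, 19, 34, 189, 33, 289, 115, 325, 41, 89, 312, 289, 321, 420, 50,
  929, 50, 17, 256, 19, 19, 373, 4576593, 299, 803, 19, 363, 800, 744, 4428842, 459, 49, 23, 23,
  132, 4277447, 543, 699, 98, 122, 19, 34, 41, 97, 4058154, 189, 135, 4649159, 158, 122, 4057109,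
  832, 4157532, 481, 361, 308, 292, 34, 204, 484, 81, 33, 288, 225, 782, 4379180, 140, 97, 76,
  769, 4059431, 597, 18, 737, 51, 18, 4360213, 49, 121, 171, 430, 783, 71, 158, 4130980, 4058154,
  256, 62, 35, 4058154, 4454442, 71, 584, 4129884, 50, 82, 373, 849, 72, 4362313, 18, 342, 584,
  49, 523, 34, 593, 156, 19, 272, 4132088, 4157532, 817, 19, 139, 4526244, 178, 150, 126, 4057109,
  265, 34, 17, 128, 924, 68, 4647111, 25, 25, 33, 33, 434, 260, 59, 4085937, 178, 29, 915, 58, 62,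
  211, 252, 4132088, 960, 272, 128, 289, 64, 17, 33, 275, 59, 128, 4527352, 196, 710, 113,
  4362303, 519, 335, 524, 25, 4232916, 178, 947, 830, 84, 17, 186, 4084007, 17, 272, 25, 33, 17,
  4159736, 86, 862, 516, 595, 4427797, 4057109, 768, 928, 233, 18, 4057109, 4453397, 728, 707,
  749, 37, 62, 4130980, 49, 231, 206, 1021, 17, 511, 18, 4361415, 29, 34, 575, 4356238, 29, 560,
  636, 82, 4429887, 167, 818, 33, 220, 291, 225, 33, 452, 35, 768, 4159736, 178, 4362313, 70, 22,
  4528220, 4129884, 97, 25, 4058211, 125, 233, 4056127, 119, 875, 523, 4208147, 64, 630, 256, 61,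
  4429887, 4086351, 585, 4129884, 23, 865, 512, 38, 4084835, 101, 484, 132, 373, 103, 4208977, 35,
  25, 178, 168, 4130980, 672, 550, 342, 553, 33, 74, 17, 291, 764, 17, 4159736, 51, 516, 120,
  4656170, 87, 4526244, 140, 312, 392, 72, 4361258, 18, 264, 19, 4231612, 282, 66, 4287794, 610,
  97, 4424803, 76, 101, 4059416, 49, 816, 38, 43, 19, 43, 4158628, 253, 53, 4429887, 256, 197,
  267, 4132088, 4056127, 541, 749, 4362720, 17, 544, 18, 23, 592, 49, 4056127, 4452415, 436, 386,
  411, 23, 4427797, 17, 251, 4129884, 268, 392, 4576662, 4575396, 290, 447, 4085937, 89, 4360213,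
  4360334, 17, 29, 300, 413, 123, 17, 19, 456, 4355145, 31, 288, 131, 41, 676, 19, 23, 4085937,
  121, 4426815, 23, 184, 794, 167, 907, 4206480, 17, 64, 908, 18, 543, 4158628, 97, 4360334]

def searchTree15 : List ℕ := [
  183, 87, 434, 348, 29, 415, 29, 317, 4280851, 65, 62, 262, 253, 4056127, 64, 41, 419, 123, 51,
  26, 252, 4085237, 4673628, 168, 407, 58, 256, 29, 37, 108, 4084757, 157, 415, 178, 4429887,
  4068148, 123, 688, 70, 4574307, 292, 380, 38, 559, 934, 4056127, 4129947, 281, 37, 343, 357, 26,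
  26, 4508693, 139, 936, 4203675, 262, 165, 88, 4056127, 38, 43, 4208285, 53, 937, 4602011, 25,
  25, 212, 204, 4159736, 254, 4508920, 207, 791, 37, 1004, 723, 68, 4362488, 753, 4214465,
  4060223, 562, 4353330, 43, 26, 4058349, 102, 46, 4129947, 4361216, 543, 548, 107, 22, 4140563,
  25, 563, 4056127, 551, 31, 219, 572, 461, 785, 1020, 205, 4132088, 4279165, 22, 509, 4129947,
  512, 4354528, 513, 4355341, 561, 178, 256, 75, 253, 4132088, 609, 4426815, 4060223, 817, 149,
  561, 4139599, 543, 4379790, 4129947, 903, 4129947, 4132825, 4129947, 711]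

def searchTree16 : List ℕ := [
  110, 183, 151, 141, 666, 336, 31, 259, 74, 33, 4647149, 4286701, 87, 656, 172, 62, 595, 259,
  4280851, 37, 34, 33, 34, 4277447, 145, 372, 185, 274, 190, 62, 26, 185, 172, 415, 325, 38,
  4085349, 417, 4213902, 4360213, 748, 26, 34, 4068148, 829, 4508693, 51, 4056595, 4084757, 139,
  4526244, 62, 113, 4056127, 4159812, 929, 37, 297, 29, 146, 190, 256, 694, 4084757, 212, 98, 636,
  598, 878, 25, 26, 783, 184, 33, 35, 4453397, 95, 4508920, 566, 38, 4721460, 31, 31, 563, 659,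
  25, 178, 656, 23, 4572315, 4060223, 4132088, 234, 4132088, 455, 230, 31, 70, 596, 4205686, 175,
  31, 391, 62, 150, 31, 4600950, 178, 168, 4130980, 640, 922, 175, 803, 22, 35, 768, 4526244, 171,
  4507812, 300, 84, 376, 26, 138, 23, 253, 53, 4429887, 455, 512, 4132088, 454, 845, 4158064, 23,
  4133455, 4056127, 544, 896, 74, 136, 277, 194, 31, 4140601, 811, 51, 4059178, 770, 4528962,
  4067492, 97, 808, 4160442, 4353449, 4600432, 4288044, 137, 72, 4133308, 4231837, 49, 4056127,
  4452415, 436, 386, 93, 4361216, 41, 410, 4360213, 87, 447, 140, 4085237, 64, 850, 22, 25, 440,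
  4507812, 4085305, 498, 31, 854, 209, 64, 305, 184, 914, 33, 163, 31, 722, 4508693, 378]

def searchTree17 : List ℕ := [
  291, 114, 320, 328, 332, 339, 245, 845, 4066873, 543, 253, 4426815, 61, 4426815, 4060223, 301,
  4060223, 4428842, 4428842, 71, 362, 134, 4428842, 4528220, 550, 25, 33, 918, 4361258, 4356614,
  4233334, 105, 4157532, 4058154, 218, 4060315, 313, 17, 38, 41, 109, 185, 38, 41, 41, 4428842,
  97, 377, 334, 4574545, 18, 318, 247, 4083775, 86, 4428842, 313, 424, 530, 4436499, 4233453, 22,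
  61, 4426815, 4059515, 154, 223, 17, 37, 37, 126, 329, 18, 71, 4428842, 19, 328, 305, 4056430,
  4426815, 115, 257, 125, 192, 4426815, 500, 18, 201, 19, 18, 440, 4157532, 169, 505, 153,
  4287530, 55, 117, 69, 328, 4133019]

def searchTree18 : List ℕ := [
  16, 32, 48, 4795392, 5532672, 5535744, 48, 5531648, 5901312, 4214784, 48, 5534720, 4583424,
  5903360, 32, 48, 5530624, 5899264, 4581376, 48, 5900288, 5164032, 6269952, 48, 4213760, 6268928,
  6270976, 32, 48, 5533696, 4212736, 5904384, 48, 4582400, 6267904, 6272000, 48, 5902336, 6273024,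
  5166080]

def searchTree19 : List ℕ := [
  175, 133, 812, 1000, 543, 4206655, 963, 4508620, 22, 4232213, 868, 894, 32, 247, 687, 4720909,
  188, 4656047, 965, 706, 16, 279, 249, 4208003, 4067786, 937, 896, 121, 22, 4380693, 457, 93,
  196, 75, 16, 193, 26, 4085556, 843, 6884129, 488, 446, 6852845, 124, 687, 22, 197, 4720363, 124,
  326, 261, 4351224, 4060359, 4056137, 4233308, 316, 420, 68, 68, 4649159, 64, 4233177, 4232472,
  629, 4649159, 43, 4286982, 4232213, 4721196, 868, 583, 260, 24, 4649159, 123, 584, 6792040,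
  6792040, 43, 4289291, 555, 6915516, 4208682, 862, 260, 26, 4060029, 310, 286, 4575527, 96, 43,
  440, 4232598, 24, 4208682, 4214983, 4232990, 805, 70, 841, 4130571, 106, 108, 90, 4056137, 890,
  960, 6756300, 4380693, 361, 6756300, 4130664, 4159475, 94, 4141155, 71, 137, 126, 107, 256, 27,
  22, 6786048, 17, 862, 858, 6681431, 256, 16, 789, 4205364, 512, 4574974, 220, 343, 4572539, 789,
  4205364, 412, 6920971, 6995691, 215, 4573432, 4158563, 168, 952, 188, 4068148, 799, 272, 969,
  4655976, 672, 4067051, 4306075, 352, 4204721, 544, 4502060, 24, 23, 934, 16, 22, 4131296,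
  4206655, 109, 253, 128, 27, 114, 117, 60, 828, 102, 24, 160, 552, 519, 69, 120, 67, 4233308,
  6828231, 717, 576, 4647560, 717, 245, 4232213, 709, 25, 38, 23, 209, 289, 6786048, 4572337,
  4206769, 628, 687, 59, 586, 94, 4434533, 121, 62, 4600088, 4232861, 636, 4507747, 244, 6680740,
  434, 421, 43, 16, 4232861, 57, 811, 37, 4600088, 718, 6866019, 4129956, 911, 805, 91, 875,
  4214784, 333, 277, 6859021, 405, 453, 524, 4278220, 333, 6791267, 4278220, 809, 37, 31, 17, 71,
  6890569, 4435086, 4509860, 1000, 906, 877, 16, 6902826, 80, 4204721, 24, 299, 796, 144, 4204721,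
  504, 4353771, 256, 746, 517, 879, 795, 287, 4282648, 6681431, 789, 4205364, 667, 4354121, 120,
  4573432, 487, 4204721, 32, 4305038, 268, 26, 262, 22, 48, 32, 4430119, 259, 969, 16, 4058668,
  6963587, 4281543, 22, 1005, 847, 4067470, 271, 104, 4281543, 4159968, 4067470, 545, 6639110,
  271, 937, 22, 4066377, 394, 4067470, 130, 107, 523, 546, 740, 788, 6896436, 275, 4720395, 23,
  963, 4499375, 22, 127, 4499375, 70, 57, 193, 4277447, 1007, 149, 71, 380, 4231323, 279, 25, 112,
  348, 6859270, 4277447, 289, 4504200, 71, 4084757, 4135011, 616, 4279019, 4277447, 170, 780, 900,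
  25, 6712075, 154, 4453397, 184, 4140852, 980, 17, 50, 84, 924, 4429601, 775, 4427653, 26, 841,
  6866792, 78, 4425801, 188, 462, 851, 4208682, 6858752, 6836211, 4204923, 18, 774, 888, 6712075,
  6858752, 4282616, 841, 440, 48, 192, 6858752, 326, 344, 4204923, 55, 4215618, 4208682, 194,
  4355171, 6884162, 32, 25, 6656872, 61, 865, 575, 121, 198, 6663260, 390, 192, 6858752, 6663260,
  125, 6663260, 570, 249, 6858752, 125, 6663260, 16, 830, 816, 710, 6755370, 4648908, 4085747,
  959, 4056333, 48, 4060252, 891, 195, 6858752, 16, 38, 350, 6712075, 807, 885, 4277447, 277, 141,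
  527, 86, 362, 33, 220, 161, 230, 4435108, 442, 48, 100, 22, 23, 78, 4425801, 1019, 51, 194, 62,
  94, 48, 290, 388, 266, 4056489, 346, 22, 308, 356, 4277447, 49, 53, 18, 74, 82, 4231323, 347,
  195, 6858752, 4656586, 586, 716, 4061276, 62, 314, 60, 6895896, 523, 4720395, 4649707, 4289259,
  81, 822, 906, 947, 567, 510, 18, 192, 4085441, 6971280, 206, 515, 23, 4453397, 627, 16, 78, 216,
  74, 16, 4083889, 4748675, 459, 198, 206, 74, 30, 947, 680, 846, 790, 4057109, 4453397, 878, 16,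
  189, 121, 667, 46, 38, 112, 934, 124, 40, 898, 819, 937, 781, 6712075, 4141625, 970, 6719243,
  867, 18, 6712075, 4675571, 192, 957, 19, 4287488, 704, 4498680, 38, 18, 4133980, 244, 691, 535,
  4453397, 4508827, 80, 4060337, 899, 828, 824, 6719243, 16, 528, 22, 6983330, 46, 67, 22, 23,
  4057109, 4427797, 124, 4430001, 4453397, 813, 242, 298, 64, 59, 193, 244, 4213760, 743, 22, 16,
  110, 6786827, 1019, 16, 254, 40, 546, 653, 165, 577, 19, 4280001, 27, 4426894, 6675555, 463,
  283, 23, 6675555, 71, 221, 4306511, 22, 4214784, 260, 49, 4283115, 38, 4453989, 16, 165, 46,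
  4379943, 4426894, 4204721, 144, 4204721, 4065811, 4067470, 571, 334, 18, 596, 4649707, 4131958,
  641, 50, 115, 68, 71, 64, 4057252, 71, 678, 655, 53, 62, 62, 4204721, 254, 46, 286, 4288512,
  668, 23, 16, 4351256, 775, 4723206, 430, 22, 6928180, 4362339, 928, 909, 60, 6663260, 94,
  4131958, 6663260, 831, 46, 50, 124, 4278220, 6663260, 16, 6791267, 771, 77, 6712075, 208,
  6908915, 308, 18, 4214784, 4205364, 335, 6663260, 6786827, 26, 534, 286, 4205364, 6663260, 208,
  6853088, 4288512, 676, 967, 564, 62, 6883527, 455, 152, 54, 4209006, 4232861, 4574709, 54,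
  4215171, 4232861, 6883527, 6995143, 609, 4060751, 208, 19, 29, 852, 4436581, 150, 609, 572, 311,
  4139126, 4427321, 193, 522, 6639110, 127, 16, 216, 4231286, 4139126, 835, 904, 16, 22, 26, 928,
  611, 22, 1002, 222, 89, 6803611, 924, 82, 4130908, 6712281, 670, 4061132, 16, 575, 720, 46,
  4130908, 4288512, 75, 4425801, 4066377, 552, 64, 330, 80, 4215053, 666, 33, 4132135, 6853014,
  662, 288, 6663260, 26, 4135011, 552, 32, 4501036, 4134444, 179, 244, 4066952, 267, 26, 4720395,
  4354827, 141, 4057230, 57, 958, 644, 589, 16, 19, 144, 100, 385, 997, 6768290, 4380849, 890, 46,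
  4065575, 45, 644, 38, 4059291, 128, 43, 699, 647, 38, 148, 4232213, 232, 33, 6976389, 413, 23,
  4453397, 16, 6700933, 34, 588, 34, 4427321, 17, 782, 106, 115, 30, 181, 87, 28, 919, 98,
  4131958, 22, 44, 6971037, 729, 4066377, 650, 521, 4429448, 4086408, 646, 90, 4057989, 4529139,
  260, 4160162, 266, 4436412, 315, 100, 277, 4498609, 33, 4720395, 184, 575, 390, 628, 64, 213,
  6693433, 4208682, 536, 37, 33, 6871688, 707, 6651585, 4500151, 23, 566, 24, 17, 4277447, 957,
  235, 163, 557, 4675657, 32, 1021, 195, 135, 4085878, 25, 4286464, 4286464, 4648829, 443,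
  4140196, 4650232, 827, 439, 4725431, 84, 107, 179, 4510597, 19, 121, 4650232, 23, 947, 697, 285,
  424, 4380296, 571, 4380296, 900, 845, 115, 950, 6644491, 68, 4427653, 854, 4158563, 208,
  4280208, 4453397, 68, 6644491, 4289332, 217, 96, 4676477, 43, 4213708, 23, 115, 16, 4129947, 22,
  240, 4141876, 4286464, 320, 4356687, 75, 4434754, 327, 4379215, 96, 974, 108, 4576319, 26,
  4208682, 783, 950, 846, 808, 24, 856, 24, 4140124, 47, 4576319, 4576420, 81, 4129947, 4066422,
  100, 23, 86, 4453397, 158, 148, 4158563, 4576420, 423, 516, 4362303, 4129947, 4649052, 311, 522,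
  4720395, 4084281, 47, 4576319, 453, 4286788, 35, 16, 299, 4214040, 4720395, 6705800, 124, 601,
  24, 512, 264, 16, 16, 4135370, 4140327, 259, 900, 408, 4380296, 94, 4282648, 807, 26, 4362358,
  151, 45, 50, 823, 38, 50, 263, 4647111, 437, 4132017, 75, 783, 827, 45, 4582555, 19, 74,
  4066377, 4452425, 167, 235, 264, 197, 4455354, 618, 16, 1019, 24, 449, 4435402, 4453518, 31,
  4204607, 735, 517, 708, 62, 4355171, 762, 4209006, 6847946, 53, 393, 4083854, 598, 41, 133,
  4362520, 309, 4056137, 525, 98, 823, 4749607, 4354258, 25, 4056137, 6755492, 548, 6680740, 25,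
  105, 16, 509, 106, 654, 209, 4601009, 971, 25, 987, 589, 4575788, 811, 923, 4131053, 37, 392,
  4206388, 16, 6787046, 616, 96, 129, 6878726, 312, 4215563, 462, 4056137, 555, 654, 53, 391, 438,
  6798905, 4214926, 105, 4454956, 119, 6810723, 4214926, 353, 4280994, 630, 6810723, 4060751, 32,
  4208909, 676, 126, 53, 53, 4065836, 25, 216, 106, 493, 96, 169, 16, 588, 4360213, 996, 512, 803,
  83, 4058913, 512, 131, 6786048, 321, 4056137, 667, 528, 6786048, 4508372, 6748315, 642, 41,
  4204286, 416, 53, 4214857, 6847757, 33, 4572784, 41, 982, 195, 570, 4206829, 16, 4208682, 508,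
  6669181, 4723412, 62, 323, 808, 77, 6719243, 251, 4502727, 4434986, 4602104, 844, 886, 6792023,
  49, 961, 6799308, 815, 107, 568, 16, 776, 807, 4575998, 135, 4060455, 6828231, 131, 6859531,
  4434986, 1022, 82, 4204923, 40, 6719243, 4599871]

def searchTree20 : List ℕ := [
  4, 8, 12, 6638592, 7013376, 7019520, 12, 7012352, 7007232, 4159488, 12, 7018496, 4528128,
  7009280, 8, 12, 7011328, 7005184, 4526080, 12, 7006208, 6643712, 7021568, 12, 4158464, 7020544,
  7015424, 8, 12, 7017472, 4157440, 7010304, 12, 4527104, 7022592, 7016448, 12, 7008256, 7014400,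
  6650880]

def searchTree21 : List ℕ := [
  39, 46, 310, 450, 65, 7596419, 7652529, 336, 353, 7393398, 7615913, 7596032, 112, 7376251, 260,
  7393575, 354, 389, 7430413, 7596512, 7633397, 7523634, 256, 7413216, 381, 7541073, 422, 7468438,
  7560598, 7430308, 7725574, 277, 143, 7671079, 7652551, 7688461, 111, 7688461, 7652589, 7671079,
  287, 273, 175, 787, 7725911, 7708179, 15, 278, 79, 542, 7725725, 7708446, 47, 7560255, 79, 559,
  625, 7376496, 7725999, 7577663, 559, 121, 7725999, 7577663, 7577663, 847, 49, 7577895, 7577869,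
  77, 7541629, 4134985, 517, 7707669, 7725999, 7725647, 7560693, 4130858, 4501546, 11, 7468095, 6,
  14, 7468074, 4, 7393301, 326, 582, 113, 7430978, 7468105, 7430768, 7689026, 77, 7708541,
  7504969, 72, 4057161, 7485440, 4435017, 72, 4057161, 7485440, 4435017, 183, 434, 7393457, 223,
  7596124, 7393457, 7430413, 4130971, 128, 7393457, 7708322, 146, 7578295, 7578274, 134, 7578295,
  7505051, 87, 7430468, 325, 842, 10, 7505730, 887, 785, 61, 7688761, 7393444, 7577718, 7708261,
  7376773, 7578455, 7430468, 7633095, 327, 455, 231, 7376071, 4141351, 7413123, 7615875, 265,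
  7633321, 7485709, 268, 4061453, 4434189, 7504896, 806, 867, 7394081, 538, 7671064, 7394081,
  7412809, 4135710, 768, 7394081, 7561104, 787, 7561190, 7561203, 775, 7561190, 7486238, 278,
  7413060, 325, 399, 8, 7485827, 422, 145, 41, 7540913, 7560487, 7394100, 7633397, 7560598,
  7376773, 7413060, 7708166, 268, 4061453, 4434189, 7504896, 181, 663, 514, 7523859, 7560723, 807,
  599, 7560723, 7707943, 547, 7560866, 7541267, 7524002, 7578295, 179, 679, 513, 7468209, 430,
  7485819, 7541142, 317, 7725949, 7505465, 7578295, 87, 7578118, 154, 7578118, 7632938, 407, 346,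
  7523634, 25, 7505797, 7633354, 7596490, 122, 7596280, 7560234, 256, 7448845, 930, 4066059,
  7633095, 87, 551, 29, 7541267, 33, 7540757, 7578118, 275, 321, 7523634, 22, 951, 7708343, 138,
  4499598, 294, 7578118, 4139150, 16, 7596032, 7413123, 422, 7523734, 4, 7560310, 7523505,
  7633095, 103, 31, 7633095, 17, 87, 7578118, 154, 7578118, 7632938, 274, 265, 7448845, 951,
  7708343, 171, 7523634, 260, 7596490, 4061464, 7633106, 375, 7596356, 7633095, 273, 288, 7523634,
  301, 486, 7523538, 7376167, 55, 7523808, 7577895, 7633191, 278, 4499725, 7413216, 7725574,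
  7632995, 225, 53, 310, 7688993, 7560310, 4429095, 7540757, 161, 7541161, 7615725, 55, 7523538,
  7577895, 7632995, 7505133, 275, 278, 7376152, 497, 7560391, 55, 7560391, 7725393, 131, 38,
  7615530, 329, 8, 7413123, 7412809, 8, 7413123, 7393659, 7485709, 137, 7523483, 201, 7708427,
  7615561, 47, 7485539, 7577663, 7596490, 265, 7412809, 7615825, 141, 7707711, 7505797, 45, 389,
  7560498, 7577895, 71, 7577699, 7540757, 310, 46, 7468074, 7633233, 7560498, 46, 7468074, 302,
  7412900, 262, 354, 7485709, 7541042, 390, 459, 7540757, 4065560, 7615946, 7468074, 22, 7468074,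
  7560310, 942, 275, 55, 7560310, 7560391, 770, 41, 7540757, 7485677, 7468074, 323, 4207715,
  4425041, 7689026, 7560498, 336, 87, 470, 7393604, 7633302, 7708166, 66, 7393379, 599, 7485919,
  7689026, 7725911, 289, 67, 7376196, 8, 7689026, 23, 7413216, 7413073, 548, 64, 7375964, 7504896,
  7393575, 64, 7375964, 7504896, 7670784, 7578420, 275, 55, 774, 790, 7560310, 7505283, 11,
  7560310, 7725574, 7560391, 135, 10, 7412809, 7725835, 795, 7560234, 7413042, 7633051, 24,
  7652551, 270, 7560498, 7485898, 771, 838, 4577398, 934, 141, 7541515, 7633894, 7596866, 7708179,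
  71, 151, 20, 7413123, 7560391, 242, 7633014, 7540946, 6, 7560310, 135, 7652551, 402, 151, 162,
  7523505, 7560598, 7560579, 6, 7632995, 7652551, 71, 195, 7633014, 7632995, 7615561, 38, 25,
  7560310, 7653207, 7652551, 135, 4278482, 20, 7413073, 7708468, 4650183, 7430165, 64, 7652551,
  86, 4655314, 4305106, 7725574, 74]

def searchTree22 : List ℕ := [
  1, 2, 3, 7375872, 7762944, 7781376, 7799808, 3, 7761920, 7744512, 4058112, 4428800, 3, 7780352,
  4426752, 7749632, 4067328, 3, 7798784, 4060160, 4435968, 7756800, 2, 3, 7760896, 7742464,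
  4424704, 4061184, 3, 7743488, 7393280, 7786496, 7803904, 3, 4057088, 7785472, 7768064, 4453376,
  3, 4427776, 7805952, 4084736, 7775232, 2, 3, 7779328, 4056064, 7750656, 4433920, 3, 4425728,
  7787520, 7769088, 4085760, 3, 7748608, 7767040, 7412736, 7811072, 3, 4066304, 4452352, 7810048,
  7792640, 2, 3, 7797760, 4429824, 4065280, 7754752, 3, 4059136, 7804928, 4454400, 7773184, 3,
  4434944, 4083712, 7812096, 7793664, 3, 7755776, 7774208, 7791616, 7430144]

theorem checkSearch_11 : checkSearch 11 searchTree11 = true := by decide +kernel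

theorem checkSearch_12 : checkSearch 12 searchTree12 = true := by decide +kernel

theorem checkSearch_13 : checkSearch 13 searchTree13 = true := by decide +kernel

theorem checkSearch_14 : checkSearch 14 searchTree14 = true := by decide +kernel

theorem checkSearch_15 : checkSearch 15 searchTree15 = true := by decide +kernel

theorem checkSearch_16 : checkSearch 16 searchTree16 = true := by decide +kernel

theorem checkSearch_17 : checkSearch 17 searchTree17 = true := by decide +kernel

theorem checkSearch_18 : checkSearch 18 searchTree18 = true := by decide +kernel

theorem checkSearch_19 : checkSearch 19 searchTree19 = true := by decide +kernel

theorem checkSearch_20 : checkSearch 20 searchTree20 = true := by decide +kernel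

theorem checkSearch_21 : checkSearch 21 searchTree21 = true := by decide +kernel

theorem checkSearch_22 : checkSearch 22 searchTree22 = true := by decide +kernel

/-- A property of direction functions that is invariant under the symmetries of the code holds in
general if it holds for the first eleven patterns. -/
theorem direction_induction {Q : ((Fin 5 → Fin 4) → Fin 5) → Prop}
    (base : ∀ t < 11, ∀ d, IsDirection modelCode d → Satisfies (pattern t) d → Q d)
    (symm : ∀ d p f, (∀ x, isotopy p f x ∈ modelCode ↔ x ∈ modelCode) → IsDirection modelCode d →
      Q (fun x => p.symm (d (isotopy p f x))) → Q d)
    (d : (Fin 5 → Fin 4) → Fin 5) (hd : IsDirection modelCode d) : Q d := by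
  have step : ∀ r s, checkSearch r s = true →
      (∀ t < r, ∀ d, IsDirection modelCode d → Satisfies (pattern t) d → Q d) →
      ∀ d, IsDirection modelCode d → Satisfies (pattern r) d → Q d :=
    fun r s hs earlier d hd h => search_sound earlier symm hd _ _ s hs (compatible_start hd h)
  -- Strong induction on the index: the certificate of a pattern refers only to patterns of smaller
  -- index.
  have all : ∀ r < 23, ∀ d, IsDirection modelCode d → Satisfies (pattern r) d → Q d := by
    intro r
    induction r using Nat.strong_induction_on with
    | _ r ih =>
      intro hr
      by_cases h11 : r < 11
      · exact base r h11
      have earlier : ∀ t < r, ∀ d, IsDirection modelCode d → Satisfies (pattern t) d → Q d :=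
        fun t ht => ih t ht (ht.trans hr)
      clear ih
      interval_cases r
      · exact step _ _ checkSearch_11 earlier
      · exact step _ _ checkSearch_12 earlier
      · exact step _ _ checkSearch_13 earlier
      · exact step _ _ checkSearch_14 earlier
      · exact step _ _ checkSearch_15 earlier
      · exact step _ _ checkSearch_16 earlier
      · exact step _ _ checkSearch_17 earlier
      · exact step _ _ checkSearch_18 earlier
      · exact step _ _ checkSearch_19 earlier
      · exact step _ _ checkSearch_20 earlier
      · exact step _ _ checkSearch_21 earlier
      · exact step _ _ checkSearch_22 earlier
  -- The last pattern is empty, so every direction function satisfies it.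
  exact all 22 (by norm_num) d hd fun q hq => absurd hq (List.not_mem_nil (a := q))

/-! ### Eleven direction functions -/

/-- Eleven direction functions, three bits for every word. -/
def tables : List ℕ := [
  0x4e44a24d20d24db4a24126d25244825126d25204a25127122e12212e12d10db0000006d40000000006d00000009047148c40008d28d28db9209126d20000001126d20000009126124e40008e08e24db0000006c24240000006e244c04c84c64a4246e34d30004590614516595240005100005216e15117014a26e30e300049a00000061c48200000000048a6c890c70c88c6cb8cb8888999219016992892093092890896c99096894a46c38e38a249800000069a4a40000000a248c6cc80c68a26426324325325b26325b25012400071b6d332122131931126026326325325b24325b25400000061b6d300000091c11484c04b84b84b81b92391b00000000071b6c30000009180004a44938a382349b49309b0004a449069b6e348449489c0002642602532532412612512517240007136137216e111171126226226324324a24a24824c64a04a64b64b60a6ca90c70c8940008138938919219110916900007136936916c19116910a40008a38a32892092892896a40006836a368c6cc88c688,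
  0x4a44a24d209249b4a24126924a44825126924a04a24d26923212212e129111b0000006940000000006900000008c46949040008d291285b8608526520000001127120000008d26125240008e08a251b0000006824240000006a250c10c8cc68a4246e34d30004590614516594e40005100004616614516415226e30e300051a00000061c4c200000000044a64884c64c90c6cb8cb9088598618416592c92093093090496498496495246c38e38a251800000069a4e40000000a250c70c80c68a2a42e32c329329b2e32db2900a400071b6932a12212d92913202e32e329331b2c32db29400000061b6930000008dc09490c0cb8cb90b81b8e38db00000000071b7030000008d80005244d38e382351b4d30db00046445065b6635045148dc0002642602532532412612512516e40007136136616610516513222a22a328330a28a28828c6ca08a68b68b60a68a88c68c9140008139138518618510516d00007137136516418516511240008a38a33092092892896e40006836a370c70c88c688,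
  0x4940004d20dc4930004120004946c34d26dc4900004d20000008244e28dc04b84c44a84c0006e34e26d80000004c20003043142d22da2632502522620006d30d26da3243142d22225149144d08dc4538544548444146d34d46dc5141144d400020c28a2cb2cc00009a0000002cc28a2c82cc00069a0006c30008a40e38d400089c0008142c12a12e12d10006980006d330c30c2cb2c82612592412612c92092c92c912471c0006e35149044d38d445085c4548544d40004d40d451471c4146d365c4526434540004d20004d00dc4d20004d40004120004d36588646638540008c40008d42d92e12212d10000000000d371c1146930002212d12912e12d92d12912c13243142902e371c9146938140008d40948d42dc2d02942d43043142942d324c24824b24c6c30000000006dc00000061c6496490496490008a44a38846cb88c48888c6d90a14a169960968948968930c30c20b28a6e30000000a26d800000069a7247040006a210c90c48b88c6cb80c48c88c6dc00048469c70c70c48c688,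
  0x88c48a8ca08a89b4a28228a269b48292269a88848a6ca68a3092092c928911b0000008a471b0000006980000006c46a43043242d232225b26025226265b86405265a0000006d262230c30c2c828c91b00000088461b00000069c9091096c968981c0008db00085906186186100000092000085965965964151a0000db00051a00000082450200000000045a65865c66431c3242db32025926124126100082400000005965965966131c3042db2949180000008940000000000949197196196918940008c30008936e38e38e009300092300089361b0000005100004d30005136c34d38e451300041300045365b4540645141244d35224136e34d34e245386445344245365b45046230c30c2cb20c90b6cb0cb8cc24b24824b24c90371b00000084c64884a64a84366386286200000092261a84b64b04a64a5116914916815136934908a45110914916994136934946a451472441272245366345206245086445265a45364345266210c70c48a68c90b60b48a88c00000048269c90b70b48a688,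
  0x88c68a90c10a28c28a20b2ca6a46820006e228828a30b30a0006244a400010c90c48b8cc70c70c48c6c80000004830008846a48a400028c28828b2cc6896890896c928c28c28b20c0006944900000008944938c46216914916e100009449300080c6ca90c50a64c04a64b44a66465a6584620006da71b5020006e40a400070c90c68b80c70471c69c0000006d869b0008946e48a44906940006834946916196994910946dc69b4940006c400000064884c64b84c6616596590610006dc61b00089c00090451b69c0000004d80a40000004e368960970950925826426425b71c9040008dc30c30c20c2cb64964964904985c06486445b61c0000004dc0000000004c364c64c64844c29a29429221b69a8940928dc2a22902922e368269469200088c6c890c70b6840000000006a40000006236896c91097090006e44a468370c90c48888c70c10c48c68b6096c94896898946e48246936940000000946900000006936946c400069408a6cc48a68b68a80c48a88c6a20004826a368a6cc48a688,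
  0x84c64a64c04c90c6ca60b6cb7246c20006e424824a24c24c0006246a400010c6cc68b6cb70c6cc88c6c80000008840008847246a400088c6c868b6cb6896c90896c92893092892090007126900000006d26936c36246d28946e400011289400080c68a48c48c90c08a48b48b72469a4984a400069a49c4840006a40a400030c28c28b20b70469c89c00000069889c0008947244a449089400048349369161949949109171949949100070200000024824a24b24b66465a85c06400071a81c0008dc0006c469c91c0000006981240000006a42cb20b2cc28c4d84a46e469a51c48400069a50c48c80c68a4cb48b8cc08a8dc1246e469a81c00000069a0000000006822cb30b2c828a4d95116d16194594510516594644508546644c35138d400084c64864c64c90400000000072400000062464b64b04c64c0006a46a468230c28c28828a70c08c88c68a60b68b88c68a8947246246928940000000926900000006926937030006920897096896892892092892896a40008846a468b70b88c688,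
  0x86186145905900000041b00065984145965964884c44c64c2a12212992990a400089b8a469c00089c6986a40008846a424125125925926425025b26465985105965972491400062400000049889a00000049b88261c00049c69a70c10c48c68a8238a349300000009b49300000089b49000000089c4946c44a34a30930004a449b89382448449b8940004a44988946e424b24b24b24826425b24326400081b00000012491c0006e445344345385245045b45385245445b45405251451c4146d28618614414510000004db4d005985945945100081c4dc4d44a04a20000004a44828db8e449c49a81c0004a449a8dc0e44490494494494240004db4e445985945944152491c4d84e40000000008120000000db8d225c25825c25230431c2dc2d28e28e00000006c20000000006da8db00061b64a84c04c64c2e12e12912816e40008908a46dc0db89469b6240008946a42c92c92092896e40000000a46d88db00069b7249040006a40c94c94898896c94094898896dc4db48469b70c50c48c688,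
  0x49469a6dc0dc4936a262300049488200000049089a00000000061a6dc8dc04b64a64b84c24c24a24c24826425a2442644816996d94d948b68870b50c4898891095094a489c00042451471c6d88dc45366466384441400000000051411c0000004140004dc4dc45106146145945485b45845b4518594594410000000dc8dc00000000081c24425b25c25b26425825c2640000004da4d800000050251c00081b51a51b06485c45a4645145044da8dc45046446285c45445b45a05b51451c41a00025c25a24425c25b2622632580dc8da00000000081a00000045845a45485c45b44245385c4dc4da41400046445a45406445905945145941b00051351c4d98d951150146485c45046451c51c00081c45b46406385c4dc4d800000050451c00000024c24824c24c2412612612596dc8db00061b64984904964900000049488400000049089c6dc0db49469b6240004946a400000041200000000051211c6d88db51271b66484445266410c50c48a88c0004244a289c6dc4db48269b70c50c48a688,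
  0x4916996d90d94936a462400049388400000049089c00000000061a6da8dc04b64a64a84c24b24a24a24826425a2422644816996d94d948b68870c50c48b88c10c50c4a489c00042451471c6d88dc45366466484441300000000051411c0000004120004db4da45206446445a45285c45845a45285c45b4420000000db8dc00000000081c24125925925926425825b2640000004db4d800000050451c00081c51c51c06485c45b4645145044db8dc45046446485c45145945905951451c41b00025925924125925b2642642580db8dc00000000081c00000045845a45285c45b44245285c4db4da41200046445a45206445905945145941b00051451c4db8dc51450446485c45046451c51c00081c45b46406485c4db4d800000050451c00000024a24824b24a24226426425a6da8dc00061a64a84c04b64a00000049388400000049089c6d90d94916996240004936a400000041300000000051411c6d88dc51471c66484445366410c50c48b88c0004244a489c6d94d948169970c50c48b688,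
  0x1122dc2e42242d20008c40008d22d82e32e33120004140005140dc4d40004d40004d40004d08dc4d38c35142442542542522dc2d03142d20008d41148d22dc2d32d32122642542502642d92d13112c12212d13112e18dc0d38d30002092892893096dc0a46a40006cb88c6888cb2d92a12a13010004940925146dc4946924146c34946924d38dc49089251424c24c24c2486dc0007040006cb80c70c8cb0dc0000000002642442522646d80007120006e30007120e38dc0008120002d12d92c13112542642642500d38dc0008d32d12212e13112d02dc2d23142542442522542d32dc2122d38d40008d21144d40dc4d40004140005140004d38dc5148c34d40004d00002e42dc2d22240000001120002e32d83122e38c40008d20000006d80007122442642642520008dc0008120006e30e37120006dc00070424c24c24824c0000dc00000080c6cb8cb70c4946dc4146924940005140924908dc5148924946c34d36920a46dc0006a42892093092892a12d93012a188c6cb8cb688,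
  0x6a20000db0006a26236e30008820006e430828a30c30c0006240008db10c70c70b6cb0000000006e02612612412618846a40008db88c68870b6cb8898891096c92892893092095126928908db5126926936c34128928946e45120928940004116e14d94d945106146146145385b45846451300051c5040006e40da8da30c30c30a20a24325b25a26226326025a2628946e44da8d889400050200089381b51a00009300051a0005116c18d98d951000000000045385b85c06451300081c00025a26224325b25a2622632600da8da0006e430a20a30c30c45846445385b51c5045130004d94d94116e146146145106185c06445385b81c0005130008d98d95116c100000051000051a00089381b51a0000930004da8d88946e45020008940000006e00000002412612612610008db00062470b6cb10c70c0006e400088230c30c30828a0000db0006a26236e30006a28946e44128928940005120928908db5126926936c35126921096c98898893092092892890008db8846a470b6cb88c688]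

def table (k : ℕ) : ℕ := tables.getD k 0

def dirAt (t n : ℕ) : ℕ := Nat.land (Nat.shiftRight t (Nat.mul 3 n)) 7

/-- The `k`-th direction function. -/
def rep (k : ℕ) (x : Fin 5 → Fin 4) : Fin 5 := Fin.ofNat 5 (dirAt (table k) (idx x))

def checkTable (t : ℕ) : Bool :=
  (List.range 1024).all fun n => bit codeMask n ||
    (Nat.blt (dirAt t n) 5 && (List.range 4).all fun v =>
      !bit codeMask (setDigit n (dirAt t n) v) &&
        Nat.beq (dirAt t (setDigit n (dirAt t n) v)) (dirAt t n))

theorem checkTable_table : ∀ k < 11, checkTable (table k) = true := by decide +kernel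

theorem not_bit_codeMask (x : Fin 5 → Fin 4) : bit codeMask (idx x) = false ↔ x ∉ modelCode := by
  rw [← bit_codeMask, Bool.not_eq_true]

theorem dirAt_table {k : ℕ} (hk : k < 11) {x : Fin 5 → Fin 4} (hx : x ∉ modelCode) :
    dirAt (table k) (idx x) = rep k x ∧ ∀ v : Fin 4,
      update x (rep k x) v ∉ modelCode ∧ dirAt (table k) (idx (update x (rep k x) v)) = rep k x := by
  have h := List.all_eq_true.1 (checkTable_table k hk) (idx x) (List.mem_range.2 (idx_lt x))
  rw [(not_bit_codeMask x).2 hx, Bool.false_or, Bool.and_eq_true] at h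
  have e : dirAt (table k) (idx x) = rep k x :=
    (Nat.mod_eq_of_lt (Nat.le_of_ble_eq_true h.1)).symm
  refine ⟨e, fun v => ?_⟩
  have hv := List.all_eq_true.1 h.2 v (List.mem_range.2 v.2)
  rw [e, ← idx_update, Bool.and_eq_true, Bool.not_eq_true', not_bit_codeMask] at hv
  exact ⟨hv.1, Nat.eq_of_beq_eq_true hv.2⟩

theorem isDirection_rep {k : ℕ} (hk : k < 11) : IsDirection modelCode (rep k) where
  update_notMem x hx v := ((dirAt_table hk hx).2 v).1
  update_eq x hx v := by
    obtain ⟨h1, h2⟩ := (dirAt_table hk hx).2 v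
    exact Fin.ext ((dirAt_table hk h1).1.symm.trans h2)

def checkPattern (k : ℕ) : Bool :=
  (pattern k).all fun q => Nat.blt q.1 1024 && !bit codeMask q.1 &&
    Nat.beq (dirAt (table k) q.1) q.2

theorem checkPattern_eq_true : ∀ k < 11, checkPattern k = true := by decide +kernel

/-- Every candidate that propagation leaves outside the code must be the tabulated direction; no
branching is involved. -/
def checkUnique (m : Masks) (t : ℕ) : Bool :=
  (List.range 5).all fun i => (List.range 1024).all fun n =>
    !bit (m.get i) n || bit codeMask n || Nat.beq (dirAt t n) i

theorem checkUnique_propagate : ∀ k < 11,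
    checkUnique (propagate 100 0 (start (pattern k))) (table k) = true := by
  decide +kernel

/-- The first eleven patterns determine the eleven direction functions. -/
theorem eq_rep_of_satisfies {k : ℕ} (hk : k < 11) {d : (Fin 5 → Fin 4) → Fin 5}
    (hd : IsDirection modelCode d) (h : Satisfies (pattern k) d) {x : Fin 5 → Fin 4}
    (hx : x ∉ modelCode) : d x = rep k x := by
  have hm := (compatible_start hd h).propagate hd 100 0 x hx
  have hu := List.all_eq_true.1 (List.all_eq_true.1 (checkUnique_propagate k hk) (d x)
    (List.mem_range.2 (d x).2)) (idx x) (List.mem_range.2 (idx_lt x))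
  rw [bit_eq_testBit, hm, (not_bit_codeMask x).2 hx] at hu
  have := Nat.eq_of_beq_eq_true hu
  exact Fin.ext (this.symm.trans (dirAt_table hk hx).1)

/-- The pairs of a symmetry and a codeword that stabilize the eleven direction functions. -/
def stabilizers : List (List (ℕ × ℕ)) := [
  -- Symmetry number 2 is the identity.
  [(2, 0)],
  [(2, 0)],
  [(2, 0)],
  [(2, 0)],
  [(2, 0)],
  [(2, 0)],
  [(2, 0), (282, 379)],
  [(2, 0), (26, 0), (38, 0)],
  [(2, 0), (26, 0), (38, 0), (2, 872), (26, 872), (38, 872)],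
  [(2, 0), (26, 0), (38, 0), (2, 724), (26, 724), (38, 724)],
  [(2, 0), (26, 0), (38, 0), (2, 872), (26, 872), (38, 872)]]

def stabilizer (k : ℕ) : List (ℕ × ℕ) := stabilizers.getD k []

def respects (t g c y a : ℕ) : Bool := Nat.beq (dirAt t (act g c y)) (dirOf g a)

/-- The symmetry given by `k` and `c` maps the `i`-th pattern to prescriptions that are respected by
the `j`-th direction function. -/
def moves (i j k c : ℕ) : Bool :=
  (pattern i).all fun q => respects (table j) (symmetry k) c q.1 q.2

/-- The first three prescriptions are common to all eleven patterns, so testing them once rejects an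
automorphism for all `i` simultaneously. -/
def checkMovesAux (j k c t g : ℕ) : Bool :=
  bif respects t g c 1 1 then
    bif respects t g c 2 2 then
      bif respects t g c 3 3 then
        (List.range 11).all fun i =>
          !moves i j k c || (Nat.beq i j && (stabilizer j).contains (k, c))
      else true
    else true
  else true

def checkMoves (j : ℕ) : Bool :=
  (List.range 360).all fun k => codewords.all fun c =>
    checkMovesAux j k c (table j) (symmetry k)

theorem checkMoves_eq_true : ∀ j < 11, checkMoves j = true := by decide +kernel

theorem mem_stabilizer_of_moves {i j k c : ℕ} (hi : i < 11) (hj : j < 11) (hk : k < 360)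
    (hc : c ∈ codewords) (h : moves i j k c = true) : i = j ∧ (k, c) ∈ stabilizer j := by
  have hmem : ∀ i < 11, (1, 1) ∈ pattern i ∧ (2, 2) ∈ pattern i ∧ (3, 3) ∈ pattern i := by decide
  obtain ⟨m1, m2, m3⟩ := hmem i hi
  have h1 := List.all_eq_true.1 h _ m1
  have h2 := List.all_eq_true.1 h _ m2
  have h3 := List.all_eq_true.1 h _ m3
  have hc := List.all_eq_true.1 (List.all_eq_true.1 (checkMoves_eq_true j hj) k
    (List.mem_range.2 hk)) c hc
  rw [checkMovesAux, h1, h2, h3, cond_true, cond_true, cond_true] at hc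
  have hi' := List.all_eq_true.1 hc i (List.mem_range.2 hi)
  rw [h, Bool.not_true, Bool.false_or, Bool.and_eq_true] at hi'
  exact ⟨Nat.eq_of_beq_eq_true hi'.1, List.contains_iff_mem.1 hi'.2⟩

def checkStabilizer (j : ℕ) : Bool :=
  (stabilizer j).all fun q => Nat.blt q.1 360 && codewords.contains q.2 && moves j j q.1 q.2

theorem checkStabilizer_eq_true : ∀ j < 11, checkStabilizer j = true := by decide +kernel

theorem moves_of_mem_stabilizer {j : ℕ} (hj : j < 11) {q : ℕ × ℕ} (hq : q ∈ stabilizer j) :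
    q.1 < 360 ∧ q.2 ∈ codewords ∧ moves j j q.1 q.2 = true := by
  have := List.all_eq_true.1 (checkStabilizer_eq_true j hj) q hq
  rw [Bool.and_eq_true, Bool.and_eq_true] at this
  exact ⟨Nat.le_of_ble_eq_true this.1.1, List.contains_iff_mem.1 this.1.2, this.2⟩

theorem card_stabilizer : ∀ j : Fin 11, (stabilizer j).toFinset.card =
    (![1, 1, 1, 1, 1, 1, 2, 3, 6, 6, 6] : Fin 11 → ℕ) j := by
  decide +kernel

/-- The pattern determines the direction function, so agreement of the pulled back function with
`rep i` on a few words forces agreement on all words outside the code. -/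
theorem moves_iff {i j k : ℕ} (hi : i < 11) (hj : j < 11) {c : Fin 5 → Fin 4}
    {p : Equiv.Perm (Fin 5)} {f : Fin 5 → Fin 4 ≃ Fin 4} (hpf : IsRealization k c p f) :
    moves i j k (idx c) = true ↔
      SimpleGraph.mapFamily (isotopy p f) (lineFamily modelCode (rep i)) =
        lineFamily modelCode (rep j) := by
  have hmoves : moves i j k (idx c) = true ↔
      Satisfies (pattern i) fun x => p.symm (rep j (isotopy p f x)) := by
    rw [moves, List.all_eq_true]
    refine forall₂_congr fun q hq => ?_
    have hq' := List.all_eq_true.1 (checkPattern_eq_true i hi) q hq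
    rw [Bool.and_eq_true, Bool.and_eq_true, Bool.not_eq_true'] at hq'
    obtain ⟨y, hy⟩ := exists_idx_eq (Nat.le_of_ble_eq_true hq'.1.1)
    have hyC : y ∉ modelCode := (not_bit_codeMask y).1 (hy ▸ hq'.1.2)
    have hd := hpf.dirOf_eq ⟨q.2, pattern_snd_lt i q hq⟩
    dsimp only at hd
    rw [respects, hd, ← hy, ← hpf.idx_eq, (dirAt_table hj ((hpf.mem_iff y).not.2 hyC)).1]
    constructor
    · intro h x _ hx
      have h := Fin.ext (Nat.eq_of_beq_eq_true h)
      dsimp only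
      rw [idx_injective hx, h, Equiv.symm_apply_apply]
    · intro h
      have h : p.symm (rep j (isotopy p f y)) = ⟨q.2, pattern_snd_lt i q hq⟩ :=
        Fin.ext (h y hyC rfl)
      rw [← h, Equiv.apply_symm_apply]
      exact Nat.beq_refl _
  rw [hmoves]
  constructor
  · intro h
    refine mapFamily_lineFamily p f hpf.mem_iff fun x hx => ?_
    rw [← eq_rep_of_satisfies hi ((isDirection_rep hj).pullback p f hpf.mem_iff) h hx,
      Equiv.apply_symm_apply]
  · intro h q hq x hx hxq
    -- The image partition has its own direction function, obtained by transport along the inverse;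
    -- uniqueness then compares it with `rep j`.
    have e : SimpleGraph.mapFamily (isotopy p f) (lineFamily modelCode (rep i)) =
        lineFamily modelCode fun y => p (rep i ((isotopy p f).symm y)) :=
      mapFamily_lineFamily p f hpf.mem_iff fun x _ => by rw [RelIso.symm_apply_apply]
    have := (isDirection_rep hj).eq_of_lineFamily_eq (e.symm.trans h)
      ((hpf.mem_iff x).not.2 hx)
    rw [RelIso.symm_apply_apply] at this
    dsimp only
    rw [← this, Equiv.symm_apply_apply]
    have hq' := List.all_eq_true.1 (checkPattern_eq_true i hi) q hq
    rw [Bool.and_eq_true] at hq'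
    rw [← (dirAt_table hi hx).1, hxq]
    exact Nat.eq_of_beq_eq_true hq'.2

/-! ### The group of automorphisms of the graph that preserve the model code -/

/-- The numbers of all automorphisms: a symmetry that fixes the zero word and a codeword. -/
def groupCodes : Finset (ℕ × ℕ) := Finset.range 360 ×ˢ codewords.toFinset

theorem card_groupCodes : groupCodes.card = 23040 := by
  have h : codewords.toFinset.card = 64 := by decide +kernel
  unfold groupCodes
  refine (Finset.card_product _ _).trans ?_
  rw [h, Finset.card_range]

theorem mem_groupCodes (q : ℕ × ℕ) : q ∈ groupCodes ↔ q.1 < 360 ∧ q.2 ∈ codewords := by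
  unfold groupCodes
  exact Finset.mem_product.trans (and_congr Finset.mem_range List.mem_toFinset)

attribute [irreducible] groupCodes

theorem exists_automorphism (q : groupCodes) :
    ∃ φ : hammingGraph (Fin 5) (Fin 4) ≃g hammingGraph (Fin 5) (Fin 4), ∃ c p f,
      φ = isotopy p f ∧ idx c = q.1.2 ∧ IsRealization q.1.1 c p f := by
  obtain ⟨h1, h2⟩ := (mem_groupCodes q.1).1 q.2
  have hc := bit_codeMask_of_mem h2
  obtain ⟨c, hc'⟩ := exists_idx_eq hc.1
  obtain ⟨p, f, h⟩ := exists_isRealization h1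
    ((bit_codeMask c).1 (hc' ▸ hc.2))
  exact ⟨_, c, p, f, rfl, hc', h⟩

/-- The automorphism with a given number. -/
noncomputable def automorphism (q : groupCodes) :
    hammingGraph (Fin 5) (Fin 4) ≃g hammingGraph (Fin 5) (Fin 4) :=
  (exists_automorphism q).choose

theorem automorphism_spec (q : groupCodes) : ∃ c p f,
    automorphism q = isotopy p f ∧ idx c = q.1.2 ∧ IsRealization q.1.1 c p f :=
  (exists_automorphism q).choose_spec

theorem idx_automorphism (q : groupCodes) (x : Fin 5 → Fin 4) :
    idx (automorphism q x) = act (symmetry q.1.1) q.1.2 (idx x) := by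
  obtain ⟨c, p, f, h, hc, hpf⟩ := automorphism_spec q
  rw [h, hpf.idx_eq, hc]

theorem automorphism_mem_iff (q : groupCodes) (x : Fin 5 → Fin 4) :
    automorphism q x ∈ modelCode ↔ x ∈ modelCode := by
  obtain ⟨c, p, f, h, hc, hpf⟩ := automorphism_spec q
  rw [h, hpf.mem_iff]

theorem act_eq_xor (g c y : ℕ) : act g c y = c ^^^ act g 0 y := by
  change c ^^^ _ = c ^^^ (0 ^^^ _)
  rw [Nat.zero_xor]

/-- The images of five words, which distinguish the symmetries that fix the zero word. -/
def signature (g : ℕ) : ℕ :=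
  Nat.add (act g 0 1) (Nat.mul 1024 (Nat.add (act g 0 4) (Nat.mul 1024 (Nat.add (act g 0 16)
    (Nat.mul 1024 (Nat.add (act g 0 64) (Nat.mul 1024 (act g 0 256))))))))

theorem signature_ne {k l : ℕ} (hk : k < 360) (hl : l < k) :
    signature (symmetry k) ≠ signature (symmetry l) := by
  have h : ((List.range 360).all fun k => (List.range k).all fun l =>
      !Nat.beq (signature (symmetry k)) (signature (symmetry l))) = true := by
    decide +kernel
  have := List.all_eq_true.1 (List.all_eq_true.1 h k (List.mem_range.2 hk)) l (List.mem_range.2 hl)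
  intro e
  rw [e, Nat.beq_refl] at this
  exact absurd this (by simp)

theorem act_symmetry_zero : ∀ k < 360, act (symmetry k) 0 0 = 0 := by decide +kernel

/-- The image of the zero word is the codeword; after removing this translation, the images of five
words tell the symmetries apart. -/
theorem automorphism_injective : Injective automorphism := by
  intro q r hqr
  have hq := ((mem_groupCodes q.1).1 q.2).1
  have hr := ((mem_groupCodes r.1).1 r.2).1
  have h : ∀ n < 1024, q.1.2 ^^^ act (symmetry q.1.1) 0 n = r.1.2 ^^^ act (symmetry r.1.1) 0 n := by
    intro n hn
    obtain ⟨x, rfl⟩ := exists_idx_eq hn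
    rw [← act_eq_xor, ← act_eq_xor, ← idx_automorphism, ← idx_automorphism, hqr]
  have h2 : q.1.2 = r.1.2 := by
    have := h 0 (by norm_num)
    rwa [act_symmetry_zero _ hq, act_symmetry_zero _ hr,
      Nat.xor_zero, Nat.xor_zero] at this
  have hs : signature (symmetry q.1.1) = signature (symmetry r.1.1) := by
    have e : ∀ n < 1024, act (symmetry q.1.1) 0 n = act (symmetry r.1.1) 0 n := by
      intro n hn
      have := h n hn
      rw [h2] at this
      exact Nat.xor_right_injective this
    rw [signature, signature, e 1 (by norm_num), e 4 (by norm_num), e 16 (by norm_num),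
      e 64 (by norm_num), e 256 (by norm_num)]
  have h1 : q.1.1 = r.1.1 := by
    rcases lt_trichotomy q.1.1 r.1.1 with hlt | heq | hlt
    · exact absurd hs.symm (signature_ne hr hlt)
    · exact heq
    · exact absurd hs (signature_ne hq hlt)
  exact Subtype.ext (Prod.ext h1 h2)

/-- Letter bijections that preserve the code and fix the zero word and one of its neighbours are
trivial. -/
theorem letters_eq_self {θ : Fin 5 → Fin 4 → Fin 4} (h0 : ∀ i, θ i 0 = 0) (h1 : θ 0 1 = 1)
    (hC : ∀ x ∈ modelCode, (fun i => θ i (x i)) ∈ modelCode) (i : Fin 5) (v : Fin 4) :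
    θ i v = v := by
  have xor0 : ∀ a : Fin 4, a ^^^ 0 = a := by decide
  have zero_xor : ∀ a : Fin 4, 0 ^^^ a = a := by decide
  have m2 : mulTwo 0 = 0 := rfl
  have m3 : mulThree 0 = 0 := rfl
  -- These three families of codewords of weight 3 force all five letter maps to coincide and the
  -- common map to satisfy the relations for multiplication by `w` and `w + 1`.
  have w2 : ∀ a : Fin 4, ![a, a, a, 0, 0] ∈ modelCode := by decide
  have w3 : ∀ a : Fin 4, ![a, mulTwo a, 0, a, 0] ∈ modelCode := by decide
  have w4 : ∀ a : Fin 4, ![a, mulThree a, 0, 0, a] ∈ modelCode := by decide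
  have e2 : ∀ a, θ 0 a = θ 2 a ∧ θ 1 a = θ 2 a := by
    intro a
    obtain ⟨h, h'⟩ := hC _ (w2 a)
    simp only [Matrix.cons_val, h0, xor0, m2, m3] at h h'
    exact ⟨h, h'⟩
  have e3 : ∀ a, θ 0 a = θ 3 a ∧ θ 1 (mulTwo a) = mulTwo (θ 3 a) := by
    intro a
    obtain ⟨h, h'⟩ := hC _ (w3 a)
    simp only [Matrix.cons_val, h0, xor0, zero_xor, m3] at h h'
    exact ⟨h, h'⟩
  have e4 : ∀ a, θ 0 a = θ 4 a ∧ θ 1 (mulThree a) = mulThree (θ 4 a) := by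
    intro a
    obtain ⟨h, h'⟩ := hC _ (w4 a)
    simp only [Matrix.cons_val, h0, xor0, zero_xor, m2] at h h'
    exact ⟨h, h'⟩
  have e1 : ∀ a, θ 1 a = θ 0 a := fun a => (e2 a).2.trans (e2 a).1.symm
  have key : ∀ a, θ 0 a = a := by
    intro a
    fin_cases a
    · exact h0 0
    · exact h1
    -- As 1 is fixed, so are `w * 1` and `(w + 1) * 1`.
    · have := (e3 1).2
      rw [e1, ← (e3 1).1, h1] at this
      exact this
    · have := (e4 1).2
      rw [e1, ← (e4 1).1, h1] at this
      exact this
  fin_cases i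
  · exact key v
  · exact (e1 v).trans (key v)
  · exact (e2 v).1.symm.trans (key v)
  · exact (e3 v).1.symm.trans (key v)
  · exact (e4 v).1.symm.trans (key v)

/-- The tuple `(a, b, c, d, e)` runs through the permutations of the positions, tuples with a
repetition being skipped at once, and `v` through the nonzero letters. -/
def checkTransitive : Bool :=
  (List.range 5).all fun a => (List.range 5).all fun b => Nat.beq a b ||
  (List.range 5).all fun c => Nat.beq a c || Nat.beq b c ||
  (List.range 5).all fun d => Nat.beq a d || Nat.beq b d || Nat.beq c d ||
  (List.range 5).all fun e => Nat.beq a e || Nat.beq b e || Nat.beq c e || Nat.beq d e ||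
  (List.range 4).all fun v => Nat.beq v 0 ||
  (List.range 360).any fun k =>
    Nat.beq (dirOf (symmetry k) 0) a && (Nat.beq (dirOf (symmetry k) 1) b &&
    (Nat.beq (dirOf (symmetry k) 2) c && (Nat.beq (dirOf (symmetry k) 3) d &&
    (Nat.beq (dirOf (symmetry k) 4) e && Nat.beq (letterOf (symmetry k) 0 1) v))))

theorem checkTransitive_eq_true : checkTransitive = true := by decide +kernel

/-- Every permutation of the positions is induced by a symmetry of the code, and the image of a
letter can be prescribed. -/
theorem exists_symmetry (p : Equiv.Perm (Fin 5)) {v : Fin 4} (hv : v ≠ 0) :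
    ∃ k < 360, (∀ i : Fin 5, dirOf (symmetry k) i = p i) ∧ letterOf (symmetry k) 0 1 = v := by
  have h := checkTransitive_eq_true
  have ne : ∀ i j : Fin 5, i ≠ j → Nat.beq (p i) (p j) = false := by
    intro i j hij
    by_contra h
    rw [Bool.not_eq_false] at h
    exact hij (p.injective (Fin.ext (Nat.eq_of_beq_eq_true h)))
  have nv : Nat.beq v 0 = false := by
    by_contra h
    rw [Bool.not_eq_false] at h
    exact hv (Fin.ext (Nat.eq_of_beq_eq_true h))
  rw [checkTransitive] at h
  have h := List.all_eq_true.1 h (p 0) (List.mem_range.2 (p 0).2)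
  have h := List.all_eq_true.1 h (p 1) (List.mem_range.2 (p 1).2)
  rw [ne 0 1 (by decide), Bool.false_or] at h
  have h := List.all_eq_true.1 h (p 2) (List.mem_range.2 (p 2).2)
  rw [ne 0 2 (by decide), ne 1 2 (by decide), Bool.false_or, Bool.false_or] at h
  have h := List.all_eq_true.1 h (p 3) (List.mem_range.2 (p 3).2)
  rw [ne 0 3 (by decide), ne 1 3 (by decide), ne 2 3 (by decide), Bool.false_or, Bool.false_or,
    Bool.false_or] at h
  have h := List.all_eq_true.1 h (p 4) (List.mem_range.2 (p 4).2)
  rw [ne 0 4 (by decide), ne 1 4 (by decide), ne 2 4 (by decide), ne 3 4 (by decide),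
    Bool.false_or, Bool.false_or, Bool.false_or, Bool.false_or] at h
  have h := List.all_eq_true.1 h v (List.mem_range.2 v.2)
  rw [nv, Bool.false_or] at h
  obtain ⟨k, hk, h⟩ := List.any_eq_true.1 h
  simp only [Bool.and_eq_true] at h
  obtain ⟨h0, h1, h2, h3, h4, h5⟩ := h
  refine ⟨k, List.mem_range.1 hk, fun i => ?_, Nat.eq_of_beq_eq_true h5⟩
  fin_cases i
  · exact Nat.eq_of_beq_eq_true h0
  · exact Nat.eq_of_beq_eq_true h1
  · exact Nat.eq_of_beq_eq_true h2
  · exact Nat.eq_of_beq_eq_true h3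
  · exact Nat.eq_of_beq_eq_true h4

/-- The automorphism is matched with a listed one having the same image of the zero word, the same
permutation of positions and the same image of the letter 1 in position 0. The two then differ by
letter bijections preserving the code, which `letters_eq_self` shows to be trivial. -/
theorem exists_automorphism_eq (φ : hammingGraph (Fin 5) (Fin 4) ≃g hammingGraph (Fin 5) (Fin 4))
    (hφ : ∀ x, φ x ∈ modelCode ↔ x ∈ modelCode) : ∃ q, automorphism q = φ := by
  obtain ⟨p, f, rfl⟩ := exists_eq_isotopy φ
  set o : Fin 5 → Fin 4 := fun _ => 0
  have ho : o ∈ modelCode := by decide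
  set c := isotopy p f o
  have hc : c ∈ modelCode := (hφ o).2 ho
  have hcf : ∀ i, c (p i) = f i 0 := fun i => isotopy_apply_perm p f o i
  have xor_ne : ∀ a b : Fin 4, b ≠ a → a ^^^ b ≠ 0 := by decide
  have xor_xor : ∀ a b : Fin 4, a ^^^ (a ^^^ b) = b := by decide
  have xor0 : ∀ a : Fin 4, a ^^^ 0 = a := by decide
  -- The image of the letter 1 is taken after undoing the translation by `c`; it is nonzero since `f
  -- 0` is injective.
  obtain ⟨k, hk, hdir, hlet⟩ := exists_symmetry p
    (xor_ne (c (p 0)) (f 0 1) (by rw [hcf]; exact (f 0).injective.ne (by decide)))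
  have hq : (k, idx c) ∈ groupCodes := (mem_groupCodes _).2
    ⟨hk, (idx_mem_codewords c).2 hc⟩
  refine ⟨⟨(k, idx c), hq⟩, ?_⟩
  obtain ⟨c', p', f', h, hc', hpf⟩ := automorphism_spec ⟨(k, idx c), hq⟩
  have hcc : c' = c := idx_injective hc'
  have hpp : p' = p := by
    ext i
    rw [← hdir i, ← hpf.dirOf_eq i]
  subst hcc hpp
  have hf0 : ∀ i, f' i 0 = f i 0 := by
    intro i
    rw [hpf.apply_eq, ← hcf i]
    have : (⟨letterOf (symmetry k) i (0 : Fin 4), letterOf_lt _ _ _⟩ : Fin 4) = 0 :=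
      Fin.ext (hpf.letterOf_zero i)
    rw [this, xor0]
  have hf1 : f' 0 1 = f 0 1 := by
    rw [hpf.apply_eq]
    have : (⟨letterOf (symmetry k) (0 : Fin 5) (1 : Fin 4), letterOf_lt _ _ _⟩ : Fin 4) =
        c (p' 0) ^^^ f 0 1 := Fin.ext hlet
    rw [this, xor_xor]
  have hff : f' = f := by
    funext i
    ext1 v
    have := letters_eq_self (θ := fun i v => (f' i).symm (f i v))
      (fun i => by rw [← hf0 i, Equiv.symm_apply_apply])
      (by rw [← hf1, Equiv.symm_apply_apply]) (fun x hx => by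
        have e : (fun i => (f' i).symm (f i (x i))) = (isotopy p' f').symm (isotopy p' f x) := by
          ext1 i
          rw [isotopy_symm_apply, isotopy_apply_perm]
        rw [e, ← hpf.mem_iff, RelIso.apply_symm_apply]
        exact (hφ x).2 hx) i v
    rw [← Equiv.apply_symm_apply (f' i) (f i v), this]
  rw [h, hff]

/-! ### Transport of clique partitions along isomorphisms of graphs -/

namespace SimpleGraph

variable {V W : Type*} {G : SimpleGraph V} {G' : SimpleGraph W}

/-- The image of a family of vertex sets under an isomorphism of graphs. -/
def imageFamily (ψ : G ≃g G') (P : Set (Finset V)) : Set (Finset W) :=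
  (fun A : Finset V => A.map ψ.toEquiv.toEmbedding) '' P

theorem imageFamily_trans {X : Type*} {G'' : SimpleGraph X} (ψ : G ≃g G') (χ : G' ≃g G'')
    (P : Set (Finset V)) : imageFamily χ (imageFamily ψ P) = imageFamily (ψ.trans χ) P := by
  rw [imageFamily, imageFamily, imageFamily, Set.image_image]
  congr 1
  funext A
  rw [Finset.map_map]
  rfl

theorem imageFamily_refl (P : Set (Finset V)) : imageFamily (RelIso.refl G.Adj) P = P :=
  mapFamily_one P

theorem IsCliquePartition.image {k : ℕ} {S : Set V} {S' : Set W} {P : Set (Finset V)}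
    (hP : G.IsCliquePartition k S P) (ψ : G ≃g G') (hS : ∀ x, ψ x ∈ S' ↔ x ∈ S) :
    G'.IsCliquePartition k S' (imageFamily ψ P) where
  isNClique := by
    rintro _ ⟨A, hA, rfl⟩
    refine ⟨?_, by rw [Finset.card_map]; exact (hP.isNClique A hA).card_eq⟩
    intro y hy z hz hyz
    obtain ⟨y, hy', rfl⟩ := Finset.mem_map.1 (Finset.mem_coe.1 hy)
    obtain ⟨z, hz', rfl⟩ := Finset.mem_map.1 (Finset.mem_coe.1 hz)
    exact ψ.map_adj_iff.2 ((hP.isNClique A hA).isClique hy' hz' fun e => hyz (by rw [e]))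
  subset := by
    rintro _ ⟨A, hA, rfl⟩ y hy
    obtain ⟨y, hy', rfl⟩ := Finset.mem_map.1 (Finset.mem_coe.1 hy)
    exact (hS y).2 (hP.subset A hA hy')
  existsUnique_mem := by
    intro y hy
    obtain ⟨x, rfl⟩ := ψ.surjective y
    obtain ⟨A, ⟨hA, hxA⟩, huniq⟩ := hP.existsUnique_mem x ((hS x).1 hy)
    refine ⟨_, ⟨⟨A, hA, rfl⟩, Finset.mem_map_of_mem ψ.toEquiv.toEmbedding hxA⟩, ?_⟩
    rintro _ ⟨⟨B, hB, rfl⟩, hxB⟩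
    obtain ⟨z, hz, e⟩ := Finset.mem_map.1 hxB
    have : z = x := ψ.injective e
    subst this
    rw [huniq B ⟨hB, hz⟩]

/-- Clique partitions correspond to each other under an isomorphism of graphs. -/
def cliquePartitionEquiv (ψ : G ≃g G') (k : ℕ) {S : Set V} {S' : Set W}
    (hS : ∀ x, ψ x ∈ S' ↔ x ∈ S) : G.CliquePartition k S ≃ G'.CliquePartition k S' where
  toFun P := ⟨imageFamily ψ P.1, P.2.image ψ hS⟩
  invFun Q := ⟨imageFamily ψ.symm Q.1, Q.2.image ψ.symm fun y => by
    rw [← hS, RelIso.apply_symm_apply]⟩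
  left_inv P := Subtype.ext <| by
    dsimp only
    rw [imageFamily_trans, RelIso.self_trans_symm, imageFamily_refl]
  right_inv Q := Subtype.ext <| by
    dsimp only
    rw [imageFamily_trans, RelIso.symm_trans_self, imageFamily_refl]

/-- Conjugation with an isomorphism of graphs. -/
def conjIso (ψ : G ≃g G') : (G ≃g G) ≃ (G' ≃g G') where
  toFun φ := (ψ.symm.trans φ).trans ψ
  invFun φ := (ψ.trans φ).trans ψ.symm
  left_inv φ := by ext x; simp
  right_inv φ := by ext x; simp

theorem mapFamily_conjIso (ψ : G ≃g G') (φ : G ≃g G) (P Q : Set (Finset V)) :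
    mapFamily (conjIso ψ φ) (imageFamily ψ P) = imageFamily ψ Q ↔ mapFamily φ P = Q := by
  have e : mapFamily (conjIso ψ φ) (imageFamily ψ P) = imageFamily ψ (mapFamily φ P) := by
    change imageFamily _ (imageFamily ψ P) = imageFamily ψ (imageFamily φ P)
    rw [imageFamily_trans, imageFamily_trans]
    congr 1
    ext x
    simp [conjIso]
  rw [e]
  constructor
  · intro h
    have := congrArg (imageFamily ψ.symm) h
    rwa [imageFamily_trans, imageFamily_trans, RelIso.self_trans_symm, imageFamily_refl,
      imageFamily_refl] at this
  · rintro rfl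
    rfl

theorem card_familyAut_image (ψ : G ≃g G') (P : Set (Finset V)) :
    Nat.card (G'.familyAut (imageFamily ψ P)) = Nat.card (G.familyAut P) :=
  Nat.card_congr ((conjIso ψ).subtypeEquiv fun φ => (mapFamily_conjIso ψ φ P P).symm).symm

theorem cliquePartitionSetoid_image_iff (ψ : G ≃g G') (k : ℕ) {S : Set V} {S' : Set W}
    (hS : ∀ x, ψ x ∈ S' ↔ x ∈ S) (P Q : G.CliquePartition k S) :
    G.cliquePartitionSetoid k S P Q ↔ G'.cliquePartitionSetoid k S'
      (cliquePartitionEquiv ψ k hS P) (cliquePartitionEquiv ψ k hS Q) := by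
  constructor
  · rintro ⟨φ, h⟩
    exact ⟨conjIso ψ φ, (mapFamily_conjIso ψ φ _ _).2 h⟩
  · rintro ⟨φ, h⟩
    obtain ⟨φ, rfl⟩ := (conjIso ψ).surjective φ
    exact ⟨φ, (mapFamily_conjIso ψ φ _ _).1 h⟩

/-- Equivalent clique partitions have automorphism groups of the same order. -/
theorem card_familyAut_eq {φ : G ≃g G} {P Q : Set (Finset V)} (h : mapFamily φ P = Q) :
    Nat.card (G.familyAut Q) = Nat.card (G.familyAut P) := by
  rw [← h]
  exact card_familyAut_image φ P

end SimpleGraph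

/-! ### The classification for the model code -/

section Model

open SimpleGraph

/-- The automorphisms of the graph that preserve the model code. -/
def codeGroup : Subgroup (hammingGraph (Fin 5) (Fin 4) ≃g hammingGraph (Fin 5) (Fin 4)) where
  carrier := {φ | ∀ x, φ x ∈ modelCode ↔ x ∈ modelCode}
  one_mem' _ := Iff.rfl
  mul_mem' {φ ψ} hφ hψ x := (hφ (ψ x)).trans (hψ x)
  inv_mem' {φ} hφ x := by
    have := hφ (φ⁻¹ x)
    rwa [RelIso.apply_inv_self, Iff.comm] at this

theorem card_codeGroup : Nat.card codeGroup = 23040 := by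
  have hb : Bijective fun q : groupCodes =>
      (⟨automorphism q, automorphism_mem_iff q⟩ : codeGroup) := by
    constructor
    · intro q r h
      exact automorphism_injective (congrArg Subtype.val h)
    · rintro ⟨φ, hφ⟩
      obtain ⟨q, rfl⟩ := exists_automorphism_eq φ hφ
      exact ⟨q, rfl⟩
  rw [← Nat.card_congr (Equiv.ofBijective _ hb), Nat.card_eq_fintype_card, Fintype.card_coe,
    card_groupCodes]

abbrev ModelPartition : Type := (hammingGraph (Fin 5) (Fin 4)).CliquePartition 4 modelCodeᶜ

instance : MulAction codeGroup ModelPartition where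
  smul φ P := ⟨mapFamily φ.1 P.1, P.2.image φ.1 fun x => (φ.2 x).not⟩
  one_smul P := Subtype.ext (mapFamily_one P.1)
  mul_smul φ ψ P := Subtype.ext (mapFamily_mul φ.1 ψ.1 P.1)

/-- A partition determines the set it covers, so nothing is lost by passing from all automorphisms
of the graph to those preserving the code. -/
theorem mem_codeGroup_of_mapFamily
    {φ : hammingGraph (Fin 5) (Fin 4) ≃g hammingGraph (Fin 5) (Fin 4)}
    {P Q : ModelPartition} (h : mapFamily φ P.1 = Q.1) : φ ∈ codeGroup :=
  fun x => not_iff_not.1 (P.2.apply_mem_iff Q.2 h x)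

/-- The eleven partitions. -/
def repPartition (i : Fin 11) : ModelPartition :=
  ⟨lineFamily modelCode (rep i), (isDirection_rep i.2).isCliquePartition⟩

/-- Lying in the orbit of one of the eleven partitions is invariant under the symmetries of the
code, so `direction_induction` applies to this property. -/
theorem exists_repPartition (P : ModelPartition) :
    ∃ i, ∃ φ : hammingGraph (Fin 5) (Fin 4) ≃g hammingGraph (Fin 5) (Fin 4),
      mapFamily φ (repPartition i).1 = P.1 := by
  obtain ⟨d, hd, hP⟩ := P.2.exists_direction
  rw [hP]
  refine direction_induction (Q := fun d => ∃ i,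
    ∃ φ : hammingGraph (Fin 5) (Fin 4) ≃g hammingGraph (Fin 5) (Fin 4),
      mapFamily φ (repPartition i).1 = lineFamily modelCode d) ?_ ?_ d hd
  · intro t ht d hd h
    refine ⟨⟨t, ht⟩, 1, ?_⟩
    rw [mapFamily_one]
    exact (lineFamily_congr fun x hx => eq_rep_of_satisfies ht hd h hx).symm
  · rintro d p f hC hd ⟨i, φ, h⟩
    refine ⟨i, isotopy p f * φ, ?_⟩
    rw [mapFamily_mul, h]
    exact mapFamily_lineFamily p f hC fun x _ => (Equiv.apply_symm_apply p _).symm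

theorem mapFamily_automorphism_iff {i j : Fin 11} (q : groupCodes) :
    mapFamily (automorphism q) (repPartition i).1 = (repPartition j).1 ↔
      moves i j q.1.1 q.1.2 = true := by
  obtain ⟨c, p, f, h, hc, hpf⟩ := automorphism_spec q
  rw [h, ← hc]
  exact (moves_iff i.2 j.2 hpf).symm

theorem eq_of_mapFamily_repPartition {i j : Fin 11}
    {φ : hammingGraph (Fin 5) (Fin 4) ≃g hammingGraph (Fin 5) (Fin 4)}
    (h : mapFamily φ (repPartition i).1 = (repPartition j).1) : i = j := by
  obtain ⟨q, rfl⟩ := exists_automorphism_eq φ (mem_codeGroup_of_mapFamily h)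
  have hq := (mem_groupCodes q.1).1 q.2
  exact Fin.ext (mem_stabilizer_of_moves i.2 j.2 hq.1 hq.2 ((mapFamily_automorphism_iff q).1 h)).1

theorem card_familyAut_repPartition (i : Fin 11) :
    Nat.card ((hammingGraph (Fin 5) (Fin 4)).familyAut (repPartition i).1) =
      (![1, 1, 1, 1, 1, 1, 2, 3, 6, 6, 6] : Fin 11 → ℕ) i := by
  have hmem : ∀ r : (stabilizer i).toFinset, r.1 ∈ groupCodes := fun r => by
    have := moves_of_mem_stabilizer i.2 (List.mem_toFinset.1 r.2)
    exact (mem_groupCodes _).2 ⟨this.1, this.2.1⟩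
  have hb : Bijective fun r : (stabilizer i).toFinset =>
      (⟨automorphism ⟨r.1, hmem r⟩, (mapFamily_automorphism_iff _).2
        (moves_of_mem_stabilizer i.2 (List.mem_toFinset.1 r.2)).2.2⟩ :
        (hammingGraph (Fin 5) (Fin 4)).familyAut (repPartition i).1) := by
    constructor
    · intro r s h
      have h' : automorphism ⟨r.1, hmem r⟩ = automorphism ⟨s.1, hmem s⟩ := congrArg Subtype.val h
      exact Subtype.ext (Subtype.mk.inj (automorphism_injective h'))
    · rintro ⟨φ, hφ⟩
      have hφ' : mapFamily φ (repPartition i).1 = (repPartition i).1 := hφ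
      obtain ⟨q, rfl⟩ := exists_automorphism_eq φ (mem_codeGroup_of_mapFamily hφ')
      have hq := (mem_groupCodes q.1).1 q.2
      have := (mem_stabilizer_of_moves i.2 i.2 hq.1 hq.2
        ((mapFamily_automorphism_iff q).1 hφ')).2
      exact ⟨⟨q.1, List.mem_toFinset.2 this⟩, rfl⟩
  rw [← Nat.card_congr (Equiv.ofBijective _ hb), Nat.card_eq_fintype_card, Fintype.card_coe,
    card_stabilizer]

theorem card_orbit_mul (i : Fin 11) :
    Nat.card (MulAction.orbit codeGroup (repPartition i)) *
      (![1, 1, 1, 1, 1, 1, 2, 3, 6, 6, 6] : Fin 11 → ℕ) i = 23040 := by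
  rw [← card_familyAut_repPartition, ← card_codeGroup,
    ← Nat.card_congr (MulAction.orbitProdStabilizerEquivGroup codeGroup (repPartition i)),
    Nat.card_prod]
  congr 1
  -- The stabilizer inside `codeGroup` is the full automorphism group of the partition, whose
  -- elements preserve the code anyway.
  refine Nat.card_congr
    { toFun := fun φ => ⟨⟨φ.1, mem_codeGroup_of_mapFamily (P := repPartition i)
        (Q := repPartition i) φ.2⟩, Subtype.ext φ.2⟩
      invFun := fun φ => ⟨φ.1.1, congrArg Subtype.val φ.2⟩
      left_inv := fun _ => rfl
      right_inv := fun _ => rfl }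

theorem card_modelPartition : Nat.card ModelPartition = 168960 := by
  -- The eleven orbits are disjoint and cover all partitions.
  have hb : Bijective fun r : Σ i : Fin 11, MulAction.orbit codeGroup (repPartition i) =>
      (r.2.1 : ModelPartition) := by
    constructor
    · rintro ⟨i, _, φ, rfl⟩ ⟨j, _, ψ, rfl⟩ h
      have h' : φ • repPartition i = ψ • repPartition j := h
      have hij : i = j := by
        refine eq_of_mapFamily_repPartition (φ := (ψ⁻¹ * φ).1) ?_
        have : (ψ⁻¹ * φ) • repPartition i = repPartition j := by
          rw [mul_smul, h', inv_smul_smul]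
        exact congrArg Subtype.val this
      subst hij
      simp only [Sigma.mk.injEq, heq_eq_eq, true_and]
      exact Subtype.ext h'
    · intro P
      obtain ⟨i, φ, h⟩ := exists_repPartition P
      exact ⟨⟨i, P, ⟨φ, mem_codeGroup_of_mapFamily h⟩, Subtype.ext h⟩, rfl⟩
  have : ∀ i : Fin 11, Finite (MulAction.orbit codeGroup (repPartition i)) := by
    intro i
    refine Nat.finite_of_card_ne_zero fun h => ?_
    have := card_orbit_mul i
    rw [h, zero_mul] at this
    norm_num at this
  rw [← Nat.card_congr (Equiv.ofBijective _ hb), Nat.card_sigma]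
  have hcard : ∀ i : Fin 11, Nat.card (MulAction.orbit codeGroup (repPartition i)) =
      (![23040, 23040, 23040, 23040, 23040, 23040, 11520, 7680, 3840, 3840, 3840] : Fin 11 → ℕ) i := by
    have pos : ∀ i, 0 < (![1, 1, 1, 1, 1, 1, 2, 3, 6, 6, 6] : Fin 11 → ℕ) i := by decide
    intro i
    refine Nat.eq_of_mul_eq_mul_right (pos i) ((card_orbit_mul i).trans ?_)
    fin_cases i <;> rfl
  rw [Finset.sum_congr rfl fun i _ => hcard i]
  rfl

theorem repPartition_bijective : Bijective fun i : Fin 11 => (Quotient.mk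
    ((hammingGraph (Fin 5) (Fin 4)).cliquePartitionSetoid 4 modelCodeᶜ) (repPartition i)) := by
  constructor
  · intro i j h
    obtain ⟨φ, hφ⟩ := Quotient.exact h
    exact eq_of_mapFamily_repPartition hφ
  · intro Q
    induction Q using Quotient.inductionOn with
    | _ P =>
      obtain ⟨i, φ, h⟩ := exists_repPartition P
      exact ⟨i, Quotient.sound ⟨φ, h⟩⟩

end Model

/-! ### Transfer from the model to an arbitrary code -/

theorem mainTheorem6 {F : Type*} [Field F] [DecidableEq F] (hF : Nat.card F = 4)
    (C : Submodule F (Fin 5 → F)) (hC : IsLinearCode 3 3 C) :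
    Nat.card ((hammingGraph (Fin 5) F).CliquePartition 4 (C : Set (Fin 5 → F))ᶜ) = 168960 ∧
    ∃ e : Fin 11 ≃ Quotient
        ((hammingGraph (Fin 5) F).cliquePartitionSetoid 4 (C : Set (Fin 5 → F))ᶜ),
      ∀ (i : Fin 11)
        (P : (hammingGraph (Fin 5) F).CliquePartition 4 (C : Set (Fin 5 → F))ᶜ),
        Quotient.mk _ P = e i →
          Nat.card ((hammingGraph (Fin 5) F).familyAut P.1) =
            (![1, 1, 1, 1, 1, 1, 2, 3, 6, 6, 6] : Fin 11 → ℕ) i := by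
  obtain ⟨f, hf⟩ := hC.exists_isotopy hF
  have hS : ∀ x, isotopy 1 f x ∈ modelCodeᶜ ↔ x ∈ (C : Set (Fin 5 → F))ᶜ := fun x => (hf x).not
  let Φ := SimpleGraph.cliquePartitionEquiv (isotopy 1 f) 4 hS
  refine ⟨(Nat.card_congr Φ).trans card_modelPartition, ?_⟩
  let eQ : Quotient ((hammingGraph (Fin 5) F).cliquePartitionSetoid 4 (C : Set (Fin 5 → F))ᶜ) ≃
      Quotient ((hammingGraph (Fin 5) (Fin 4)).cliquePartitionSetoid 4 modelCodeᶜ) :=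
    Quotient.congr Φ (SimpleGraph.cliquePartitionSetoid_image_iff (isotopy 1 f) 4 hS)
  refine ⟨(Equiv.ofBijective _ repPartition_bijective).trans eQ.symm, fun i P hP => ?_⟩
  have h : eQ (Quotient.mk _ P) = Quotient.mk _ (repPartition i) := by
    rw [hP, Equiv.trans_apply, Equiv.apply_symm_apply]
    rfl
  -- The transported partition lies in the class of the `i`-th representative; the order of the
  -- automorphism group is invariant both under equivalence and under the transport.
  obtain ⟨φ, hφ⟩ := Quotient.exact (h.symm : Quotient.mk _ (repPartition i) = Quotient.mk _ (Φ P))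
  rw [← card_familyAut_repPartition i, ← SimpleGraph.card_familyAut_eq hφ]
  exact (SimpleGraph.card_familyAut_image (isotopy 1 f) P.1).symm
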